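/- Conventions. All Hilbert spaces are complex and separable. $\mathcal T(\mathcal H)$ denotes the trace-class operators (those with $\|A\|_1=\operatorname{Tr}\sqrt{A^\dagger A}<\infty$), $\mathcal D(\mathcal H)$ the density operators, and $F(\rho,\sigma)=\|\sqrt\rho\sqrt\sigma\|_1^2$ the fidelity. A quantum channel $\mathcal T(\mathcal H)\to\mathcal T(\mathcal K)$ is a completely positive, trace-preserving linear map. If $\mathcal N(\tau)=\operatorname{Tr}_E\{U\tau U^\dagger\}$ with an isometry $U:\mathcal H_A\to\mathcal H_B\otimes\mathcal H_E$, then $\hat{\mathcal N}(\tau)=\operatorname{Tr}_B\{U\tau U^\dagger\}$ is called a complementary channel of $\mathcal N$. An energy observable $G$ on $\mathcal H_A$ is a (possibly unbounded) operator $G=\sum_j g_j|e_j\rangle\langle e_j|$ with an orthonormal basis $\{|e_j\rangle\}_j$ of $\mathcal H_A$ and $g_j\ge 0$; one sets $\operatorname{Tr}\{G\rho\}=\sup_k\operatorname{Tr}\{\Pi_kG\Pi_k\rho\}\in[0,\infty]$, where $\Pi_k$ is the spectral projection of $G$ for $[0,k]$, and $\overline G_n=\frac1n(G\otimes I\otimes\cdots\otimes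 I+\cdots+I\otimes\cdots\otimes I\otimes G)$ on $\mathcal H_A^{\otimes n}$. Codes. Let $\mathcal N:\mathcal T(\mathcal H_A)\to\mathcal T(\mathcal H_B)$ be a channel, $\hat{\mathcal N}$ a complementary channel, $G$ an energy observable on $\mathcal H_A$ and $P\ge0$. Let $\mathcal H_S=\mathcal H_R=\mathbb C^M$, let $\pi_S=I_S/M$ and let $\Phi_{RS}=\frac1M\sum_{m,m'}|m\rangle\langle m'|_R\otimes|m\rangle\langle m'|_S$. (Q) An $(n,M,G,P,\varepsilon)$ quantum communication code with uniform energy constraint consists of channels $\mathcal E:\mathcal T(\mathcal H_S)\to\mathcal T(\mathcal H_A^{\otimes n})$ and $\mathcal D:\mathcal T(\mathcal H_B^{\otimes n})\to\mathcal T(\mathcal H_S)$ such that $\operatorname{Tr}\{\overline G_n\mathcal E(\rho)\}\le P$ for all $\rho\in\mathcal D(\mathcal H_S)$ and $F(\phi,(\mathrm{id}_R\otimes\mathcal D\circ\mathcal N^{\otimes n}\circ\mathcal E)(\phi))\ge1-\varepsilon$ for all pure states $\phi$ of $\mathcal H_R\otimes\mathcal H_S$. (E) An entanglement transmission code with average energy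 constraint is defined in the same way, but the energy bound is required only for $\rho=\pi_S$ and the fidelity bound only for $\phi=\Phi_{RS}$. (P) An $(n,M,G,P,\varepsilon)$ private communication code with uniform energy constraint consists of states $\rho^1,\dots,\rho^M\in\mathcal D(\mathcal H_A^{\otimes n})$ and a POVM $\{\Lambda^m\}_{m=1}^M$ on $\mathcal H_B^{\otimes n}$ such that, for some state $\omega\in\mathcal D(\mathcal H_E^{\otimes n})$ and all $m$, $\operatorname{Tr}\{\overline G_n\rho^m\}\le P$, $\operatorname{Tr}\{\Lambda^m\mathcal N^{\otimes n}(\rho^m)\}\ge1-\varepsilon$ and $\frac12\|\hat{\mathcal N}^{\otimes n}(\rho^m)-\omega\|_1\le\varepsilon$. (K) A secret key transmission code with average energy constraint is defined in the same way, but each of the three bounds is required only for the average $\frac1M\sum_{m=1}^M$ of its left-hand side. A rate $R\in\mathbb R$ is achievable for one of these kinds of codes if for all $\varepsilon\in(0,1)$, all $\delta>0$ and all sufficiently large $n$ there is an $(n,M,G,P,\varepsilon)$ code of that kind with integer $M\ge2^{n(R-\delta)}$. The capacities $Q(\mathcal N,G,P)$, $E(\mathcal N,G,P)$, $P(\mathcal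 N,G,P)$ and $K(\mathcal N,G,P)$ are the suprema, in $[-\infty,\infty]$, of the achievable rates for (Q), (E), (P) and (K), respectively. Theorem. Let $\mathcal N:\mathcal T(\mathcal H_A)\to\mathcal T(\mathcal H_B)$ be a quantum channel, $G$ an energy observable on $\mathcal H_A$ and $P\in[0,\infty)$. Then, for every choice of the complementary channel $\hat{\mathcal N}$, $$Q(\mathcal N,G,P)=E(\mathcal N,G,P)\le P(\mathcal N,G,P)=K(\mathcal N,G,P).$$ -/

import Mathlib

namespace QCap

noncomputable section

open scoped InnerProductSpace ENNReal TensorProduct ComplexOrder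
open Filter

/-! ### Trace norm and trace-class operators -/

section TraceClass

variable {H : Type*} [NormedAddCommGroup H] [InnerProductSpace ℂ H] [CompleteSpace H]

/-- The index set of a fixed orthonormal basis of `H`. -/
def basisIndex (H : Type*) [NormedAddCommGroup H] [InnerProductSpace ℂ H] [CompleteSpace H] :
    Set H := (exists_hilbertBasis ℂ H).choose

/-- A fixed orthonormal basis of the Hilbert space `H`. -/
def fixedBasis (H : Type*) [NormedAddCommGroup H] [InnerProductSpace ℂ H] [CompleteSpace H] :
    HilbertBasis (basisIndex H) ℂ H := (exists_hilbertBasis ℂ H).choose_spec.choose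

/-- The trace, in `[0, ∞]`, of a positive bounded operator. -/
def posTrace (T : H →L[ℂ] H) : ℝ≥0∞ :=
  ∑' i, ENNReal.ofReal (⟪fixedBasis H i, T (fixedBasis H i)⟫_ℂ).re

/-- The trace norm `‖A‖₁ = Tr |A|`, in `[0, ∞]`, where `|A| = √(A† A)`. -/
def traceNorm (A : H →L[ℂ] H) : ℝ≥0∞ := posTrace (CFC.abs A)

lemma tsum_enorm_inner_sq {ι : Type*} (b : HilbertBasis ι ℂ H) (x : H) :
    ∑' i, ‖⟪b i, x⟫_ℂ‖ₑ ^ 2 = ‖x‖ₑ ^ 2 := by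
  have h2 : HasSum (fun i => ‖⟪b i, x⟫_ℂ‖ ^ 2) (‖x‖ ^ 2) := by
    have := Complex.hasSum_re (b.hasSum_inner_mul_inner x x)
    convert this using 1
    · ext i
      rw [← inner_conj_symm x (b i), ← Complex.normSq_eq_conj_mul_self, Complex.ofReal_re,
        Complex.normSq_eq_norm_sq]
    · exact (inner_self_eq_norm_sq (𝕜 := ℂ) x).symm
  have h3 := ENNReal.ofReal_tsum_of_nonneg (fun i => by positivity) h2.summable
  rw [h2.tsum_eq] at h3
  simpa [ENNReal.ofReal_pow, ofReal_norm] using h3.symm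

/-- The Hilbert--Schmidt norms of an operator and of its adjoint agree. -/
lemma tsum_enorm_adjoint_sq {ι : Type*} (b : HilbertBasis ι ℂ H) (T : H →L[ℂ] H) :
    ∑' i, ‖ContinuousLinearMap.adjoint T (b i)‖ₑ ^ 2 = ∑' i, ‖T (b i)‖ₑ ^ 2 := by
  calc ∑' i, ‖ContinuousLinearMap.adjoint T (b i)‖ₑ ^ 2
      = ∑' i, ∑' j, ‖⟪b j, ContinuousLinearMap.adjoint T (b i)⟫_ℂ‖ₑ ^ 2 := by
        simp_rw [tsum_enorm_inner_sq]
    _ = ∑' j, ∑' i, ‖⟪b j, ContinuousLinearMap.adjoint T (b i)⟫_ℂ‖ₑ ^ 2 := ENNReal.tsum_comm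
    _ = ∑' j, ∑' i, ‖⟪b i, T (b j)⟫_ℂ‖ₑ ^ 2 := by
        congr 1; ext j; congr 1; ext i
        rw [ContinuousLinearMap.adjoint_inner_right, ← inner_conj_symm (T (b j)) (b i),
          RCLike.enorm_conj]
    _ = _ := by simp_rw [tsum_enorm_inner_sq]

/-- If `‖f x‖ ≤ ‖e x‖` for all `x`, then `f = W e` for a contraction `W`. -/
lemma exists_contraction (f e : H →L[ℂ] H) (h : ∀ x, ‖f x‖ ≤ ‖e x‖) :
    ∃ W : H →L[ℂ] H, (∀ y, ‖W y‖ ≤ ‖y‖) ∧ W * e = f := by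
  set K : Submodule ℂ H := (LinearMap.range (e : H →ₗ[ℂ] H)).topologicalClosure with hK
  have : CompleteSpace K := (Submodule.isClosed_topologicalClosure _).completeSpace_coe
  let e' : H →ₗ[ℂ] K := (e : H →ₗ[ℂ] H).codRestrict K
    (fun x => Submodule.le_topologicalClosure _ ⟨x, rfl⟩)
  have hd : DenseRange e' := by
    intro y
    rw [closure_subtype]
    have : (Subtype.val '' Set.range e' : Set H) = LinearMap.range (e : H →ₗ[ℂ] H) := by
      ext z; simp [e']
    rw [this]
    exact y.2
  have hn : ∀ x, ‖(f : H →ₗ[ℂ] H) x‖ ≤ 1 * ‖e' x‖ := fun x => by simpa [e'] using h x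
  let W0 := (f : H →ₗ[ℂ] H).extendOfNorm e'
  refine ⟨W0 ∘L K.orthogonalProjectionOnto, fun y => ?_, ?_⟩
  · calc ‖W0 (K.orthogonalProjectionOnto y)‖ ≤ 1 * ‖K.orthogonalProjectionOnto y‖ :=
          LinearMap.norm_extendOfNorm_apply_le hd 1 hn _
      _ ≤ ‖y‖ := by rw [one_mul]; exact K.norm_orthogonalProjectionOnto_apply_le y
  · ext x
    have h1 : K.orthogonalProjectionOnto (e x) = e' x :=
      K.orthogonalProjectionOnto_mem_subspace_eq_self (e' x)
    simp only [mul_apply_eq_comp, ContinuousLinearMap.comp_apply, h1]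
    exact LinearMap.extendOfNorm_eq hd ⟨1, hn⟩ x

lemma norm_abs_apply (A : H →L[ℂ] H) (x : H) : ‖CFC.abs A x‖ = ‖A x‖ := by
  have h1 : ‖CFC.abs A x‖ ^ 2 = ‖A x‖ ^ 2 := by
    have h := CFC.abs_mul_abs A
    have hs : ContinuousLinearMap.adjoint (CFC.abs A) = CFC.abs A :=
      (IsSelfAdjoint.of_nonneg (CFC.abs_nonneg A)).star_eq
    have e1 : (⟪CFC.abs A x, CFC.abs A x⟫_ℂ) = ⟪A x, A x⟫_ℂ := by
      rw [← ContinuousLinearMap.adjoint_inner_right, hs, ← mul_apply_eq_comp, h,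
        mul_apply_eq_comp, ContinuousLinearMap.star_eq_adjoint,
        ContinuousLinearMap.adjoint_inner_right]
    rw [inner_self_eq_norm_sq_to_K, inner_self_eq_norm_sq_to_K] at e1
    exact_mod_cast e1
  exact (pow_left_inj₀ (norm_nonneg _) (norm_nonneg _) two_ne_zero).1 h1

lemma posTrace_eq_tsum_sqrt (T : H →L[ℂ] H) (hT : 0 ≤ T) :
    posTrace T = ∑' i, ‖CFC.sqrt T (fixedBasis H i)‖ₑ ^ 2 := by
  unfold posTrace
  congr 1; ext i
  have hs : ContinuousLinearMap.adjoint (CFC.sqrt T) = CFC.sqrt T :=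
    (IsSelfAdjoint.of_nonneg (CFC.sqrt_nonneg T)).star_eq
  have e1 : (⟪fixedBasis H i, T (fixedBasis H i)⟫_ℂ) =
      ⟪CFC.sqrt T (fixedBasis H i), CFC.sqrt T (fixedBasis H i)⟫_ℂ := by
    conv_lhs => rw [← CFC.sqrt_mul_sqrt_self T]
    rw [mul_apply_eq_comp, ← ContinuousLinearMap.adjoint_inner_left, hs]
  have e2 : ∀ y : H, (⟪y, y⟫_ℂ).re = ‖y‖ ^ 2 := inner_self_eq_norm_sq (𝕜 := ℂ)
  rw [e1, e2, ENNReal.ofReal_pow (norm_nonneg _), ofReal_norm]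

lemma tsum_enorm_inner_le_traceNorm (A W : H →L[ℂ] H) (hW : ∀ y, ‖W y‖ ≤ ‖y‖) :
    ∑' i, ‖⟪fixedBasis H i, W (A (fixedBasis H i))⟫_ℂ‖ₑ ≤ traceNorm A := by
  obtain ⟨V, hV, hVA⟩ := exists_contraction A (CFC.abs A) (fun x => (norm_abs_apply A x).ge)
  set S := CFC.sqrt (CFC.abs A) with hS
  have hs : ContinuousLinearMap.adjoint S = S :=
    (IsSelfAdjoint.of_nonneg (CFC.sqrt_nonneg _)).star_eq
  have hSS : S * S = CFC.abs A := CFC.sqrt_mul_sqrt_self _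
  set Z : H →L[ℂ] H := W * V * S with hZ
  have hZn : ∀ y, ‖Z y‖ ≤ ‖S y‖ := fun y => (hW _).trans (hV _)
  have key : ∀ x : H, ‖⟪x, W (A x)⟫_ℂ‖ₑ
      ≤ 2⁻¹ * (‖ContinuousLinearMap.adjoint Z x‖ₑ ^ 2 + ‖S x‖ₑ ^ 2) := by
    intro x
    have e1 : W (A x) = Z (S x) := by
      rw [← hVA, ← hSS]; rfl
    rw [e1, ← ContinuousLinearMap.adjoint_inner_left]
    have h1 := norm_inner_le_norm (𝕜 := ℂ) (ContinuousLinearMap.adjoint Z x) (S x)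
    have h2 : ‖⟪ContinuousLinearMap.adjoint Z x, S x⟫_ℂ‖ ≤
        2⁻¹ * (‖ContinuousLinearMap.adjoint Z x‖ ^ 2 + ‖S x‖ ^ 2) := by
      nlinarith [sq_nonneg (‖ContinuousLinearMap.adjoint Z x‖ - ‖S x‖)]
    have h3 := ENNReal.ofReal_le_ofReal h2
    rw [ENNReal.ofReal_mul (by norm_num), ENNReal.ofReal_add (by positivity) (by positivity),
      ENNReal.ofReal_pow (norm_nonneg _), ENNReal.ofReal_pow (norm_nonneg _),
      ofReal_norm, ofReal_norm, ofReal_norm, ENNReal.ofReal_inv_of_pos (by norm_num)] at h3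
    simpa using h3
  have hT : traceNorm A = ∑' i, ‖S (fixedBasis H i)‖ₑ ^ 2 :=
    posTrace_eq_tsum_sqrt _ (CFC.abs_nonneg A)
  calc ∑' i, ‖⟪fixedBasis H i, W (A (fixedBasis H i))⟫_ℂ‖ₑ
      ≤ ∑' i, 2⁻¹ * (‖ContinuousLinearMap.adjoint Z (fixedBasis H i)‖ₑ ^ 2
          + ‖S (fixedBasis H i)‖ₑ ^ 2) := ENNReal.tsum_le_tsum fun i => key _
    _ = 2⁻¹ * (∑' i, ‖Z (fixedBasis H i)‖ₑ ^ 2 + ∑' i, ‖S (fixedBasis H i)‖ₑ ^ 2) := by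
        rw [ENNReal.tsum_mul_left, ENNReal.tsum_add, tsum_enorm_adjoint_sq]
    _ ≤ 2⁻¹ * (traceNorm A + traceNorm A) := by
        rw [hT]
        gcongr
        rw [← ofReal_norm, ← ofReal_norm]
        exact ENNReal.ofReal_le_ofReal (hZn _)
    _ = traceNorm A := by
        rw [← two_mul, ← mul_assoc, ENNReal.inv_mul_cancel (by norm_num) (by norm_num), one_mul]

lemma traceNorm_add_le (A B : H →L[ℂ] H) : traceNorm (A + B) ≤ traceNorm A + traceNorm B := by
  obtain ⟨W, hW, hWC⟩ := exists_contraction (CFC.abs (A + B)) (A + B)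
    (fun x => (norm_abs_apply (A + B) x).le)
  refine le_trans ?_ (add_le_add (tsum_enorm_inner_le_traceNorm A W hW)
    (tsum_enorm_inner_le_traceNorm B W hW))
  rw [← ENNReal.tsum_add]
  refine ENNReal.tsum_le_tsum fun i => ?_
  have e1 : CFC.abs (A + B) (fixedBasis H i)
      = W (A (fixedBasis H i)) + W (B (fixedBasis H i)) := by
    rw [← hWC]; simp
  rw [e1, inner_add_right]
  refine le_trans ?_ (enorm_add_le _ _)
  rw [← ofReal_norm]
  exact ENNReal.ofReal_le_ofReal (Complex.re_le_norm _)

lemma traceNorm_zero : traceNorm (0 : H →L[ℂ] H) = 0 := by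
  simp [traceNorm, posTrace]

lemma traceNorm_smul (c : ℂ) (A : H →L[ℂ] H) : traceNorm (c • A) = ‖c‖ₑ * traceNorm A := by
  unfold traceNorm posTrace
  rw [CFC.abs_smul, ← ENNReal.tsum_mul_left]
  congr 1; ext i
  rw [smul_apply, inner_smul_right_eq_smul, Complex.smul_re, smul_eq_mul,
    ENNReal.ofReal_mul (norm_nonneg _), ofReal_norm]

/-- The space `𝒯(H)` of trace-class operators on `H`. -/
def TraceClass (H : Type*) [NormedAddCommGroup H] [InnerProductSpace ℂ H] [CompleteSpace H] :
    Submodule ℂ (H →L[ℂ] H) where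
  carrier := {A | traceNorm A < ∞}
  add_mem' {A B} hA hB := (traceNorm_add_le A B).trans_lt (ENNReal.add_lt_top.2 ⟨hA, hB⟩)
  zero_mem' := by simp [traceNorm_zero]
  smul_mem' c A hA := by
    simp only [Set.mem_ofPred_eq, traceNorm_smul]
    exact ENNReal.mul_lt_top enorm_lt_top hA

lemma mem_traceClass_of_finiteDimensional [FiniteDimensional ℂ H] (A : H →L[ℂ] H) :
    A ∈ TraceClass H := by
  have : Finite (basisIndex H) :=
    (fixedBasis H).orthonormal.linearIndependent.finite
  have := Fintype.ofFinite (basisIndex H)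
  change posTrace _ < ∞
  rw [posTrace, tsum_fintype]
  exact ENNReal.sum_lt_top.2 fun i _ => ENNReal.ofReal_lt_top

end TraceClass

/-! ### Hilbert-space tensor powers -/

/-- The `n`-fold Hilbert-space tensor power `H^{⊗n}`, realized as the space of square-summable
families of coefficients with respect to the products of the vectors of `fixedBasis H`. -/
abbrev TensorPow (H : Type*) [NormedAddCommGroup H] [InnerProductSpace ℂ H] [CompleteSpace H]
    (n : ℕ) : Type _ :=
  lp (fun _ : Fin n → basisIndex H => ℂ) 2

section TensorPow

lemma hasSum_prod_pi {ι : Type*} (n : ℕ) (F : Fin n → ι → ℂ) (hF : ∀ i, Summable fun j => ‖F i j‖) :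
    (Summable fun f : Fin n → ι => ‖∏ i, F i (f i)‖) ∧
    HasSum (fun f : Fin n → ι => ∏ i, F i (f i)) (∏ i, ∑' j, F i j) := by
  induction n with
  | zero =>
    refine ⟨(hasSum_fintype _).summable, ?_⟩
    simp
  | succ n ih =>
    obtain ⟨h1, h2⟩ := ih (fun i => F i.succ) (fun i => hF _)
    let e : (Fin (n + 1) → ι) ≃ ι × (Fin n → ι) := (Fin.consEquiv (fun _ => ι)).symm
    have hs := (hF 0).mul_norm h1
    have hsm : Summable fun p : ι × (Fin n → ι) => F 0 p.1 * ∏ i : Fin n, F i.succ (p.2 i) :=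
      summable_mul_of_summable_norm (f := F 0)
        (g := fun f : Fin n → ι => ∏ i : Fin n, F i.succ (f i)) (hF 0) h1
    have hh : HasSum (fun p : ι × (Fin n → ι) => F 0 p.1 * ∏ i : Fin n, F i.succ (p.2 i))
        ((∑' j, F 0 j) * ∏ i : Fin n, ∑' j, F i.succ j) :=
      HasSum.mul (f := F 0) (g := fun f : Fin n → ι => ∏ i : Fin n, F i.succ (f i))
        (hF 0).of_norm.hasSum h2 hsm
    constructor
    · rw [← e.symm.summable_iff]
      refine hs.congr fun p => ?_
      simp [e, Fin.prod_univ_succ, Fin.consEquiv]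
    · rw [← e.symm.hasSum_iff, Fin.prod_univ_succ]
      convert hh using 1
      ext p
      simp [e, Fin.prod_univ_succ, Fin.consEquiv]

variable {H : Type*} [NormedAddCommGroup H] [InnerProductSpace ℂ H] [CompleteSpace H]

lemma summable_norm_inner_mul {ι : Type*} (b : HilbertBasis ι ℂ H) (x y : H) :
    Summable fun j => ‖⟪x, b j⟫_ℂ * ⟪b j, y⟫_ℂ‖ :=
  (b.summable_inner_mul_inner x y).norm

/-- The elementary tensor `x₁ ⊗ ⋯ ⊗ xₙ`. -/
def tensorVec {n : ℕ} (x : Fin n → H) : TensorPow H n :=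
  ⟨fun f => ∏ i, ⟪fixedBasis H (f i), x i⟫_ℂ, by
    refine memℓp_gen ?_
    have h := (hasSum_prod_pi n (fun i j => ⟪x i, fixedBasis H j⟫_ℂ * ⟪fixedBasis H j, x i⟫_ℂ)
      (fun i => summable_norm_inner_mul _ _ _)).1
    refine h.congr fun f => ?_
    simp only [ENNReal.toReal_ofNat, Real.rpow_ofNat, norm_prod, norm_mul, ← Finset.prod_pow]
    exact Finset.prod_congr rfl fun i _ => by rw [norm_inner_symm, sq]⟩

lemma tensorVec_apply {n : ℕ} (x : Fin n → H) (f : Fin n → basisIndex H) :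
    tensorVec x f = ∏ i, ⟪fixedBasis H (f i), x i⟫_ℂ := rfl

lemma inner_tensorVec {n : ℕ} (x y : Fin n → H) :
    ⟪tensorVec x, tensorVec y⟫_ℂ = ∏ i, ⟪x i, y i⟫_ℂ := by
  have h := (hasSum_prod_pi n (fun i j => ⟪x i, fixedBasis H j⟫_ℂ * ⟪fixedBasis H j, y i⟫_ℂ)
      (fun i => summable_norm_inner_mul _ _ _)).2
  simp_rw [(fixedBasis H).tsum_inner_mul_inner] at h
  have e : ∀ f, ⟪tensorVec x f, tensorVec y f⟫_ℂ =
      ∏ i, ⟪x i, fixedBasis H (f i)⟫_ℂ * ⟪fixedBasis H (f i), y i⟫_ℂ := fun f => by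
    rw [RCLike.inner_apply, tensorVec_apply, tensorVec_apply, map_prod, mul_comm,
      ← Finset.prod_mul_distrib]
    exact Finset.prod_congr rfl fun i _ => by rw [inner_conj_symm]
  rw [lp.inner_eq_tsum, tsum_congr e]
  exact h.tsum_eq

lemma norm_tensorVec {n : ℕ} (x : Fin n → H) : ‖tensorVec x‖ = ∏ i, ‖x i‖ := by
  have h := inner_tensorVec x x
  simp_rw [inner_self_eq_norm_sq_to_K] at h
  rw [Finset.prod_pow] at h
  have h2 : ‖tensorVec x‖ ^ 2 = (∏ i, ‖x i‖) ^ 2 := by exact_mod_cast h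
  exact (pow_left_inj₀ (norm_nonneg _) (by positivity) two_ne_zero).1 h2

/-- The elementary tensor as a continuous linear function of its `i`-th factor. -/
def tensorVecL {n : ℕ} (x : Fin n → H) (i : Fin n) : H →L[ℂ] TensorPow H n :=
  LinearMap.mkContinuous
    { toFun := fun y => tensorVec (Function.update x i y)
      map_add' := fun y z => by
        ext f
        simp only [lp.coeFn_add, Pi.add_apply, tensorVec_apply]
        rw [← Finset.mul_prod_erase _ _ (Finset.mem_univ i),
          ← Finset.mul_prod_erase _ _ (Finset.mem_univ i),
          ← Finset.mul_prod_erase _ _ (Finset.mem_univ i)]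
        have hc : ∀ w : H, ∏ k ∈ Finset.univ.erase i,
            ⟪fixedBasis H (f k), Function.update x i w k⟫_ℂ =
            ∏ k ∈ Finset.univ.erase i, ⟪fixedBasis H (f k), x k⟫_ℂ := fun w =>
          Finset.prod_congr rfl fun k hk => by
            rw [Function.update_of_ne (Finset.ne_of_mem_erase hk)]
        simp only [hc, Function.update_self, inner_add_right, add_mul]
      map_smul' := fun c y => by
        ext f
        simp only [lp.coeFn_smul, Pi.smul_apply, tensorVec_apply, RingHom.id_apply]
        rw [← Finset.mul_prod_erase _ _ (Finset.mem_univ i),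
          ← Finset.mul_prod_erase _ _ (Finset.mem_univ i)]
        have hc : ∀ w : H, ∏ k ∈ Finset.univ.erase i,
            ⟪fixedBasis H (f k), Function.update x i w k⟫_ℂ =
            ∏ k ∈ Finset.univ.erase i, ⟪fixedBasis H (f k), x k⟫_ℂ := fun w =>
          Finset.prod_congr rfl fun k hk => by
            rw [Function.update_of_ne (Finset.ne_of_mem_erase hk)]
        simp only [hc, Function.update_self, inner_smul_right, smul_eq_mul, mul_assoc] }
    (∏ k ∈ Finset.univ.erase i, ‖x k‖) (fun y => by
      refine le_of_eq ?_
      change ‖tensorVec (Function.update x i y)‖ = _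
      rw [norm_tensorVec, ← Finset.mul_prod_erase _ _ (Finset.mem_univ i), mul_comm,
        Function.update_self]
      congr 1
      exact Finset.prod_congr rfl fun k hk => by
        rw [Function.update_of_ne (Finset.ne_of_mem_erase hk)])

lemma tensorVecL_apply {n : ℕ} (x : Fin n → H) (i : Fin n) (y : H) :
    tensorVecL x i y = tensorVec (Function.update x i y) := rfl

lemma eq_zero_of_inner_basis {ι : Type*} {K : Type*} [NormedAddCommGroup K]
    [InnerProductSpace ℂ K] (b : HilbertBasis ι ℂ H) (T : H →L[ℂ] K) (v : K)
    (h : ∀ j, ⟪v, T (b j)⟫_ℂ = 0) (y : H) : ⟪v, T y⟫_ℂ = 0 := by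
  have h1 := (b.hasSum_repr y).mapL ((innerSL ℂ v) ∘L T)
  refine h1.unique ?_
  convert hasSum_zero using 1
  ext j
  simp [h j]

lemma tensorVec_span_orthogonal {ι : Type*} (b : HilbertBasis ι ℂ H) (n : ℕ) :
    (Submodule.span ℂ (Set.range fun f : Fin n → ι => tensorVec fun i => b (f i)))ᗮ = ⊥ := by
  classical
  rw [eq_bot_iff]
  intro v hv
  have hv0 : ∀ f : Fin n → ι, ⟪v, tensorVec fun i => b (f i)⟫_ℂ = 0 := fun f =>
    (Submodule.mem_orthogonal' _ v).1 hv _ (Submodule.subset_span ⟨f, rfl⟩)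
  have key : ∀ s : Finset (Fin n), ∀ x : Fin n → H, (∀ i ∉ s, x i ∈ Set.range b) →
      ⟪v, tensorVec x⟫_ℂ = 0 := by
    intro s
    induction s using Finset.induction_on with
    | empty =>
      intro x hx
      choose f hf using fun i => hx i (Finset.notMem_empty i)
      have : x = fun i => b (f i) := funext fun i => (hf i).symm
      rw [this]
      exact hv0 f
    | insert a s ha ih =>
      intro x hx
      have h1 := eq_zero_of_inner_basis b (tensorVecL x a) v (fun j => ?_) (x a)
      · simpa [tensorVecL_apply] using h1
      · rw [tensorVecL_apply]
        refine ih _ fun i hi => ?_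
        by_cases hia : i = a
        · subst hia
          simp
        · rw [Function.update_of_ne hia]
          exact hx i (by simp [hia, hi])
  rw [Submodule.mem_bot]
  ext g
  have h2 := key Finset.univ (fun i => fixedBasis H (g i)) (by simp)
  have h3 : tensorVec (fun i => fixedBasis H (g i)) = lp.single 2 g (1 : ℂ) := by
    ext f
    rw [tensorVec_apply]
    have ho := orthonormal_iff_ite.1 (fixedBasis H).orthonormal
    simp_rw [ho]
    rw [lp.single_apply]
    by_cases hfg : f = g
    · subst hfg; simp
    · obtain ⟨i, hi⟩ := Function.ne_iff.1 hfg
      rw [Finset.prod_eq_zero (Finset.mem_univ i) (by simp [hi])]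
      simp [hfg]
  rw [h3, lp.inner_single_right] at h2
  simpa using h2

/-- The product orthonormal basis of `H^{⊗n}` built from an orthonormal basis of `H`. -/
def tensorBasis {ι : Type*} (b : HilbertBasis ι ℂ H) (n : ℕ) :
    HilbertBasis (Fin n → ι) ℂ (TensorPow H n) :=
  HilbertBasis.mkOfOrthogonalEqBot (v := fun f : Fin n → ι => tensorVec fun i => b (f i))
    (by
      classical
      rw [orthonormal_iff_ite]
      intro f g
      rw [inner_tensorVec]
      simp_rw [orthonormal_iff_ite.1 b.orthonormal]
      by_cases hfg : f = g
      · subst hfg; simp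
      · obtain ⟨i, hi⟩ := Function.ne_iff.1 hfg
        rw [Finset.prod_eq_zero (Finset.mem_univ i) (by simp [hi])]
        simp [hfg])
    (tensorVec_span_orthogonal b n)

lemma tensorBasis_apply {ι : Type*} (b : HilbertBasis ι ℂ H) (n : ℕ) (f : Fin n → ι) :
    tensorBasis b n f = tensorVec fun i => b (f i) := by
  simp [tensorBasis]

end TensorPow

/-! ### States, channels and fidelity -/

section Channels

variable {H K : Type*} [NormedAddCommGroup H] [InnerProductSpace ℂ H] [CompleteSpace H]
  [NormedAddCommGroup K] [InnerProductSpace ℂ K] [CompleteSpace K]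

/-- The trace of a trace-class operator. -/
def trace (A : H →L[ℂ] H) : ℂ := ∑' i, ⟪fixedBasis H i, A (fixedBasis H i)⟫_ℂ

/-- Density operators: positive semi-definite trace-class operators of trace one. -/
def IsState (ρ : TraceClass H) : Prop := 0 ≤ (ρ : H →L[ℂ] H) ∧ trace (ρ : H →L[ℂ] H) = 1

/-- The fidelity `F(ρ, σ) = ‖√ρ √σ‖₁²`. -/
def fidelity (ρ σ : H →L[ℂ] H) : ℝ := (traceNorm (CFC.sqrt ρ * CFC.sqrt σ)).toReal ^ 2

/-- Positivity of the operator `∑ᵢⱼ |i⟩⟨j| ⊗ Aᵢⱼ` on `ℂᵏ ⊗ H`. -/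
def BlockPositive {k : ℕ} (A : Fin k → Fin k → TraceClass H) : Prop :=
  ∀ x : Fin k → H, 0 ≤ ∑ i, ∑ j, ⟪x i, (A i j : H →L[ℂ] H) (x j)⟫_ℂ

/-- Quantum channels: completely positive, trace-preserving linear maps `𝒯(H) → 𝒯(K)`. -/
structure Channel (H K : Type*) [NormedAddCommGroup H] [InnerProductSpace ℂ H] [CompleteSpace H]
    [NormedAddCommGroup K] [InnerProductSpace ℂ K] [CompleteSpace K] where
  toLin : TraceClass H →ₗ[ℂ] TraceClass K
  completelyPositive : ∀ (k : ℕ) (A : Fin k → Fin k → TraceClass H),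
    BlockPositive A → BlockPositive fun i j => toLin (A i j)
  tracePreserving : ∀ A : TraceClass H,
    trace (toLin A : K →L[ℂ] K) = trace (A : H →L[ℂ] H)

/-- `T` is the tensor product `S₁ ⊗ ⋯ ⊗ Sₙ` of bounded operators. -/
def IsTensorOp {n : ℕ} (S : Fin n → H →L[ℂ] H) (T : TensorPow H n →L[ℂ] TensorPow H n) : Prop :=
  ∀ x : Fin n → H, T (tensorVec x) = tensorVec fun i => S i (x i)

/-- `Φ` is the `n`-fold tensor power `N^{⊗n}`: the channel (unique, since a channel is
trace-norm continuous and products of trace-class operators span a dense subspace) with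
`Φ(τ₁ ⊗ ⋯ ⊗ τₙ) = N(τ₁) ⊗ ⋯ ⊗ N(τₙ)` for all trace-class `τ₁, …, τₙ`. -/
def IsTensorPower (N : Channel H K) (n : ℕ) (Φ : Channel (TensorPow H n) (TensorPow K n)) : Prop :=
  ∀ (τ : Fin n → TraceClass H) (T : TraceClass (TensorPow H n)),
    IsTensorOp (fun i => (τ i : H →L[ℂ] H)) (T : TensorPow H n →L[ℂ] TensorPow H n) →
    IsTensorOp (fun i => (N.toLin (τ i) : K →L[ℂ] K))
      (Φ.toLin T : TensorPow K n →L[ℂ] TensorPow K n)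

end Channels

section Complementary

/-- The Hilbert-space tensor product `HB ⊗ HE`. -/
abbrev HilbertTensor (HB HE : Type*) [NormedAddCommGroup HB] [InnerProductSpace ℂ HB]
    [NormedAddCommGroup HE] [InnerProductSpace ℂ HE] : Type _ :=
  UniformSpace.Completion (HB ⊗[ℂ] HE)

variable {HA HB HE : Type*}
  [NormedAddCommGroup HA] [InnerProductSpace ℂ HA] [CompleteSpace HA]
  [NormedAddCommGroup HB] [InnerProductSpace ℂ HB] [CompleteSpace HB]
  [NormedAddCommGroup HE] [InnerProductSpace ℂ HE] [CompleteSpace HE]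

/-- The elementary tensor `x ⊗ y` in `HB ⊗ HE`. -/
def pureTensor (x : HB) (y : HE) : HilbertTensor HB HE := ((x ⊗ₜ[ℂ] y : HB ⊗[ℂ] HE) : _)

/-- `Y = Tr_E X`. -/
def IsPartialTraceE (X : HilbertTensor HB HE →L[ℂ] HilbertTensor HB HE) (Y : HB →L[ℂ] HB) : Prop :=
  ∀ x y : HB, HasSum
    (fun l => ⟪pureTensor x (fixedBasis HE l : HE), X (pureTensor y (fixedBasis HE l : HE))⟫_ℂ)
    ⟪x, Y y⟫_ℂ

/-- `Z = Tr_B X`. -/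
def IsPartialTraceB (X : HilbertTensor HB HE →L[ℂ] HilbertTensor HB HE) (Z : HE →L[ℂ] HE) : Prop :=
  ∀ x y : HE, HasSum
    (fun l => ⟪pureTensor (fixedBasis HB l : HB) x, X (pureTensor (fixedBasis HB l : HB) y)⟫_ℂ)
    ⟪x, Z y⟫_ℂ

/-- `U τ U†` for an isometry `U`. -/
def isometryConj (U : HA →ₗᵢ[ℂ] HilbertTensor HB HE) (τ : HA →L[ℂ] HA) :
    HilbertTensor HB HE →L[ℂ] HilbertTensor HB HE :=
  U.toContinuousLinearMap ∘L τ ∘L ContinuousLinearMap.adjoint U.toContinuousLinearMap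

/-- `Nc` is a complementary channel of `N`: for some isometry `U : HA → HB ⊗ HE`,
`N(τ) = Tr_E (U τ U†)` and `Nc(τ) = Tr_B (U τ U†)` for all trace-class `τ`. -/
def IsComplementary (N : Channel HA HB) (Nc : Channel HA HE) : Prop :=
  ∃ U : HA →ₗᵢ[ℂ] HilbertTensor HB HE, ∀ τ : TraceClass HA,
    IsPartialTraceE (isometryConj U (τ : HA →L[ℂ] HA)) (N.toLin τ : HB →L[ℂ] HB) ∧
    IsPartialTraceB (isometryConj U (τ : HA →L[ℂ] HA)) (Nc.toLin τ : HE →L[ℂ] HE)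

end Complementary

/-! ### Energy observables -/

section Energy

/-- An energy observable `G = ∑ⱼ gⱼ |eⱼ⟩⟨eⱼ|` (in general unbounded), given by an orthonormal
basis of eigenvectors `eⱼ` and the eigenvalues `gⱼ ≥ 0`. -/
structure EnergyObservable (ι H : Type*) [NormedAddCommGroup H] [InnerProductSpace ℂ H] where
  basis : HilbertBasis ι ℂ H
  eig : ι → ℝ
  eig_nonneg : ∀ j, 0 ≤ eig j

variable {ι H : Type*} [NormedAddCommGroup H] [InnerProductSpace ℂ H]

/-- `Tr{G ρ} = sup_n Tr{Πₙ G Πₙ ρ}`, in `[0, ∞]`, for a positive operator `ρ`, where `Πₙ` is the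
spectral projection of `G` for the interval `[0, n]`; the traces are computed in the eigenbasis. -/
def EnergyObservable.energy (G : EnergyObservable ι H) (ρ : H →L[ℂ] H) : ℝ≥0∞ :=
  open Classical in
  ⨆ n : ℕ, ∑' j, if G.eig j ≤ n then
    ENNReal.ofReal (G.eig j * (⟪G.basis j, ρ (G.basis j)⟫_ℂ).re) else 0

/-- The `n`th extension `(1/n) (G ⊗ I ⊗ ⋯ ⊗ I + ⋯ + I ⊗ ⋯ ⊗ I ⊗ G)`: its eigenvectors are the
products `e_{f 1} ⊗ ⋯ ⊗ e_{f n}`, with eigenvalues `(1/n) ∑ᵢ g_{f i}`. -/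
def EnergyObservable.ext [CompleteSpace H] (G : EnergyObservable ι H) (n : ℕ) :
    EnergyObservable (Fin n → ι) (TensorPow H n) where
  basis := tensorBasis G.basis n
  eig f := (1 / n : ℝ) * ∑ i, G.eig (f i)
  eig_nonneg f := mul_nonneg (by positivity) (Finset.sum_nonneg fun i _ => G.eig_nonneg _)

end Energy

/-! ### Finite-dimensional systems -/

section Qudits

/-- The `M`-dimensional system `S`, with its computational basis. -/
abbrev Qudit (M : ℕ) : Type := EuclideanSpace ℂ (Fin M)

/-- The bipartite system `R ⊗ S` of two `M`-dimensional systems. -/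
abbrev BiQudit (M : ℕ) : Type := EuclideanSpace ℂ (Fin M × Fin M)

/-- The operator on `ℂ^κ` with a given matrix. -/
def opOfMatrix {κ : Type} [Fintype κ] [DecidableEq κ] (A : Matrix κ κ ℂ) :
    EuclideanSpace ℂ κ →L[ℂ] EuclideanSpace ℂ κ := Matrix.toEuclideanCLM (n := κ) (𝕜 := ℂ) A

/-- The matrix of an operator on `ℂ^κ`. -/
def matrixOfOp {κ : Type} [Fintype κ] [DecidableEq κ]
    (A : EuclideanSpace ℂ κ →L[ℂ] EuclideanSpace ℂ κ) : Matrix κ κ ℂ :=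
  (Matrix.toEuclideanCLM (n := κ) (𝕜 := ℂ)).symm A

/-- An operator on `S`, as a trace-class operator. -/
def quditOp {M : ℕ} (A : Qudit M →L[ℂ] Qudit M) : TraceClass (Qudit M) :=
  ⟨A, mem_traceClass_of_finiteDimensional A⟩

/-- The block `⟨r|_R X |r'⟩_R` of an operator `X` on `R ⊗ S`. -/
def blockOp {M : ℕ} (X : BiQudit M →L[ℂ] BiQudit M) (r r' : Fin M) : Qudit M →L[ℂ] Qudit M :=
  opOfMatrix (Matrix.of fun s s' => matrixOfOp X (r, s) (r', s'))

/-- `(id_R ⊗ C)(X) = ∑_{r,r'} |r⟩⟨r'| ⊗ C(⟨r| X |r'⟩)`. -/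
def idTensor {M : ℕ} (C : TraceClass (Qudit M) →ₗ[ℂ] TraceClass (Qudit M))
    (X : BiQudit M →L[ℂ] BiQudit M) : BiQudit M →L[ℂ] BiQudit M :=
  opOfMatrix (Matrix.of fun p q =>
    matrixOfOp (C (quditOp (blockOp X p.1 q.1)) : Qudit M →L[ℂ] Qudit M) p.2 q.2)

/-- The maximally entangled state `Φ = (1/M) ∑_{m,m'} |m⟩⟨m'|_R ⊗ |m⟩⟨m'|_S`. -/
def maxEntangled (M : ℕ) : BiQudit M →L[ℂ] BiQudit M :=
  opOfMatrix (Matrix.of fun p q => if p.1 = p.2 ∧ q.1 = q.2 then (1 / M : ℂ) else 0)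

/-- The maximally mixed state `π_S = I_S / M`. -/
def maxMixed (M : ℕ) : TraceClass (Qudit M) := quditOp ((1 / M : ℂ) • 1)

end Qudits

/-! ### Codes and capacities -/

section Codes

variable {ι HA HB HE : Type*}
  [NormedAddCommGroup HA] [InnerProductSpace ℂ HA] [CompleteSpace HA]
  [NormedAddCommGroup HB] [InnerProductSpace ℂ HB] [CompleteSpace HB]
  [NormedAddCommGroup HE] [InnerProductSpace ℂ HE] [CompleteSpace HE]

/-- There is an `(n, M, G, P, ε)` code for quantum communication with uniform energy constraint. -/
def QuantumCode (N : Channel HA HB) (G : EnergyObservable ι HA) (P : ℝ) (n M : ℕ) (ε : ℝ) : Prop :=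
  ∃ Nn : Channel (TensorPow HA n) (TensorPow HB n), IsTensorPower N n Nn ∧
  ∃ (E : Channel (Qudit M) (TensorPow HA n)) (D : Channel (TensorPow HB n) (Qudit M)),
    (∀ ρ : TraceClass (Qudit M), IsState ρ →
      (G.ext n).energy (E.toLin ρ : TensorPow HA n →L[ℂ] TensorPow HA n) ≤ ENNReal.ofReal P) ∧
    ∀ φ : BiQudit M, ‖φ‖ = 1 →
      1 - ε ≤ fidelity (InnerProductSpace.rankOne ℂ φ φ)
        (idTensor (D.toLin ∘ₗ Nn.toLin ∘ₗ E.toLin) (InnerProductSpace.rankOne ℂ φ φ))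

/-- There is an `(n, M, G, P, ε)` code for entanglement transmission with average energy
constraint. -/
def EntanglementCode (N : Channel HA HB) (G : EnergyObservable ι HA) (P : ℝ) (n M : ℕ) (ε : ℝ) :
    Prop :=
  ∃ Nn : Channel (TensorPow HA n) (TensorPow HB n), IsTensorPower N n Nn ∧
  ∃ (E : Channel (Qudit M) (TensorPow HA n)) (D : Channel (TensorPow HB n) (Qudit M)),
    (G.ext n).energy (E.toLin (maxMixed M) : TensorPow HA n →L[ℂ] TensorPow HA n)
      ≤ ENNReal.ofReal P ∧
    1 - ε ≤ fidelity (maxEntangled M)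
      (idTensor (D.toLin ∘ₗ Nn.toLin ∘ₗ E.toLin) (maxEntangled M))

/-- A POVM with `M` outcomes. -/
def IsPOVM {H : Type*} [NormedAddCommGroup H] [InnerProductSpace ℂ H] [CompleteSpace H] {M : ℕ}
    (Λ : Fin M → H →L[ℂ] H) : Prop :=
  (∀ m, 0 ≤ Λ m) ∧ ∑ m, Λ m = 1

/-- There is an `(n, M, G, P, ε)` code for private communication with uniform energy constraint;
`Nc` is the channel to the environment. -/
def PrivateCode (N : Channel HA HB) (Nc : Channel HA HE) (G : EnergyObservable ι HA) (P : ℝ)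
    (n M : ℕ) (ε : ℝ) : Prop :=
  ∃ (Nn : Channel (TensorPow HA n) (TensorPow HB n))
    (Ncn : Channel (TensorPow HA n) (TensorPow HE n)),
    IsTensorPower N n Nn ∧ IsTensorPower Nc n Ncn ∧
  ∃ (ρ : Fin M → TraceClass (TensorPow HA n)) (Λ : Fin M → TensorPow HB n →L[ℂ] TensorPow HB n)
    (ω : TraceClass (TensorPow HE n)),
    (∀ m, IsState (ρ m)) ∧ IsPOVM Λ ∧ IsState ω ∧
    ∀ m,
      (G.ext n).energy (ρ m : TensorPow HA n →L[ℂ] TensorPow HA n) ≤ ENNReal.ofReal P ∧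
      1 - ε ≤ (trace (Λ m * (Nn.toLin (ρ m) : TensorPow HB n →L[ℂ] TensorPow HB n))).re ∧
      1 / 2 * (traceNorm
        ((Ncn.toLin (ρ m) - ω : TraceClass (TensorPow HE n)) :
          TensorPow HE n →L[ℂ] TensorPow HE n)).toReal ≤ ε

/-- There is an `(n, M, G, P, ε)` code for secret key transmission with average energy constraint;
`Nc` is the channel to the environment. -/
def SecretKeyCode (N : Channel HA HB) (Nc : Channel HA HE) (G : EnergyObservable ι HA) (P : ℝ)
    (n M : ℕ) (ε : ℝ) : Prop :=
  ∃ (Nn : Channel (TensorPow HA n) (TensorPow HB n))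
    (Ncn : Channel (TensorPow HA n) (TensorPow HE n)),
    IsTensorPower N n Nn ∧ IsTensorPower Nc n Ncn ∧
  ∃ (ρ : Fin M → TraceClass (TensorPow HA n)) (Λ : Fin M → TensorPow HB n →L[ℂ] TensorPow HB n)
    (ω : TraceClass (TensorPow HE n)),
    (∀ m, IsState (ρ m)) ∧ IsPOVM Λ ∧ IsState ω ∧
    (∑ m, (G.ext n).energy (ρ m : TensorPow HA n →L[ℂ] TensorPow HA n)) / (M : ℝ≥0∞)
      ≤ ENNReal.ofReal P ∧
    1 - ε ≤ (1 / M : ℝ) *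
      ∑ m, (trace (Λ m * (Nn.toLin (ρ m) : TensorPow HB n →L[ℂ] TensorPow HB n))).re ∧
    (1 / M : ℝ) * ∑ m, 1 / 2 * (traceNorm
        ((Ncn.toLin (ρ m) - ω : TraceClass (TensorPow HE n)) :
          TensorPow HE n →L[ℂ] TensorPow HE n)).toReal ≤ ε

/-- A rate `R` is achievable for a family of codes, `code n M ε` saying that there is a code with
`n` channel uses, size `M` and error `ε`: for all `ε ∈ (0,1)`, `δ > 0` and all sufficiently large
`n` there is a code of (integer) size at least `2^{n (R - δ)}`. -/
def Achievable (code : ℕ → ℕ → ℝ → Prop) (R : ℝ) : Prop :=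
  ∀ ε : ℝ, 0 < ε → ε < 1 → ∀ δ : ℝ, 0 < δ → ∀ᶠ n : ℕ in atTop,
    ∃ M : ℕ, (2 : ℝ) ^ ((n : ℝ) * (R - δ)) ≤ M ∧ code n M ε

/-- The supremum of all achievable rates, as an extended real number. -/
def capacity (code : ℕ → ℕ → ℝ → Prop) : EReal := ⨆ R : {R : ℝ // Achievable code R}, (R.1 : EReal)

/-- The quantum capacity `Q(N, G, P)` with uniform energy constraint. -/
def quantumCapacity (N : Channel HA HB) (G : EnergyObservable ι HA) (P : ℝ) : EReal :=
  capacity (QuantumCode N G P)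

/-- The entanglement transmission capacity `E(N, G, P)` with average energy constraint. -/
def entanglementCapacity (N : Channel HA HB) (G : EnergyObservable ι HA) (P : ℝ) : EReal :=
  capacity (EntanglementCode N G P)

/-- The private capacity `P(N, G, P)` with uniform energy constraint, `Nc` being a complementary
channel of `N`. -/
def privateCapacity (N : Channel HA HB) (Nc : Channel HA HE) (G : EnergyObservable ι HA) (P : ℝ) :
    EReal :=
  capacity (PrivateCode N Nc G P)

/-- The secret key transmission capacity `K(N, G, P)` with average energy constraint, `Nc` being a
complementary channel of `N`. -/
def secretKeyCapacity (N : Channel HA HB) (Nc : Channel HA HE) (G : EnergyObservable ι HA) (P : ℝ) :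
    EReal :=
  capacity (SecretKeyCode N Nc G P)

end Codes

end

end QCap

namespace QCap

noncomputable section

open scoped InnerProductSpace ENNReal TensorProduct ComplexOrder InnerProduct
open Filter InnerProductSpace

/-! ### Sums of rank-one operators -/

section SumRankOne

variable {H : Type*} [NormedAddCommGroup H] [InnerProductSpace ℂ H] [CompleteSpace H]

/-! Uniform bounds imply averaged ones, so Q ≤ E and P ≤ K are immediate; the content lies in E ≤ Q,
K ≤ P and E ≤ K. No capacity formula enters: codes of one kind are converted into codes of another.
A conversion may shrink the code size by a factor independent of n and may start from as small an
error as needed; neither affects rates (`capacity_mono`).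

From averaged to uniform constraints. After discarding bad codewords, a fraction bounded below
survives, with small error and energy at most some Pb ≥ P. Mixing the survivors, with small weight
r, with a suitable state brings the energy back to P and costs at most r in error. If some
eigenvalue of G lies below P, Markov's inequality applies with Pb slightly above P, and a product
eigenstate of low energy is mixed in. Otherwise every state has energy at least P, so the average
bound already holds for each codeword. `exists_expurgation_mixing` covers both cases. For K ≤ P this
is applied to the codewords themselves.

For E ≤ Q the role of codewords is played by the vectors of an arbitrary orthonormal basis of the
code space: the entanglement fidelity is at most the average of their fidelities
(`fidelity_maxEntangled_le`), and their energies average to that of the maximally mixed state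
(`sum_energy_ketBra`). Hence an orthonormal set of bad vectors cannot be large, and the orthogonal
complement of a maximal one is a large subspace without bad unit vectors
(`exists_isometry_not_bad`). Good fidelity for the pure states of this subspace implies good
fidelity for all states entangled with a reference (`le_fidelity_of_pure`).

For E ≤ K the basis states of an entanglement transmission code serve as key values. With
environment Kraus operators adapted to the decoder, the environment state for the value m is, up to
a small positive remainder, the reduction of a vector v_m, and the entanglement fidelity equals the
squared norm of the mean of the v_m. Vectors of the unit ball whose mean has norm close to 1 are
mostly close to that mean, so the environment learns almost nothing (`exists_decoupling`).

In infinite dimensions all this rests on writing trace-class operators as ∑ₜ |aₜ⟩⟨a'ₜ| with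
square-summable families (`IsSumRankOne`), on which channels act term by term
(`Channel.hasSum_inner`). -/

lemma nonneg_iff_inner {T : H →L[ℂ] H} : 0 ≤ T ↔ ∀ x, 0 ≤ ⟪x, T x⟫_ℂ := by
  rw [ContinuousLinearMap.nonneg_iff_isPositive, ContinuousLinearMap.isPositive_iff']
  constructor
  · intro h x
    rw [← ContinuousLinearMap.adjoint_inner_left, h.1.adjoint_eq]
    exact h.2 x
  · intro h
    have hp : T.IsPositive := by
      rw [ContinuousLinearMap.isPositive_iff_complex]
      intro x
      have h1 := Complex.nonneg_iff.1 (h x)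
      have h2 : ⟪T x, x⟫_ℂ = ((⟪x, T x⟫_ℂ).re : ℂ) := by
        rw [← inner_conj_symm, ← Complex.conj_eq_iff_re.1 (Complex.conj_eq_iff_im.2 h1.2.symm)]
        simp
      rw [h2]
      exact ⟨by simp, by simpa using h1.1⟩
    exact ⟨hp.isSelfAdjoint, fun x => hp.inner_nonneg_left x⟩

lemma inner_self_nonneg_complex (x : H) : 0 ≤ ⟪x, x⟫_ℂ := by
  rw [inner_self_eq_norm_sq_to_K]
  norm_cast
  exact Complex.zero_le_real.2 (sq_nonneg ‖x‖)

lemma hasSum_of_eq {T E : Type*} [AddCommMonoid E] [TopologicalSpace E] {f g : T → E} {a b : E}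
    (h : HasSum f a) (hf : ∀ t, g t = f t) (hab : b = a) : HasSum g b := by
  rw [hab, funext hf]
  exact h

/-- The product of two square-summable families of reals is summable. -/
lemma summable_mul_of_sq {T : Type*} {x y : T → ℝ} (hx : Summable fun t => x t ^ 2)
    (hy : Summable fun t => y t ^ 2) : Summable fun t => x t * y t := by
  refine Summable.of_norm_bounded (hx.add hy) fun t => ?_
  rw [Real.norm_eq_abs, abs_le]
  constructor <;> nlinarith [sq_nonneg (x t + y t), sq_nonneg (x t - y t), sq_nonneg (x t),
    sq_nonneg (y t)]

/-- `A = ∑ₜ |aₜ⟩⟨a'ₜ|`, in the weak sense, with square-summable families of vectors. -/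
structure IsSumRankOne {T : Type*} (A : H →L[ℂ] H) (a a' : T → H) : Prop where
  left : Summable fun t => ‖a t‖ ^ 2
  right : Summable fun t => ‖a' t‖ ^ 2
  hasSum : ∀ u v, HasSum (fun t => ⟪u, a t⟫_ℂ * ⟪a' t, v⟫_ℂ) ⟪u, A v⟫_ℂ

variable {T ι : Type*}

lemma ext_of_inner {A B : H →L[ℂ] H} (h : ∀ u v, ⟪u, A v⟫_ℂ = ⟪u, B v⟫_ℂ) : A = B :=
  ContinuousLinearMap.ext fun v => ext_inner_left ℂ fun u => h u v

/-- The norms ‖aₜ‖‖a'ₜ‖ are summable, so the series of rank-one operators converges in operator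
norm. -/
lemma exists_isSumRankOne {a a' : T → H} (ha : Summable fun t => ‖a t‖ ^ 2)
    (ha' : Summable fun t => ‖a' t‖ ^ 2) : ∃ A : H →L[ℂ] H, IsSumRankOne A a a' := by
  have hs : Summable fun t => rankOne ℂ (a t) (a' t) := by
    refine Summable.of_norm ?_
    simpa using summable_mul_of_sq ha ha'
  refine ⟨∑' t, rankOne ℂ (a t) (a' t), ha, ha', fun u v => ?_⟩
  have h1 := hs.hasSum.mapL ((innerSL ℂ u) ∘L (ContinuousLinearMap.apply ℂ H v))
  exact hasSum_of_eq h1 (fun t => by simp [inner_smul_right, mul_comm]) rfl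

lemma hasSum_norm_inner_sq (b : HilbertBasis ι ℂ H) (x : H) :
    HasSum (fun i => ‖⟪b i, x⟫_ℂ‖ ^ 2) (‖x‖ ^ 2) := by
  have := Complex.hasSum_re (b.hasSum_inner_mul_inner x x)
  convert this using 1
  · ext i
    rw [← inner_conj_symm x (b i), ← Complex.normSq_eq_conj_mul_self, Complex.ofReal_re,
      Complex.normSq_eq_norm_sq]
  · exact (inner_self_eq_norm_sq (𝕜 := ℂ) x).symm

lemma summable_norm_inner_sq_prod (b : HilbertBasis ι ℂ H) {a : T → H}
    (ha : Summable fun t => ‖a t‖ ^ 2) :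
    Summable fun p : T × ι => ‖⟪b p.2, a p.1⟫_ℂ‖ ^ 2 := by
  rw [summable_prod_of_nonneg (fun p => by positivity)]
  refine ⟨fun t => (hasSum_norm_inner_sq b (a t)).summable, ?_⟩
  simpa only [(hasSum_norm_inner_sq b _).tsum_eq] using ha

lemma Summable.norm_sq_map {a : T → H} (ha : Summable fun t => ‖a t‖ ^ 2) {K : Type*}
    [NormedAddCommGroup K] [InnerProductSpace ℂ K] (W : H →L[ℂ] K) :
    Summable fun t => ‖W (a t)‖ ^ 2 := by
  refine Summable.of_nonneg_of_le (fun t => by positivity) (fun t => ?_) (ha.mul_left (‖W‖ ^ 2))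
  rw [← mul_pow]
  exact pow_le_pow_left₀ (norm_nonneg _) (W.le_opNorm _) 2

/-- `Tr(W A)`, computed in any orthonormal basis, for `A = ∑ₜ |aₜ⟩⟨a'ₜ|`. -/
lemma IsSumRankOne.hasSum_basis {A : H →L[ℂ] H} {a a' : T → H} (h : IsSumRankOne A a a')
    (W : H →L[ℂ] H) (b : HilbertBasis ι ℂ H) :
    Summable (fun t => ⟪a' t, W (a t)⟫_ℂ) ∧
    HasSum (fun i => ⟪b i, W (A (b i))⟫_ℂ) (∑' t, ⟪a' t, W (a t)⟫_ℂ) := by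
  -- Absolute summability over pairs permits exchanging the sum over the basis with the sum over t;
  -- this is what makes the trace independent of the basis.
  have hs : Summable fun p : T × ι => ⟪a' p.1, b p.2⟫_ℂ * ⟪b p.2, W (a p.1)⟫_ℂ := by
    refine Summable.of_norm ?_
    have := summable_mul_of_sq (summable_norm_inner_sq_prod b h.right)
      (summable_norm_inner_sq_prod b (Summable.norm_sq_map h.left W))
    refine this.congr fun p => ?_
    rw [norm_mul, norm_inner_symm]
  have h1 : HasSum (fun t => ⟪a' t, W (a t)⟫_ℂ) _ :=
    hs.hasSum.prod_fiberwise fun t => b.hasSum_inner_mul_inner (a' t) (W (a t))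
  have h2 : HasSum (fun i => ⟪b i, W (A (b i))⟫_ℂ)
      (∑' p : T × ι, ⟪a' p.1, b p.2⟫_ℂ * ⟪b p.2, W (a p.1)⟫_ℂ) := by
    refine HasSum.prod_fiberwise ((Equiv.prodComm ι T).hasSum_iff.2 hs.hasSum) fun i => ?_
    have := h.hasSum ((W†) (b i)) (b i)
    rw [ContinuousLinearMap.adjoint_inner_left] at this
    exact hasSum_of_eq this
      (fun t => by simp [ContinuousLinearMap.adjoint_inner_left, mul_comm]) rfl
  exact ⟨h1.summable, h1.tsum_eq ▸ h2⟩

lemma IsSumRankOne.hasSum_trace_mul {A : H →L[ℂ] H} {a a' : T → H} (h : IsSumRankOne A a a')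
    (W : H →L[ℂ] H) : HasSum (fun t => ⟪a' t, W (a t)⟫_ℂ) (trace (W * A)) := by
  obtain ⟨h1, h2⟩ := h.hasSum_basis W (fixedBasis H)
  have : trace (W * A) = ∑' t, ⟪a' t, W (a t)⟫_ℂ := h2.tsum_eq
  rw [this]
  exact h1.hasSum

lemma IsSumRankOne.hasSum_trace {A : H →L[ℂ] H} {a a' : T → H} (h : IsSumRankOne A a a') :
    HasSum (fun t => ⟪a' t, a t⟫_ℂ) (trace A) := by
  simpa using h.hasSum_trace_mul 1

lemma posTrace_eq_ofReal {A : H →L[ℂ] H} (hA : 0 ≤ A) {z : ℂ}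
    (hz : HasSum (fun i => ⟪fixedBasis H i, A (fixedBasis H i)⟫_ℂ) z) :
    posTrace A = ENNReal.ofReal z.re := by
  have h1 := Complex.hasSum_re hz
  rw [posTrace, ← h1.tsum_eq, ENNReal.ofReal_tsum_of_nonneg _ h1.summable]
  exact fun i => (Complex.nonneg_iff.1 (nonneg_iff_inner.1 hA _)).1

/-- A contraction W with |A| = W A turns the trace norm into ∑ₜ ⟨a'ₜ, W aₜ⟩, which is then bounded
term by term. -/
lemma IsSumRankOne.traceNorm_le {A : H →L[ℂ] H} {a a' : T → H} (h : IsSumRankOne A a a') :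
    traceNorm A ≤ ENNReal.ofReal (∑' t, ‖a t‖ * ‖a' t‖) := by
  obtain ⟨W, hW, hWA⟩ := exists_contraction (CFC.abs A) A (fun x => (norm_abs_apply A x).le)
  obtain ⟨h1, h2⟩ := h.hasSum_basis W (fixedBasis H)
  rw [traceNorm, posTrace_eq_ofReal (CFC.abs_nonneg A) (by rw [← hWA]; exact h2)]
  refine ENNReal.ofReal_le_ofReal ((Complex.re_le_norm _).trans ?_)
  refine (norm_tsum_le_tsum_norm h1.norm).trans ?_
  refine h1.norm.tsum_le_tsum (fun t => ?_) (summable_mul_of_sq h.left h.right)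
  refine (norm_inner_le_norm _ _).trans ?_
  rw [mul_comm]
  exact mul_le_mul_of_nonneg_right (hW _) (norm_nonneg _)

lemma IsSumRankOne.mem_traceClass {A : H →L[ℂ] H} {a a' : T → H} (h : IsSumRankOne A a a') :
    A ∈ TraceClass H :=
  h.traceNorm_le.trans_lt ENNReal.ofReal_lt_top

lemma traceNorm_of_nonneg {A : H →L[ℂ] H} (hA : 0 ≤ A) : traceNorm A = posTrace A := by
  rw [traceNorm, CFC.abs_of_nonneg A hA]

lemma summable_norm_sq_of_tsum_enorm {a : T → H} (h : ∑' t, ‖a t‖ₑ ^ 2 < ∞) :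
    Summable fun t => ‖a t‖ ^ 2 := by
  have h1 := ENNReal.summable_toReal h.ne
  refine h1.congr fun t => ?_
  rw [ENNReal.toReal_pow, toReal_enorm]

lemma inner_mul_inner_adjoint (b : HilbertBasis ι ℂ H) (S S' : H →L[ℂ] H) (u v : H) :
    HasSum (fun i => ⟪u, S (b i)⟫_ℂ * ⟪(S'†) (b i), v⟫_ℂ) ⟪u, S (S' v)⟫_ℂ := by
  have := b.hasSum_inner_mul_inner ((S†) u) (S' v)
  simpa [ContinuousLinearMap.adjoint_inner_left] using this

/-- Every trace-class operator is a sum of rank-one operators. -/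
lemma exists_isSumRankOne_of_mem {A : H →L[ℂ] H} (hA : A ∈ TraceClass H) :
    ∃ a a' : basisIndex H → H, IsSumRankOne A a a' := by
  obtain ⟨V, hV, hVA⟩ := exists_contraction A (CFC.abs A) (fun x => (norm_abs_apply A x).ge)
  set S := CFC.sqrt (CFC.abs A) with hS
  have hs : S† = S := (IsSelfAdjoint.of_nonneg (CFC.sqrt_nonneg _)).star_eq
  have hSS : S * S = CFC.abs A := CFC.sqrt_mul_sqrt_self _
  have hsum : Summable fun i => ‖S (fixedBasis H i)‖ ^ 2 := by
    refine summable_norm_sq_of_tsum_enorm ?_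
    rw [← posTrace_eq_tsum_sqrt _ (CFC.abs_nonneg A)]
    exact hA
  -- With A = V|A| and S = √|A|, one has A = (V S) S with S Hilbert–Schmidt; the rank-one terms
  -- arise by inserting the basis between the two factors.
  refine ⟨fun i => V (S (fixedBasis H i)), fun i => S (fixedBasis H i),
    Summable.norm_sq_map hsum V, hsum, fun u v => ?_⟩
  have h1 := inner_mul_inner_adjoint (fixedBasis H) (V * S) S u v
  rw [hs] at h1
  have h2 : A v = (V * S) (S v) := by rw [← hVA, ← hSS]; rfl
  rw [h2]
  exact h1

/-- Every positive trace-class operator is a sum `∑ₜ |aₜ⟩⟨aₜ|`. -/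
lemma exists_isSumRankOne_of_nonneg {A : H →L[ℂ] H} (hA : A ∈ TraceClass H) (h0 : 0 ≤ A) :
    ∃ a : basisIndex H → H, IsSumRankOne A a a := by
  set S := CFC.sqrt A with hS
  have hs : S† = S := (IsSelfAdjoint.of_nonneg (CFC.sqrt_nonneg _)).star_eq
  have hSS : S * S = A := CFC.sqrt_mul_sqrt_self _ h0
  have hsum : Summable fun i => ‖S (fixedBasis H i)‖ ^ 2 := by
    refine summable_norm_sq_of_tsum_enorm ?_
    rw [← posTrace_eq_tsum_sqrt _ h0, ← traceNorm_of_nonneg h0]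
    exact hA
  refine ⟨fun i => S (fixedBasis H i), hsum, hsum, fun u v => ?_⟩
  have h1 := inner_mul_inner_adjoint (fixedBasis H) S S u v
  rw [hs] at h1
  rw [← hSS]
  exact h1

lemma IsSumRankOne.norm_inner_le {A : H →L[ℂ] H} {a a' : T → H} (h : IsSumRankOne A a a')
    (u v : H) : ‖⟪u, A v⟫_ℂ‖ ≤ (∑' t, ‖a t‖ * ‖a' t‖) * (‖u‖ * ‖v‖) := by
  have hs := (summable_mul_of_sq h.left h.right).mul_right (‖u‖ * ‖v‖)
  have hle : ∀ t, ‖⟪u, a t⟫_ℂ * ⟪a' t, v⟫_ℂ‖ ≤ ‖a t‖ * ‖a' t‖ * (‖u‖ * ‖v‖) := fun t => by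
    rw [norm_mul]
    calc _ ≤ (‖u‖ * ‖a t‖) * (‖a' t‖ * ‖v‖) := by gcongr <;> exact norm_inner_le_norm _ _
      _ = _ := by ring
  rw [← (h.hasSum u v).tsum_eq, ← tsum_mul_right]
  exact tsum_of_norm_bounded hs.hasSum hle

lemma isSumRankOne_self_norm {A : H →L[ℂ] H} {a : T → H} (h : IsSumRankOne A a a) :
    HasSum (fun t => ‖a t‖ ^ 2) (trace A).re := by
  convert Complex.hasSum_re h.hasSum_trace using 1
  ext t
  exact (inner_self_eq_norm_sq (𝕜 := ℂ) (a t)).symm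

lemma trace_nonneg_of_mem {A : H →L[ℂ] H} (hA : A ∈ TraceClass H) (h0 : 0 ≤ A) :
    0 ≤ trace A := by
  obtain ⟨a, ha⟩ := exists_isSumRankOne_of_nonneg hA h0
  exact ha.hasSum_trace.nonneg fun t => inner_self_nonneg_complex _

lemma norm_inner_le_trace {A : H →L[ℂ] H} (hA : A ∈ TraceClass H) (h0 : 0 ≤ A) (u v : H) :
    ‖⟪u, A v⟫_ℂ‖ ≤ (trace A).re * (‖u‖ * ‖v‖) := by
  obtain ⟨a, ha⟩ := exists_isSumRankOne_of_nonneg hA h0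
  have := ha.norm_inner_le u v
  rwa [← (isSumRankOne_self_norm ha).tsum_eq, tsum_congr fun t => sq ‖a t‖]

lemma hasSum_trace_basis {A : H →L[ℂ] H} (hA : A ∈ TraceClass H) (W : H →L[ℂ] H)
    (b : HilbertBasis ι ℂ H) : HasSum (fun i => ⟪b i, W (A (b i))⟫_ℂ) (trace (W * A)) := by
  obtain ⟨a, a', h⟩ := exists_isSumRankOne_of_mem hA
  have := (h.hasSum_basis W b).2
  rwa [(h.hasSum_trace_mul W).tsum_eq] at this

lemma traceNorm_eq_trace {A : H →L[ℂ] H} (hA : A ∈ TraceClass H) (h0 : 0 ≤ A) :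
    traceNorm A = ENNReal.ofReal (trace A).re := by
  rw [traceNorm_of_nonneg h0]
  refine posTrace_eq_ofReal h0 ?_
  simpa using hasSum_trace_basis hA 1 (fixedBasis H)

lemma trace_mul_add (W : H →L[ℂ] H) (A B : TraceClass H) :
    trace (W * ((A + B : TraceClass H) : H →L[ℂ] H)) =
      trace (W * (A : H →L[ℂ] H)) + trace (W * (B : H →L[ℂ] H)) := by
  refine (hasSum_trace_basis (A + B).2 W (fixedBasis H)).unique ?_
  exact hasSum_of_eq ((hasSum_trace_basis A.2 W (fixedBasis H)).add
    (hasSum_trace_basis B.2 W (fixedBasis H))) (fun i => by simp [inner_add_right]) rfl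

lemma trace_mul_smul (W : H →L[ℂ] H) (c : ℂ) (A : TraceClass H) :
    trace (W * ((c • A : TraceClass H) : H →L[ℂ] H)) = c * trace (W * (A : H →L[ℂ] H)) := by
  refine (hasSum_trace_basis (c • A).2 W (fixedBasis H)).unique ?_
  exact hasSum_of_eq ((hasSum_trace_basis A.2 W (fixedBasis H)).mul_left c)
    (fun i => by simp [inner_smul_right]) rfl

/-- `A ↦ Tr(W A)` as a linear functional on the trace-class operators. -/
def traceL (W : H →L[ℂ] H) : TraceClass H →ₗ[ℂ] ℂ where
  toFun A := trace (W * (A : H →L[ℂ] H))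
  map_add' A B := trace_mul_add W A B
  map_smul' c A := trace_mul_smul W c A

lemma traceL_apply (W : H →L[ℂ] H) (A : TraceClass H) :
    traceL W A = trace (W * (A : H →L[ℂ] H)) := rfl

lemma traceL_one (A : TraceClass H) : traceL 1 A = trace (A : H →L[ℂ] H) := by
  rw [traceL_apply, one_mul]

lemma isSumRankOne_rankOne (x y : H) :
    IsSumRankOne (rankOne ℂ x y) (fun _ : Unit => x) (fun _ : Unit => y) :=
  ⟨(hasSum_fintype _).summable, (hasSum_fintype _).summable, fun u v => by
    exact hasSum_of_eq (hasSum_fintype fun _ : Unit => ⟪u, x⟫_ℂ * ⟪y, v⟫_ℂ) (fun _ => rfl)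
      (by simp [inner_smul_right, mul_comm])⟩

/-- The rank-one operator `|x⟩⟨y|`, as a trace-class operator. -/
def ketBra (x y : H) : TraceClass H := ⟨rankOne ℂ x y, (isSumRankOne_rankOne x y).mem_traceClass⟩

@[simp] lemma coe_ketBra (x y : H) : (ketBra x y : H →L[ℂ] H) = rankOne ℂ x y := rfl

lemma ketBra_add_left (x x' y : H) : ketBra (x + x') y = ketBra x y + ketBra x' y :=
  Subtype.ext (by simp)

lemma ketBra_add_right (x y y' : H) : ketBra x (y + y') = ketBra x y + ketBra x y' :=
  Subtype.ext (by simp)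

lemma ketBra_smul_left (c : ℂ) (x y : H) : ketBra (c • x) y = c • ketBra x y :=
  Subtype.ext (by simp)

lemma ketBra_smul_right (c : ℂ) (x y : H) :
    ketBra x (c • y) = (starRingEnd ℂ c) • ketBra x y :=
  Subtype.ext (by simp)

lemma trace_rankOne (x y : H) : trace (rankOne ℂ x y : H →L[ℂ] H) = ⟪y, x⟫_ℂ := by
  exact (isSumRankOne_rankOne x y).hasSum_trace.unique
    (hasSum_of_eq (hasSum_fintype fun _ : Unit => ⟪y, x⟫_ℂ) (fun _ => rfl) (by simp))

lemma rankOne_self_nonneg (x : H) : 0 ≤ (rankOne ℂ x x : H →L[ℂ] H) := by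
  rw [ContinuousLinearMap.nonneg_iff_isPositive]
  exact isPositive_rankOne_self x

lemma Summable.norm_sq_add {a a' : T → H} (ha : Summable fun t => ‖a t‖ ^ 2)
    (ha' : Summable fun t => ‖a' t‖ ^ 2) : Summable fun t => ‖a t + a' t‖ ^ 2 := by
  refine Summable.of_nonneg_of_le (fun t => by positivity) (fun t => ?_)
    ((ha.add ha').mul_left 2)
  have := norm_add_le (a t) (a' t)
  nlinarith [norm_nonneg (a t + a' t), sq_nonneg (‖a' t‖ - ‖a t‖)]

/-- The polarization identity for sums of rank-one operators. -/
lemma IsSumRankOne.polarization {A : TraceClass H} {a a' : T → H}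
    (h : IsSumRankOne (A : H →L[ℂ] H) a a') : ∃ B : Fin 4 → TraceClass H,
      (∀ k, IsSumRankOne (B k : H →L[ℂ] H) (fun t => a t + Complex.I ^ (k : ℕ) • a' t)
        (fun t => a t + Complex.I ^ (k : ℕ) • a' t)) ∧
      A = (1 / 4 : ℂ) • ∑ k : Fin 4, Complex.I ^ (k : ℕ) • B k := by
  have hs : ∀ k : Fin 4, Summable fun t => ‖a t + Complex.I ^ (k : ℕ) • a' t‖ ^ 2 := fun k =>
    Summable.norm_sq_add h.left (by simpa [norm_smul] using h.right)
  choose B hB using fun k : Fin 4 => exists_isSumRankOne (hs k) (hs k)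
  refine ⟨fun k => ⟨B k, (hB k).mem_traceClass⟩, hB, Subtype.ext (ext_of_inner fun u v => ?_)⟩
  have h1 := hasSum_sum (s := Finset.univ) fun (k : Fin 4) _ =>
    ((hB k).hasSum u v).mul_left (1 / 4 * Complex.I ^ (k : ℕ))
  refine (h.hasSum u v).unique ?_
  refine hasSum_of_eq h1 (fun t => ?_) ?_
  · have h2 : Complex.I ^ 3 = - Complex.I := by rw [pow_succ]; simp
    simp only [inner_add_left, inner_add_right, inner_smul_left, inner_smul_right,
      Fin.sum_univ_four, Fin.val_zero, Fin.val_one, Fin.val_two, Fin.coe_ofNat_eq_mod, pow_zero,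
      pow_one, Complex.I_sq, map_one, map_neg, Complex.conj_I]
    norm_num [h2]
    linear_combination ((1 / 2 : ℂ) * ⟪u, a t⟫_ℂ * ⟪a' t, v⟫_ℂ +
      -(1 / 2 : ℂ) * ⟪u, a' t⟫_ℂ * ⟪a t, v⟫_ℂ) * Complex.I_sq
  · simp [inner_smul_right, inner_add_right, Fin.sum_univ_four]
    ring

end SumRankOne

/-! ### Gram representations and channels -/

section ChannelBasics

variable {H K K₂ : Type*} [NormedAddCommGroup H] [InnerProductSpace ℂ H] [CompleteSpace H]
  [NormedAddCommGroup K] [InnerProductSpace ℂ K] [CompleteSpace K]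
  [NormedAddCommGroup K₂] [InnerProductSpace ℂ K₂] [CompleteSpace K₂]

/-- A block-positive family of operators is a Gram family. -/
lemma exists_gram {k : ℕ} (A : Fin k → Fin k → H →L[ℂ] H)
    (hA : ∀ x : Fin k → H, 0 ≤ ∑ i, ∑ j, ⟪x i, A i j (x j)⟫_ℂ) :
    ∃ S : Fin k → (H →L[ℂ] PiLp 2 fun _ : Fin k => H),
      ∀ i j u v, ⟪u, A i j v⟫_ℂ = ⟪S i u, S j v⟫_ℂ := by
  let π : Fin k → ((PiLp 2 fun _ : Fin k => H) →L[ℂ] H) := fun i =>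
    PiLp.proj (𝕜 := ℂ) 2 (fun _ : Fin k => H) i
  -- The blocks form a single positive operator on Hᵏ; restricting its square root to the i-th
  -- summand gives the i-th Gram operator.
  let B : (PiLp 2 fun _ : Fin k => H) →L[ℂ] (PiLp 2 fun _ : Fin k => H) :=
    ∑ i, ∑ j, (π i)† ∘L A i j ∘L π j
  have hB : ∀ z w, ⟪z, B w⟫_ℂ = ∑ i, ∑ j, ⟪π i z, A i j (π j w)⟫_ℂ := fun z w => by
    simp only [B, sum_apply, inner_sum]
    simp only [ContinuousLinearMap.comp_apply, ContinuousLinearMap.adjoint_inner_right]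
  have hB0 : 0 ≤ B := nonneg_iff_inner.2 fun z => by rw [hB]; exact hA _
  have hs : (CFC.sqrt B)† = CFC.sqrt B := (IsSelfAdjoint.of_nonneg (CFC.sqrt_nonneg _)).star_eq
  have hSS : CFC.sqrt B * CFC.sqrt B = B := CFC.sqrt_mul_sqrt_self _ hB0
  have hπ : ∀ i u, ((π i)†) u = PiLp.single 2 i u := fun i u => by
    refine ext_inner_right ℂ fun z => ?_
    rw [ContinuousLinearMap.adjoint_inner_left, PiLp.inner_apply,
      Finset.sum_eq_single i]
    · simp [π]
    · intro j _ hj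
      simp [hj]
    · simp
  refine ⟨fun i => CFC.sqrt B ∘L (π i)†, fun i j u v => ?_⟩
  simp only [ContinuousLinearMap.comp_apply]
  rw [← hs, ContinuousLinearMap.adjoint_inner_left, hs, ← mul_apply_eq_comp, hSS, hB,
    Finset.sum_eq_single i, Finset.sum_eq_single j]
  · simp [hπ, π]
  · intro l _ hl
    simp [hπ, π, hl]
  · simp
  · intro l _ hl
    simp [hπ, π, hl]
  · simp

namespace Channel

lemma nonneg (Φ : Channel H K) {A : TraceClass H} (hA : 0 ≤ (A : H →L[ℂ] H)) :
    0 ≤ (Φ.toLin A : K →L[ℂ] K) := by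
  rw [nonneg_iff_inner] at hA ⊢
  have := Φ.completelyPositive 1 (fun _ _ => A) (fun x => by simpa using hA (x 0))
  exact fun x => by simpa using this (fun _ => x)

lemma isState (Φ : Channel H K) {A : TraceClass H} (hA : IsState A) : IsState (Φ.toLin A) :=
  ⟨Φ.nonneg hA.1, by rw [Φ.tracePreserving, hA.2]⟩

lemma blockPositive_ketBra {k : ℕ} (x : Fin k → H) :
    BlockPositive fun i j => ketBra (x i) (x j) := fun u => by
  have : ∑ i, ∑ j, ⟪u i, (ketBra (x i) (x j) : H →L[ℂ] H) (u j)⟫_ℂ =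
      (∑ i, ⟪u i, x i⟫_ℂ) * (starRingEnd ℂ) (∑ i, ⟪u i, x i⟫_ℂ) := by
    rw [map_sum, Finset.sum_mul_sum]
    refine Finset.sum_congr rfl fun i _ => Finset.sum_congr rfl fun j _ => ?_
    rw [inner_conj_symm]
    simp [inner_smul_right, mul_comm]
  rw [this, Complex.mul_conj]
  exact Complex.zero_le_real.2 (Complex.normSq_nonneg _)

lemma exists_gram_ketBra (Φ : Channel H K) {k : ℕ} (x : Fin k → H) :
    ∃ S : Fin k → (K →L[ℂ] PiLp 2 fun _ : Fin k => K), ∀ i j u v,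
      ⟪u, (Φ.toLin (ketBra (x i) (x j)) : K →L[ℂ] K) v⟫_ℂ = ⟪S i u, S j v⟫_ℂ :=
  exists_gram _ (Φ.completelyPositive k _ (blockPositive_ketBra x))

/-- In the Gram representation ‖S_i w‖² is a diagonal matrix element of Φ(|x_i⟩⟨x_i|), hence at most
its trace ‖x_i‖² times ‖w‖²; Cauchy–Schwarz does the rest. This is the continuity of channels on
rank-one operators. -/
lemma norm_inner_ketBra_le (Φ : Channel H K) (x y : H) (u v : K) :
    ‖⟪u, (Φ.toLin (ketBra x y) : K →L[ℂ] K) v⟫_ℂ‖ ≤ ‖x‖ * ‖y‖ * (‖u‖ * ‖v‖) := by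
  obtain ⟨S, hS⟩ := Φ.exists_gram_ketBra ![x, y]
  have hn : ∀ i w, ‖S i w‖ ≤ ‖(![x, y] : Fin 2 → H) i‖ * ‖w‖ := fun i w => by
    have h1 := norm_inner_le_trace (Φ.toLin (ketBra (![x, y] i) (![x, y] i))).2
      (Φ.nonneg (rankOne_self_nonneg _)) w w
    have e2 : ∀ y : H, (⟪y, y⟫_ℂ).re = ‖y‖ ^ 2 := inner_self_eq_norm_sq (𝕜 := ℂ)
    rw [hS, Φ.tracePreserving, coe_ketBra, trace_rankOne, e2, inner_self_eq_norm_sq_to_K,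
      norm_pow, RCLike.norm_ofReal, abs_norm] at h1
    refine le_of_sq_le_sq ?_ (by positivity)
    calc _ ≤ _ := h1
      _ = _ := by ring
  have := hS 0 1 u v
  simp only [Matrix.cons_val_zero, Matrix.cons_val_one] at this
  rw [this]
  calc _ ≤ ‖S 0 u‖ * ‖S 1 v‖ := norm_inner_le_norm _ _
    _ ≤ (‖x‖ * ‖u‖) * (‖y‖ * ‖v‖) := mul_le_mul (hn 0 u) (hn 1 v) (norm_nonneg _) (by positivity)
    _ = _ := by ring

/-- Continuity is not part of the definition of a channel; it comes from positivity. Subtracting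
finitely many terms from A leaves a positive operator whose trace tends to 0, and its image is
positive with the same trace, which dominates all matrix elements. -/
lemma hasSum_inner_self (Φ : Channel H K) {T : Type*} {A : TraceClass H} {a : T → H}
    (h : IsSumRankOne (A : H →L[ℂ] H) a a) (u v : K) :
    HasSum (fun t => ⟪u, (Φ.toLin (ketBra (a t) (a t)) : K →L[ℂ] K) v⟫_ℂ)
      ⟪u, (Φ.toLin A : K →L[ℂ] K) v⟫_ℂ := by
  have htr := isSumRankOne_self_norm h
  have key : ∀ s : Finset T, ‖∑ t ∈ s, ⟪u, (Φ.toLin (ketBra (a t) (a t)) : K →L[ℂ] K) v⟫_ℂ -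
      ⟪u, (Φ.toLin A : K →L[ℂ] K) v⟫_ℂ‖ ≤
      ((trace (A : H →L[ℂ] H)).re - ∑ t ∈ s, ‖a t‖ ^ 2) * (‖u‖ * ‖v‖) := fun s => by
    let B : TraceClass H := A - ∑ t ∈ s, ketBra (a t) (a t)
    have hB : 0 ≤ (B : H →L[ℂ] H) := by
      rw [nonneg_iff_inner]
      intro x
      have h1 : ⟪x, (B : H →L[ℂ] H) x⟫_ℂ =
          ⟪x, (A : H →L[ℂ] H) x⟫_ℂ - ∑ t ∈ s, ⟪x, a t⟫_ℂ * ⟪a t, x⟫_ℂ := by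
        simp [B, inner_sub_right, inner_sum, inner_smul_right, mul_comm, sum_apply]
      rw [h1, sub_nonneg]
      refine sum_le_hasSum s (fun t _ => ?_) (h.hasSum x x)
      rw [← inner_conj_symm (a t) x, Complex.mul_conj]
      exact Complex.zero_le_real.2 (Complex.normSq_nonneg _)
    have htB : (trace (B : H →L[ℂ] H)).re =
        (trace (A : H →L[ℂ] H)).re - ∑ t ∈ s, ‖a t‖ ^ 2 := by
      rw [← traceL_one, map_sub, map_sum, traceL_one, Complex.sub_re, Complex.re_sum]
      congr 1
      refine Finset.sum_congr rfl fun t _ => ?_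
      rw [traceL_one, coe_ketBra, trace_rankOne]
      exact inner_self_eq_norm_sq (𝕜 := ℂ) _
    have h2 := norm_inner_le_trace (Φ.toLin B).2 (Φ.nonneg hB) u v
    rw [Φ.tracePreserving, htB] at h2
    rw [norm_sub_rev]
    refine le_trans (le_of_eq ?_) h2
    congr 1
    simp [B, inner_sub_right, inner_sum, sum_apply]
  have h0 : Tendsto (fun s : Finset T =>
      ((trace (A : H →L[ℂ] H)).re - ∑ t ∈ s, ‖a t‖ ^ 2) * (‖u‖ * ‖v‖)) atTop (nhds 0) := by
    have := (tendsto_const_nhds (x := (trace (A : H →L[ℂ] H)).re)).sub htr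
    simpa using this.mul_const (‖u‖ * ‖v‖)
  refine tendsto_iff_norm_sub_tendsto_zero.2 ?_
  exact squeeze_zero (fun s => norm_nonneg _) key h0

lemma ketBra_polarization (x y : H) : ketBra x y = (1 / 4 : ℂ) • ∑ k : Fin 4,
    Complex.I ^ (k : ℕ) • ketBra (x + Complex.I ^ (k : ℕ) • y) (x + Complex.I ^ (k : ℕ) • y) := by
  obtain ⟨B, hB, h⟩ := (isSumRankOne_rankOne x y).polarization (A := ketBra x y)
  rw [h]
  congr 1
  refine Finset.sum_congr rfl fun k _ => ?_
  congr 1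
  exact Subtype.ext (ext_of_inner fun u v => ((hB k).hasSum u v).unique
    ((isSumRankOne_rankOne _ _).hasSum u v))

/-- Channels act term by term on sums of rank-one operators. -/
lemma hasSum_inner (Φ : Channel H K) {T : Type*} {A : TraceClass H} {a a' : T → H}
    (h : IsSumRankOne (A : H →L[ℂ] H) a a') (u v : K) :
    HasSum (fun t => ⟪u, (Φ.toLin (ketBra (a t) (a' t)) : K →L[ℂ] K) v⟫_ℂ)
      ⟪u, (Φ.toLin A : K →L[ℂ] K) v⟫_ℂ := by
  obtain ⟨B, hB, hA⟩ := h.polarization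
  have h1 := (hasSum_sum (s := Finset.univ) fun (k : Fin 4) _ =>
    (Φ.hasSum_inner_self (hB k) u v).mul_left (Complex.I ^ (k : ℕ))).mul_left (1 / 4 : ℂ)
  refine hasSum_of_eq h1 (fun t => ?_) ?_
  · rw [ketBra_polarization]
    simp [inner_sum, inner_smul_right, sum_apply]
  · rw [hA]
    simp [inner_sum, inner_smul_right, sum_apply]

/-- A channel is determined by its action on the matrix units of an orthonormal basis. -/
lemma toLin_eq_of_basis {ι : Type*} (b : HilbertBasis ι ℂ H) (Φ Ψ : Channel H K)
    (h : ∀ i j, Φ.toLin (ketBra (b i) (b j)) = Ψ.toLin (ketBra (b i) (b j))) :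
    Φ.toLin = Ψ.toLin := by
  -- The matrix elements of Φ(|x⟩⟨y|) are bounded linear functionals of x and, after conjugation, of
  -- y, so agreement on the basis is extended one variable at a time.
  let fl : Channel H K → H → K → K → (H →L[ℂ] ℂ) := fun Φ y u v =>
    LinearMap.mkContinuous
      { toFun := fun x => ⟪u, (Φ.toLin (ketBra x y) : K →L[ℂ] K) v⟫_ℂ
        map_add' := fun x x' => by simp [ketBra_add_left, inner_add_right]
        map_smul' := fun c x => by simp [ketBra_smul_left, inner_smul_right] }
      (‖y‖ * (‖u‖ * ‖v‖)) (fun x => (Φ.norm_inner_ketBra_le x y u v).trans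
        (le_of_eq (by ring)))
  have hfl : ∀ Φ y u v x, fl Φ y u v x = ⟪u, (Φ.toLin (ketBra x y) : K →L[ℂ] K) v⟫_ℂ :=
    fun _ _ _ _ _ => rfl
  let fr : Channel H K → H → K → K → (H →L[ℂ] ℂ) := fun Φ x u v =>
    LinearMap.mkContinuous
      { toFun := fun y => (starRingEnd ℂ) ⟪u, (Φ.toLin (ketBra x y) : K →L[ℂ] K) v⟫_ℂ
        map_add' := fun x x' => by simp [ketBra_add_right, inner_add_right]
        map_smul' := fun c x => by simp [ketBra_smul_right, inner_smul_right] }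
      (‖x‖ * (‖u‖ * ‖v‖)) (fun y => (RCLike.norm_conj _).trans_le
        ((Φ.norm_inner_ketBra_le x y u v).trans (le_of_eq (by ring))))
  have hfr : ∀ Φ x u v y, fr Φ x u v y =
      (starRingEnd ℂ) ⟪u, (Φ.toLin (ketBra x y) : K →L[ℂ] K) v⟫_ℂ := fun _ _ _ _ _ => rfl
  have hext : ∀ f g : H →L[ℂ] ℂ, (∀ i, f (b i) = g (b i)) → f = g := fun f g hfg =>
    ContinuousLinearMap.ext_on ((Submodule.dense_iff_topologicalClosure_eq_top).2 b.dense_span)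
      (by rintro _ ⟨i, rfl⟩; exact hfg i)
  have h1 : ∀ j x u v, ⟪u, (Φ.toLin (ketBra x (b j)) : K →L[ℂ] K) v⟫_ℂ =
      ⟪u, (Ψ.toLin (ketBra x (b j)) : K →L[ℂ] K) v⟫_ℂ := fun j x u v => by
    rw [← hfl, ← hfl, hext (fl Φ (b j) u v) (fl Ψ (b j) u v)]
    intro i
    rw [hfl, hfl, h]
  have h2 : ∀ x y u v, ⟪u, (Φ.toLin (ketBra x y) : K →L[ℂ] K) v⟫_ℂ =
      ⟪u, (Ψ.toLin (ketBra x y) : K →L[ℂ] K) v⟫_ℂ := fun x y u v => by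
    refine (starRingEnd ℂ).injective ?_
    rw [← hfr, ← hfr, hext (fr Φ x u v) (fr Ψ x u v)]
    intro i
    rw [hfr, hfr, h1]
  refine LinearMap.ext fun A => Subtype.ext (ext_of_inner fun u v => ?_)
  obtain ⟨a, a', ha⟩ := exists_isSumRankOne_of_mem A.2
  refine (Φ.hasSum_inner ha u v).unique ?_
  simp_rw [h2]
  exact Ψ.hasSum_inner ha u v

/-- The composition of two channels. -/
def comp (Ψ : Channel K K₂) (Φ : Channel H K) : Channel H K₂ where
  toLin := Ψ.toLin ∘ₗ Φ.toLin
  completelyPositive k A hA := Ψ.completelyPositive k _ (Φ.completelyPositive k A hA)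
  tracePreserving A := by
    rw [LinearMap.comp_apply, Ψ.tracePreserving, Φ.tracePreserving]

lemma comp_toLin (Ψ : Channel K K₂) (Φ : Channel H K) :
    (Ψ.comp Φ).toLin = Ψ.toLin ∘ₗ Φ.toLin := rfl

/-- The mixture `(1 - r) Φ + r Ψ` of two channels. -/
def mix (r : ℝ) (h0 : 0 ≤ r) (h1 : r ≤ 1) (Φ Ψ : Channel H K) : Channel H K where
  toLin := ((1 - r : ℝ) : ℂ) • Φ.toLin + (r : ℂ) • Ψ.toLin
  completelyPositive k A hA x := by
    have e : ∑ i, ∑ j, ⟪x i, (((((1 - r : ℝ) : ℂ) • Φ.toLin + (r : ℂ) • Ψ.toLin) (A i j) :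
        TraceClass K) : K →L[ℂ] K) (x j)⟫_ℂ =
        ((1 - r : ℝ) : ℂ) * ∑ i, ∑ j, ⟪x i, (Φ.toLin (A i j) : K →L[ℂ] K) (x j)⟫_ℂ +
        (r : ℂ) * ∑ i, ∑ j, ⟪x i, (Ψ.toLin (A i j) : K →L[ℂ] K) (x j)⟫_ℂ := by
      simp only [Finset.mul_sum, ← Finset.sum_add_distrib]
      refine Finset.sum_congr rfl fun i _ => Finset.sum_congr rfl fun j _ => ?_
      simp [inner_add_right, inner_smul_right]
    rw [e]
    exact add_nonneg
      (mul_nonneg (Complex.zero_le_real.2 (by linarith)) (Φ.completelyPositive k A hA x))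
      (mul_nonneg (Complex.zero_le_real.2 h0) (Ψ.completelyPositive k A hA x))
  tracePreserving A := by
    rw [← traceL_one]
    simp only [LinearMap.add_apply, LinearMap.smul_apply, map_add, map_smul, traceL_one,
      Φ.tracePreserving, Ψ.tracePreserving, smul_eq_mul]
    push_cast
    ring

lemma mix_toLin (r : ℝ) (h0 : 0 ≤ r) (h1 : r ≤ 1) (Φ Ψ : Channel H K) (A : TraceClass H) :
    (mix r h0 h1 Φ Ψ).toLin A = ((1 - r : ℝ) : ℂ) • Φ.toLin A + (r : ℂ) • Ψ.toLin A := rfl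

end Channel

/-! ### Kraus channels -/

/-- The completeness relation `∑ₗ Kₗ† Kₗ = 1`. -/
def IsKrausFamily {L : Type*} (S : L → H →L[ℂ] K) : Prop :=
  ∀ x, HasSum (fun l => ‖S l x‖ ^ 2) (‖x‖ ^ 2)

/-- `Φ(A) = ∑ₗ Kₗ A Kₗ†`. -/
def Channel.HasKraus {L : Type*} (Φ : Channel H K) (S : L → H →L[ℂ] K) : Prop :=
  ∀ (A : TraceClass H) (u v : K), HasSum
    (fun l => ⟪((S l)†) u, (A : H →L[ℂ] H) (((S l)†) v)⟫_ℂ) ⟪u, (Φ.toLin A : K →L[ℂ] K) v⟫_ℂ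

variable {L T : Type*} {S : L → H →L[ℂ] K}

/-- Polarization of the completeness relation. -/
lemma IsKrausFamily.hasSum_inner (hS : IsKrausFamily S) (x y : H) :
    HasSum (fun l => ⟪S l x, S l y⟫_ℂ) ⟪x, y⟫_ℂ := by
  have hc : ∀ z, HasSum (fun l => (‖S l z‖ : ℂ) ^ 2) ((‖z‖ : ℂ) ^ 2) := fun z => by
    have := Complex.hasSum_ofReal.2 (hS z)
    simpa using this
  have h1 := ((((hc (x + y)).sub (hc (x - y))).add
    (((hc (x - Complex.I • y)).sub (hc (x + Complex.I • y))).mul_right Complex.I))).div_const 4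
  refine hasSum_of_eq h1 (fun l => ?_) ?_
  · rw [inner_eq_sum_norm_sq_div_four]
    simp [map_add, map_sub, map_smul]
  · rw [inner_eq_sum_norm_sq_div_four]
    simp

lemma IsKrausFamily.summable_prod (hS : IsKrausFamily S) {a : T → H}
    (ha : Summable fun t => ‖a t‖ ^ 2) : Summable fun p : T × L => ‖S p.2 (a p.1)‖ ^ 2 := by
  rw [summable_prod_of_nonneg (fun p => by positivity)]
  refine ⟨fun t => (hS (a t)).summable, ?_⟩
  simpa only [(hS _).tsum_eq] using ha

lemma IsKrausFamily.hasSum_conj (hS : IsKrausFamily S) {A : H →L[ℂ] H} {a a' : T → H}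
    (h : IsSumRankOne A a a') {B : K →L[ℂ] K}
    (hB : IsSumRankOne B (fun p : T × L => S p.2 (a p.1)) (fun p : T × L => S p.2 (a' p.1)))
    (u v : K) :
    HasSum (fun l => ⟪((S l)†) u, A (((S l)†) v)⟫_ℂ) ⟪u, B v⟫_ℂ := by
  refine HasSum.prod_fiberwise ((Equiv.prodComm L T).hasSum_iff.2 (hB.hasSum u v)) fun l => ?_
  refine hasSum_of_eq (h.hasSum (((S l)†) u) (((S l)†) v)) (fun t => ?_) rfl
  simp [ContinuousLinearMap.adjoint_inner_left, ContinuousLinearMap.adjoint_inner_right]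

lemma IsKrausFamily.exists_conj (hS : IsKrausFamily S) (A : TraceClass H) :
    ∃ B : TraceClass K, ∀ u v,
      HasSum (fun l => ⟪((S l)†) u, (A : H →L[ℂ] H) (((S l)†) v)⟫_ℂ) ⟪u, (B : K →L[ℂ] K) v⟫_ℂ := by
  obtain ⟨a, a', h⟩ := exists_isSumRankOne_of_mem A.2
  obtain ⟨B, hB⟩ := exists_isSumRankOne (hS.summable_prod h.left) (hS.summable_prod h.right)
  exact ⟨⟨B, hB.mem_traceClass⟩, hS.hasSum_conj h hB⟩

/-- The sum `∑ₗ Kₗ A Kₗ†`. -/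
def IsKrausFamily.conj (hS : IsKrausFamily S) (A : TraceClass H) : TraceClass K :=
  (hS.exists_conj A).choose

lemma IsKrausFamily.hasSum_conj_apply (hS : IsKrausFamily S) (A : TraceClass H) (u v : K) :
    HasSum (fun l => ⟪((S l)†) u, (A : H →L[ℂ] H) (((S l)†) v)⟫_ℂ)
      ⟪u, (hS.conj A : K →L[ℂ] K) v⟫_ℂ :=
  (hS.exists_conj A).choose_spec u v

lemma IsKrausFamily.isSumRankOne_of_hasSum (hS : IsKrausFamily S) {A : H →L[ℂ] H} {a a' : T → H}
    (h : IsSumRankOne A a a') {B : K →L[ℂ] K}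
    (hB : ∀ u v, HasSum (fun l => ⟪((S l)†) u, A (((S l)†) v)⟫_ℂ) ⟪u, B v⟫_ℂ) :
    IsSumRankOne B (fun p : T × L => S p.2 (a p.1)) (fun p : T × L => S p.2 (a' p.1)) := by
  obtain ⟨B', hB'⟩ := exists_isSumRankOne (hS.summable_prod h.left) (hS.summable_prod h.right)
  have : B = B' := ext_of_inner fun u v => (hB u v).unique (hS.hasSum_conj h hB' u v)
  rwa [this]

/-- The channel `A ↦ ∑ₗ Kₗ A Kₗ†`. -/
def krausChannel (hS : IsKrausFamily S) : Channel H K where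
  toLin :=
    { toFun := hS.conj
      map_add' := fun A B => Subtype.ext (ext_of_inner fun u v =>
        (hS.hasSum_conj_apply (A + B) u v).unique (hasSum_of_eq
          ((hS.hasSum_conj_apply A u v).add (hS.hasSum_conj_apply B u v))
          (fun l => by simp [inner_add_right]) (by simp [inner_add_right])))
      map_smul' := fun c A => Subtype.ext (ext_of_inner fun u v =>
        (hS.hasSum_conj_apply (c • A) u v).unique (hasSum_of_eq
          ((hS.hasSum_conj_apply A u v).mul_left c)
          (fun l => by simp [inner_smul_right]) (by simp [inner_smul_right]))) }
  completelyPositive k A hA x := by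
    have h1 := hasSum_sum (s := Finset.univ) fun (i : Fin k) _ =>
      hasSum_sum (s := Finset.univ) fun (j : Fin k) _ => hS.hasSum_conj_apply (A i j) (x i) (x j)
    exact h1.nonneg fun l => hA fun i => ((S l)†) (x i)
  tracePreserving A := by
    obtain ⟨a, a', h⟩ := exists_isSumRankOne_of_mem A.2
    have hB := hS.isSumRankOne_of_hasSum h (hS.hasSum_conj_apply A)
    exact (h.hasSum_trace.unique (HasSum.prod_fiberwise hB.hasSum_trace
      fun t => hS.hasSum_inner (a' t) (a t))).symm

lemma krausChannel_hasKraus (hS : IsKrausFamily S) : (krausChannel hS).HasKraus S :=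
  hS.hasSum_conj_apply

lemma Channel.HasKraus.isSumRankOne {Φ : Channel H K} (h : Φ.HasKraus S) (hS : IsKrausFamily S)
    {A : TraceClass H} {a a' : T → H} (hA : IsSumRankOne (A : H →L[ℂ] H) a a') :
    IsSumRankOne (Φ.toLin A : K →L[ℂ] K) (fun p : T × L => S p.2 (a p.1))
      (fun p : T × L => S p.2 (a' p.1)) :=
  hS.isSumRankOne_of_hasSum hA (h A)

end ChannelBasics

/-! ### Tensor powers of channels -/

section TensorChannels

variable {H K E : Type*} [NormedAddCommGroup H] [InnerProductSpace ℂ H] [CompleteSpace H]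
  [NormedAddCommGroup K] [InnerProductSpace ℂ K] [CompleteSpace K]
  [NormedAddCommGroup E] [InnerProductSpace ℂ E] [CompleteSpace E]

lemma ext_of_basis {ι : Type*} (b : HilbertBasis ι ℂ H) {v w : H}
    (h : ∀ i, ⟪b i, v⟫_ℂ = ⟪b i, w⟫_ℂ) : v = w := by
  refine b.repr.injective ?_
  ext i
  rw [b.repr_apply_apply, b.repr_apply_apply, h]

lemma clm_ext_of_basis {ι : Type*} (b : HilbertBasis ι ℂ H) {f g : H →L[ℂ] K}
    (h : ∀ i, f (b i) = g (b i)) : f = g :=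
  ContinuousLinearMap.ext_on ((Submodule.dense_iff_topologicalClosure_eq_top).2 b.dense_span)
    (by rintro _ ⟨i, rfl⟩; exact h i)

lemma ext_of_tensorVec {n : ℕ} {v w : TensorPow H n}
    (h : ∀ x, ⟪tensorVec x, v⟫_ℂ = ⟪tensorVec x, w⟫_ℂ) : v = w :=
  ext_of_basis (tensorBasis (fixedBasis H) n) fun f => by rw [tensorBasis_apply, h]

lemma clm_ext_of_tensorVec {n : ℕ} {f g : TensorPow H n →L[ℂ] K}
    (h : ∀ x, f (tensorVec x) = g (tensorVec x)) : f = g :=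
  clm_ext_of_basis (tensorBasis (fixedBasis H) n) fun i => by rw [tensorBasis_apply, h]

lemma tensorVec_smul {n : ℕ} (c : Fin n → ℂ) (x : Fin n → H) :
    (tensorVec fun i => c i • x i) = (∏ i, c i) • tensorVec x := by
  ext f
  rw [tensorVec_apply, lp.coeFn_smul, Pi.smul_apply, tensorVec_apply, smul_eq_mul,
    ← Finset.prod_mul_distrib]
  simp [inner_smul_right]

lemma isTensorOp_ketBra {n : ℕ} (x y : Fin n → H) :
    IsTensorOp (fun i => (ketBra (x i) (y i) : H →L[ℂ] H))
      (ketBra (tensorVec x) (tensorVec y) : TensorPow H n →L[ℂ] TensorPow H n) := fun z => by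
  simp only [coe_ketBra, rankOne_apply, inner_tensorVec, tensorVec_smul]

lemma IsTensorOp.unique {n : ℕ} {S : Fin n → H →L[ℂ] H}
    {A B : TensorPow H n →L[ℂ] TensorPow H n} (hA : IsTensorOp S A) (hB : IsTensorOp S B) :
    A = B :=
  clm_ext_of_tensorVec fun x => by rw [hA, hB]

lemma IsTensorPower.toLin_eq {N : Channel H K} {n : ℕ}
    {Φ Ψ : Channel (TensorPow H n) (TensorPow K n)} (hΦ : IsTensorPower N n Φ)
    (hΨ : IsTensorPower N n Ψ) : Φ.toLin = Ψ.toLin := by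
  refine Channel.toLin_eq_of_basis (tensorBasis (fixedBasis H) n) Φ Ψ fun f g => ?_
  rw [tensorBasis_apply, tensorBasis_apply]
  exact Subtype.ext ((hΦ _ _ (isTensorOp_ketBra _ _)).unique (hΨ _ _ (isTensorOp_ketBra _ _)))

/-- A map on families of vectors with the Gram matrix of the elementary tensors extends to an
isometry. -/
lemma exists_tensor_isometry {n : ℕ} (ψ : (Fin n → H) → K)
    (hψ : ∀ x y, ⟪ψ x, ψ y⟫_ℂ = ∏ i, ⟪x i, y i⟫_ℂ) :
    ∃ V : TensorPow H n →ₗᵢ[ℂ] K, ∀ x, V (tensorVec x) = ψ x := by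
  classical
  have hv : Orthonormal ℂ fun f : Fin n → basisIndex H => ψ fun i => fixedBasis H (f i) := by
    rw [orthonormal_iff_ite]
    intro f g
    have h1 := orthonormal_iff_ite.1 (tensorBasis (fixedBasis H) n).orthonormal f g
    rwa [tensorBasis_apply, tensorBasis_apply, inner_tensorVec, ← hψ] at h1
  have hO := hv.orthogonalFamily
  refine ⟨hO.linearIsometry, fun x => ?_⟩
  -- The isometry V is fixed by its values on the product basis. To see that V(x₁ ⊗ ⋯ ⊗ xₙ) = ψ x,
  -- without knowing that ψ x lies in the range of V, it suffices that both squared norms and the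
  -- inner product coincide: then the difference has norm 0.
  have h1 : ⟪ψ x, hO.linearIsometry (tensorVec x)⟫_ℂ = ⟪ψ x, ψ x⟫_ℂ := by
    have h2 := (hO.hasSum_linearIsometry (tensorVec x)).mapL (innerSL ℂ (ψ x))
    have h3 := (hasSum_prod_pi n
      (fun i j => ⟪x i, fixedBasis H j⟫_ℂ * ⟪fixedBasis H j, x i⟫_ℂ)
      (fun i => summable_norm_inner_mul _ _ _)).2
    simp_rw [(fixedBasis H).tsum_inner_mul_inner] at h3
    rw [hψ]
    refine h2.unique (hasSum_of_eq h3 (fun f => ?_) rfl)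
    simp [inner_smul_right, hψ, tensorVec_apply, Finset.prod_mul_distrib, mul_comm]
  have h4 : ⟪hO.linearIsometry (tensorVec x), hO.linearIsometry (tensorVec x)⟫_ℂ
      = ⟪ψ x, ψ x⟫_ℂ := by
    rw [LinearIsometry.inner_map_map, inner_tensorVec, hψ]
  have h5 : ⟪hO.linearIsometry (tensorVec x), ψ x⟫_ℂ = ⟪ψ x, ψ x⟫_ℂ := by
    rw [← inner_conj_symm, h1, inner_conj_symm]
  rw [← sub_eq_zero, ← inner_self_eq_zero (𝕜 := ℂ), inner_sub_left, inner_sub_right,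
    inner_sub_right, h1, h4, h5]
  ring

lemma summable_norm_inner_of_sq {L : Type*} {x y : L → K} (hx : Summable fun l => ‖x l‖ ^ 2)
    (hy : Summable fun l => ‖y l‖ ^ 2) : Summable fun l => ‖⟪x l, y l⟫_ℂ‖ :=
  Summable.of_nonneg_of_le (fun _ => norm_nonneg _) (fun _ => norm_inner_le_norm _ _)
    (summable_mul_of_sq hx hy)

lemma lp_hasSum_norm_sq {L : Type*} (z : lp (fun _ : L => K) 2) :
    HasSum (fun l => ‖z l‖ ^ 2) (‖z‖ ^ 2) := by
  have h2 : ∀ y : K, (⟪y, y⟫_ℂ).re = ‖y‖ ^ 2 := inner_self_eq_norm_sq (𝕜 := ℂ)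
  have h3 : (⟪z, z⟫_ℂ).re = ‖z‖ ^ 2 := inner_self_eq_norm_sq (𝕜 := ℂ) z
  have h1 := Complex.hasSum_re (lp.hasSum_inner (𝕜 := ℂ) z z)
  exact hasSum_of_eq h1 (fun l => (h2 _).symm) h3.symm

/-- The products of the operators of a Kraus family form a Kraus family. -/
lemma IsKrausFamily.exists_tensor {L : Type*} {S : L → H →L[ℂ] K} (hS : IsKrausFamily S) (n : ℕ) :
    ∃ Sn : (Fin n → L) → TensorPow H n →L[ℂ] TensorPow K n, IsKrausFamily Sn ∧
      ∀ f x, Sn f (tensorVec x) = tensorVec fun i => S (f i) (x i) := by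
  have hsum : ∀ x y : Fin n → H, HasSum (fun f : Fin n → L =>
      ∏ i, ⟪S (f i) (x i), S (f i) (y i)⟫_ℂ) (∏ i, ⟪x i, y i⟫_ℂ) := fun x y => by
    have := (hasSum_prod_pi n (fun i l => ⟪S l (x i), S l (y i)⟫_ℂ) (fun i =>
      summable_norm_inner_of_sq (hS (x i)).summable (hS (y i)).summable)).2
    simpa only [(hS.hasSum_inner _ _).tsum_eq] using this
  have hmem : ∀ x : Fin n → H, Memℓp (E := fun _ : Fin n → L => TensorPow K n)
      (fun f : Fin n → L => tensorVec fun i => S (f i) (x i)) 2 := fun x => by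
    refine memℓp_gen ?_
    refine (Complex.hasSum_re (hsum x x)).summable.congr fun f => ?_
    rw [← inner_tensorVec]
    simpa using (inner_self_eq_norm_sq (𝕜 := ℂ) (tensorVec fun i => S (f i) (x i)))
  -- All product operators are obtained at once, as the components of one isometry into an ℓ² space;
  -- its being isometric is the completeness relation.
  obtain ⟨V, hV⟩ := exists_tensor_isometry
    (K := lp (fun _ : Fin n → L => TensorPow K n) 2) (fun x : Fin n → H => ⟨_, hmem x⟩)
    (fun x y => (lp.hasSum_inner (𝕜 := ℂ) (⟨_, hmem x⟩ : lp (fun _ : Fin n → L => TensorPow K n) 2)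
      ⟨_, hmem y⟩).unique (hasSum_of_eq (hsum x y) (fun f => inner_tensorVec _ _) rfl))
  refine ⟨fun f => (lp.evalCLM ℂ (fun _ : Fin n → L => TensorPow K n) 2 f) ∘L
    V.toContinuousLinearMap, fun z => ?_, fun f x => ?_⟩
  · rw [← V.norm_map z]
    exact lp_hasSum_norm_sq (V z)
  · change V (tensorVec x) f = _
    rw [hV]

lemma adjoint_tensorVec {n : ℕ} {A : TensorPow H n →L[ℂ] TensorPow K n} {S : Fin n → H →L[ℂ] K}
    (h : ∀ x, A (tensorVec x) = tensorVec fun i => S i (x i)) (u : Fin n → K) :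
    (A†) (tensorVec u) = tensorVec fun i => ((S i)†) (u i) := by
  refine ext_of_tensorVec fun x => ?_
  rw [ContinuousLinearMap.adjoint_inner_right, h, inner_tensorVec, inner_tensorVec]
  simp only [ContinuousLinearMap.adjoint_inner_right]

/-- The channel with the product Kraus operators is the tensor power. -/
lemma isTensorPower_krausChannel {L : Type*} {S : L → H →L[ℂ] K} {N : Channel H K}
    (hN : N.HasKraus S) {n : ℕ} {Sn : (Fin n → L) → TensorPow H n →L[ℂ] TensorPow K n}
    (hSn : IsKrausFamily Sn)
    (h : ∀ f x, Sn f (tensorVec x) = tensorVec fun i => S (f i) (x i)) :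
    IsTensorPower N n (krausChannel hSn) := fun τ A hA v => by
  refine ext_of_tensorVec fun u => ?_
  have h1 := krausChannel_hasKraus hSn A (tensorVec u) (tensorVec v)
  refine h1.unique ?_
  have h2 := (hasSum_prod_pi n
    (fun i l => ⟪((S l)†) (u i), (τ i : H →L[ℂ] H) (((S l)†) (v i))⟫_ℂ)
    (fun i => (hN (τ i) (u i) (v i)).summable.norm)).2
  simp_rw [fun i => (hN (τ i) (u i) (v i)).tsum_eq] at h2
  refine hasSum_of_eq h2 (fun f => ?_) (inner_tensorVec _ _)
  rw [adjoint_tensorVec (h f), adjoint_tensorVec (h f), hA, inner_tensorVec]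

/-- `Ψ` is complementary to the channel with Kraus operators `S i`, the environment having the
orthonormal basis `c`. -/
def IsKrausComplement {I : Type*} (c : HilbertBasis I ℂ E) (S : I → H →L[ℂ] K)
    (Ψ : Channel H E) : Prop :=
  ∀ y z f g, ⟪c f, (Ψ.toLin (ketBra y z) : E →L[ℂ] E) (c g)⟫_ℂ = ⟪S g z, S f y⟫_ℂ

/-- The relation `∑_w |⟨w, x⟩|² = ‖x‖²`. -/
def IsParseval {W : Type*} (w : W → K) : Prop := ∀ x y, HasSum
  (fun s => ⟪x, w s⟫_ℂ * ⟪w s, y⟫_ℂ) ⟪x, y⟫_ℂ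

/-- Summing over the frame collapses ⟨S_g z, w_s⟩⟨w_s, S_f y⟩ to ⟨S_g z, S_f y⟩. The frame is
arbitrary: this is the freedom in the Kraus representation of the complementary channel, used later
to adapt it to a decoder. -/
lemma Channel.HasKraus.isKrausComplement {I W : Type*} {c : HilbertBasis I ℂ E}
    {S : I → H →L[ℂ] K} {Ψ : Channel H E} {R : W → H →L[ℂ] E} (h : Ψ.HasKraus R) {w : W → K}
    (hw : IsParseval w) (hR : ∀ s f y, ⟪c f, R s y⟫_ℂ = ⟪w s, S f y⟫_ℂ) :
    IsKrausComplement c S Ψ := fun y y' f f' => by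
  refine (h (ketBra y y') (c f) (c f')).unique (hasSum_of_eq (hw (S f' y') (S f y)) (fun s => ?_)
    rfl)
  rw [coe_ketBra, rankOne_apply, inner_smul_right, ContinuousLinearMap.adjoint_inner_right,
    ContinuousLinearMap.adjoint_inner_left, hR, ← inner_conj_symm (R s y'), hR, inner_conj_symm]

lemma IsKrausComplement.toLin_eq {I : Type*} {c : HilbertBasis I ℂ E}
    {S : I → H →L[ℂ] K} {Ψ Ψ' : Channel H E} (h : IsKrausComplement c S Ψ)
    (hΨ : IsKrausComplement c S Ψ') : Ψ.toLin = Ψ'.toLin :=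
  Channel.toLin_eq_of_basis (fixedBasis H) Ψ Ψ' fun i j => Subtype.ext
    (clm_ext_of_basis c fun f' => ext_of_basis c fun f => by rw [h, hΨ])

/-- The operator `y ↦ ∑_f ⟨w, S_f y⟩ c_f`. -/
lemma IsKrausFamily.exists_slice {I : Type*} (c : HilbertBasis I ℂ E) {S : I → H →L[ℂ] K}
    (hS : IsKrausFamily S) (w : K) : ∃ R : H →L[ℂ] E, ∀ f y, ⟪c f, R y⟫_ℂ = ⟪w, S f y⟫_ℂ := by
  have hle : ∀ y f, ‖⟪w, S f y⟫_ℂ‖ ^ 2 ≤ ‖w‖ ^ 2 * ‖S f y‖ ^ 2 := fun y f => by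
    rw [← mul_pow]
    exact pow_le_pow_left₀ (norm_nonneg _) (norm_inner_le_norm _ _) 2
  have hsum : ∀ y, Summable fun f => ‖⟪w, S f y⟫_ℂ‖ ^ 2 := fun y =>
    Summable.of_nonneg_of_le (fun f => by positivity) (hle y) ((hS y).summable.mul_left _)
  have hmem : ∀ y : H, Memℓp (fun f => ⟪w, S f y⟫_ℂ) 2 := fun y =>
    memℓp_gen (by simpa using hsum y)
  let R0 : H →ₗ[ℂ] lp (fun _ : I => ℂ) 2 :=
    { toFun := fun y => ⟨_, hmem y⟩
      map_add' := fun y z => by ext f; simp [inner_add_right]; rfl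
      map_smul' := fun a y => by ext f; simp [inner_smul_right] }
  have hR0 : ∀ y, ‖R0 y‖ ≤ ‖w‖ * ‖y‖ := fun y => by
    refine le_of_sq_le_sq ?_ (by positivity)
    rw [mul_pow]
    exact hasSum_le (hle y) (lp_hasSum_norm_sq (R0 y)) ((hS y).mul_left _)
  refine ⟨c.repr.symm.toContinuousLinearEquiv.toContinuousLinearMap ∘L R0.mkContinuous _ hR0,
    fun f y => ?_⟩
  rw [← c.repr_apply_apply]
  simp [R0]

end TensorChannels

/-! ### Kraus operators from an isometric dilation -/

section Dilation

variable {HA HB HE : Type*}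
  [NormedAddCommGroup HA] [InnerProductSpace ℂ HA] [CompleteSpace HA]
  [NormedAddCommGroup HB] [InnerProductSpace ℂ HB] [CompleteSpace HB]
  [NormedAddCommGroup HE] [InnerProductSpace ℂ HE] [CompleteSpace HE]

/-- `x ↦ x ⊗ y` as a continuous linear map. -/
def tensorRight (y : HE) : HB →L[ℂ] HilbertTensor HB HE :=
  UniformSpace.Completion.toComplL ∘L (TensorProduct.mkL ℂ HB HE).flip y

/-- `y ↦ x ⊗ y` as a continuous linear map. -/
def tensorLeft (x : HB) : HE →L[ℂ] HilbertTensor HB HE :=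
  UniformSpace.Completion.toComplL ∘L TensorProduct.mkL ℂ HB HE x

lemma tensorRight_apply (x : HB) (y : HE) : tensorRight y x = pureTensor x y := rfl

lemma tensorLeft_apply (x : HB) (y : HE) : tensorLeft x y = pureTensor x y := rfl

lemma inner_pureTensor (x x' : HB) (y y' : HE) :
    ⟪pureTensor x y, pureTensor x' y'⟫_ℂ = ⟪x, x'⟫_ℂ * ⟪y, y'⟫_ℂ := by
  rw [pureTensor, pureTensor, UniformSpace.Completion.inner_coe, TensorProduct.inner_tmul]

lemma eq_zero_of_inner_pureTensor {v : HilbertTensor HB HE}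
    (h : ∀ x y, ⟪v, pureTensor x y⟫_ℂ = 0) : v = 0 := by
  have h1 : ∀ z : HB ⊗[ℂ] HE, ⟪v, (z : HilbertTensor HB HE)⟫_ℂ = 0 := fun z => by
    induction z using TensorProduct.induction_on with
    | zero => rw [UniformSpace.Completion.coe_zero, inner_zero_right]
    | tmul x y => exact h x y
    | add x y hx hy => rw [UniformSpace.Completion.coe_add, inner_add_right, hx, hy, add_zero]
  have h2 : ⟪v, v⟫_ℂ = 0 := by
    refine UniformSpace.Completion.induction_on (p := fun w => ⟪v, w⟫_ℂ = 0) v ?_ h1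
    exact isClosed_eq (by fun_prop) continuous_const
  exact inner_self_eq_zero.1 h2

/-- The product basis of `HB ⊗ HE`. -/
def pairBasis {ι κ : Type*} (b : HilbertBasis ι ℂ HB) (c : HilbertBasis κ ℂ HE) :
    HilbertBasis (ι × κ) ℂ (HilbertTensor HB HE) :=
  HilbertBasis.mkOfOrthogonalEqBot (v := fun p : ι × κ => pureTensor (b p.1) (c p.2))
    (by
      classical
      rw [orthonormal_iff_ite]
      intro p q
      rw [inner_pureTensor, orthonormal_iff_ite.1 b.orthonormal, orthonormal_iff_ite.1 c.orthonormal]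
      by_cases h1 : p.1 = q.1 <;> by_cases h2 : p.2 = q.2 <;> simp [Prod.ext_iff, h1, h2])
    (by
      rw [eq_bot_iff]
      intro v hv
      rw [Submodule.mem_bot]
      have hv0 : ∀ i j, ⟪v, pureTensor (b i) (c j)⟫_ℂ = 0 := fun i j =>
        (Submodule.mem_orthogonal' _ v).1 hv _ (Submodule.subset_span ⟨(i, j), rfl⟩)
      refine eq_zero_of_inner_pureTensor fun x y => ?_
      refine eq_zero_of_inner_basis c (tensorLeft x) v (fun j => ?_) y
      exact eq_zero_of_inner_basis b (tensorRight (c j)) v (fun i => hv0 i j) x)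

lemma pairBasis_apply {ι κ : Type*} (b : HilbertBasis ι ℂ HB) (c : HilbertBasis κ ℂ HE)
    (p : ι × κ) : pairBasis b c p = pureTensor (b p.1) (c p.2) := by
  simp [pairBasis]

/-- Complementary channels have Kraus families which are slices of a common isometry. -/
lemma IsComplementary.exists_kraus {N : Channel HA HB} {Nc : Channel HA HE}
    (h : IsComplementary N Nc) :
    ∃ (S : basisIndex HE → HA →L[ℂ] HB) (R : basisIndex HB → HA →L[ℂ] HE),
      IsKrausFamily S ∧ N.HasKraus S ∧ IsKrausFamily R ∧ Nc.HasKraus R ∧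
      ∀ l j x, ⟪fixedBasis HE l, R j x⟫_ℂ = ⟪fixedBasis HB j, S l x⟫_ℂ := by
  obtain ⟨U, hU⟩ := h
  let b := fixedBasis HB
  let c := fixedBasis HE
  -- Slicing U along the basis of the environment gives Kraus operators of `N`, slicing along the
  -- basis of the receiver gives those of `Nc`; both have the matrix elements ⟨b_j ⊗ c_l, U x⟩.
  let S : basisIndex HE → HA →L[ℂ] HB := fun l =>
    (tensorRight (HB := HB) (c l))† ∘L U.toContinuousLinearMap
  let R : basisIndex HB → HA →L[ℂ] HE := fun j =>
    (tensorLeft (HE := HE) (b j))† ∘L U.toContinuousLinearMap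
  have hSi : ∀ l y x, ⟪y, S l x⟫_ℂ = ⟪pureTensor y (c l), U x⟫_ℂ := fun l y x => by
    simp only [S, ContinuousLinearMap.comp_apply, ContinuousLinearMap.adjoint_inner_right,
      tensorRight_apply]
    rfl
  have hRi : ∀ j y x, ⟪y, R j x⟫_ℂ = ⟪pureTensor (b j) y, U x⟫_ℂ := fun j y x => by
    simp only [R, ContinuousLinearMap.comp_apply, ContinuousLinearMap.adjoint_inner_right,
      tensorLeft_apply]
    rfl
  have hpair : ∀ x, HasSum (fun p : basisIndex HB × basisIndex HE =>
      ‖⟪pureTensor (b p.1) (c p.2), U x⟫_ℂ‖ ^ 2) (‖x‖ ^ 2) := fun x => by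
    have := hasSum_norm_inner_sq (pairBasis b c) (U x)
    simpa only [pairBasis_apply, U.norm_map] using this
  have hSadj : ∀ l y, ((S l)†) y = (U.toContinuousLinearMap†) (pureTensor y (c l)) := fun l y => by
    simp [S, ContinuousLinearMap.adjoint_comp, tensorRight_apply]
  have hRadj : ∀ j y, ((R j)†) y = (U.toContinuousLinearMap†) (pureTensor (b j) y) := fun j y => by
    simp [R, ContinuousLinearMap.adjoint_comp, tensorLeft_apply]
  refine ⟨S, R, fun x => ?_, fun A u v => ?_, fun x => ?_, fun A u v => ?_, fun l j x => ?_⟩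
  · refine HasSum.prod_fiberwise ((Equiv.prodComm _ _).hasSum_iff.2 (hpair x)) fun l => ?_
    refine hasSum_of_eq (hasSum_norm_inner_sq b (S l x)) (fun j => ?_) rfl
    rw [hSi]
    rfl
  · refine hasSum_of_eq ((hU A).1 u v) (fun l => ?_) rfl
    rw [hSadj, hSadj, ContinuousLinearMap.adjoint_inner_left]
    rfl
  · refine HasSum.prod_fiberwise (hpair x) fun l => ?_
    refine hasSum_of_eq (hasSum_norm_inner_sq c (R l x)) (fun j => ?_) rfl
    rw [hRi]
  · refine hasSum_of_eq ((hU A).2 u v) (fun l => ?_) rfl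
    rw [hRadj, hRadj, ContinuousLinearMap.adjoint_inner_left]
    rfl
  · exact (hRi j _ x).trans (hSi l _ x).symm

lemma HilbertBasis.isParseval {ι : Type*} (b : HilbertBasis ι ℂ HB) : IsParseval b :=
  fun x y => b.hasSum_inner_mul_inner x y

/-- The tensor powers of complementary channels are complementary. -/
lemma IsComplementary.exists_tensorPower {N : Channel HA HB} {Nc : Channel HA HE}
    (h : IsComplementary N Nc) (n : ℕ) {Nn : Channel (TensorPow HA n) (TensorPow HB n)}
    (hNn : IsTensorPower N n Nn) :
    ∃ (Ncn : Channel (TensorPow HA n) (TensorPow HE n))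
      (S : (Fin n → basisIndex HE) → TensorPow HA n →L[ℂ] TensorPow HB n),
      IsTensorPower Nc n Ncn ∧ IsKrausFamily S ∧ Nn.HasKraus S ∧
      IsKrausComplement (tensorBasis (fixedBasis HE) n) S Ncn := by
  obtain ⟨S, R, hS, hNS, hR, hNR, hSR⟩ := h.exists_kraus
  obtain ⟨Sn, hSn, hSn'⟩ := hS.exists_tensor n
  obtain ⟨Rn, hRn, hRn'⟩ := hR.exists_tensor n
  refine ⟨krausChannel hRn, Sn, isTensorPower_krausChannel hNR hRn hRn', hSn, ?_, ?_⟩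
  · have := hNn.toLin_eq (isTensorPower_krausChannel hNS hSn hSn')
    intro A u v
    rw [this]
    exact krausChannel_hasKraus hSn A u v
  · refine (krausChannel_hasKraus hRn).isKrausComplement
      (HilbertBasis.isParseval (tensorBasis (fixedBasis HB) n)) fun g f y => ?_
    -- The slice relation multiplies over the tensor factors, so it holds on elementary tensors and
    -- extends by continuity.
    have : (innerSL ℂ (tensorBasis (fixedBasis HE) n f)) ∘L Rn g =
        (innerSL ℂ (tensorBasis (fixedBasis HB) n g)) ∘L Sn f := by
      refine clm_ext_of_tensorVec fun x => ?_
      simp only [ContinuousLinearMap.comp_apply, innerSL_apply_apply, tensorBasis_apply, hSn',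
        hRn', inner_tensorVec, hSR]
    exact DFunLike.congr_fun this y

end Dilation

/-! ### The trace norm on trace-class operators -/

section TraceDist

variable {H : Type*} [NormedAddCommGroup H] [InnerProductSpace ℂ H] [CompleteSpace H]

/-- The real-valued trace norm of a trace-class operator. -/
def tnorm (A : TraceClass H) : ℝ := (traceNorm (A : H →L[ℂ] H)).toReal

lemma tnorm_nonneg (A : TraceClass H) : 0 ≤ tnorm A := ENNReal.toReal_nonneg

lemma tnorm_add_le (A B : TraceClass H) : tnorm (A + B) ≤ tnorm A + tnorm B := by
  have hA : traceNorm (A : H →L[ℂ] H) ≠ ∞ := A.2.ne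
  have hB : traceNorm (B : H →L[ℂ] H) ≠ ∞ := B.2.ne
  rw [tnorm, tnorm, tnorm, ← ENNReal.toReal_add hA hB]
  exact ENNReal.toReal_mono (ENNReal.add_ne_top.2 ⟨hA, hB⟩) (traceNorm_add_le _ _)

lemma tnorm_smul (c : ℂ) (A : TraceClass H) : tnorm (c • A) = ‖c‖ * tnorm A := by
  rw [tnorm, tnorm, Submodule.coe_smul, traceNorm_smul, ENNReal.toReal_mul, toReal_enorm]

lemma tnorm_neg (A : TraceClass H) : tnorm (-A) = tnorm A := by
  rw [← neg_one_smul ℂ A, tnorm_smul]; simp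

lemma tnorm_sub_le (A B : TraceClass H) : tnorm (A - B) ≤ tnorm A + tnorm B := by
  rw [sub_eq_add_neg, ← tnorm_neg B]
  exact tnorm_add_le _ _

lemma tnorm_sum_le {ι : Type*} (s : Finset ι) (A : ι → TraceClass H) :
    tnorm (∑ i ∈ s, A i) ≤ ∑ i ∈ s, tnorm (A i) := by
  classical
  induction s using Finset.induction_on with
  | empty => simp [tnorm, traceNorm_zero]
  | insert a s ha ih =>
    rw [Finset.sum_insert ha, Finset.sum_insert ha]
    exact (tnorm_add_le _ _).trans (by gcongr)

lemma tnorm_of_nonneg {A : TraceClass H} (hA : 0 ≤ (A : H →L[ℂ] H)) :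
    tnorm A = (trace (A : H →L[ℂ] H)).re := by
  rw [tnorm, traceNorm_eq_trace A.2 hA, ENNReal.toReal_ofReal]
  exact (Complex.nonneg_iff.1 (trace_nonneg_of_mem A.2 hA)).1

lemma IsState.tnorm_eq {A : TraceClass H} (hA : IsState A) : tnorm A = 1 := by
  rw [tnorm_of_nonneg hA.1, hA.2, Complex.one_re]

lemma IsSumRankOne.tnorm_le {T : Type*} {A : TraceClass H} {a a' : T → H}
    (h : IsSumRankOne (A : H →L[ℂ] H) a a') : tnorm A ≤ ∑' t, ‖a t‖ * ‖a' t‖ :=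
  ENNReal.toReal_le_of_le_ofReal (tsum_nonneg fun t => by positivity) h.traceNorm_le

lemma IsState.convex {A B : TraceClass H} (hA : IsState A) (hB : IsState B) {r : ℝ} (h0 : 0 ≤ r)
    (h1 : r ≤ 1) : IsState (((1 - r : ℝ) : ℂ) • A + (r : ℂ) • B) := by
  refine ⟨?_, ?_⟩
  · rw [nonneg_iff_inner]
    intro x
    have e : ⟪x, ((((1 - r : ℝ) : ℂ) • A + (r : ℂ) • B : TraceClass H) : H →L[ℂ] H) x⟫_ℂ =
        ((1 - r : ℝ) : ℂ) * ⟪x, (A : H →L[ℂ] H) x⟫_ℂ + (r : ℂ) * ⟪x, (B : H →L[ℂ] H) x⟫_ℂ := by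
      simp [inner_add_right, inner_smul_right]
    rw [e]
    exact add_nonneg
      (mul_nonneg (Complex.zero_le_real.2 (by linarith)) (nonneg_iff_inner.1 hA.1 x))
      (mul_nonneg (Complex.zero_le_real.2 h0) (nonneg_iff_inner.1 hB.1 x))
  · rw [← traceL_one, map_add, map_smul, map_smul, traceL_one, traceL_one, hA.2, hB.2]
    simp

lemma trace_mul_nonneg {W : H →L[ℂ] H} (hW : 0 ≤ W) {A : TraceClass H}
    (hA : 0 ≤ (A : H →L[ℂ] H)) : 0 ≤ trace (W * (A : H →L[ℂ] H)) := by
  obtain ⟨a, ha⟩ := exists_isSumRankOne_of_nonneg A.2 hA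
  exact (ha.hasSum_trace_mul W).nonneg fun t => nonneg_iff_inner.1 hW _

lemma isState_ketBra {x : H} (hx : ‖x‖ = 1) : IsState (ketBra x x) :=
  ⟨rankOne_self_nonneg x, by
    rw [coe_ketBra, trace_rankOne, inner_self_eq_norm_sq_to_K, hx]; simp⟩

lemma trace_mul_sub_left {W W' : H →L[ℂ] H} (A : TraceClass H) :
    trace ((W - W') * (A : H →L[ℂ] H)) =
      trace (W * (A : H →L[ℂ] H)) - trace (W' * (A : H →L[ℂ] H)) := by
  refine (hasSum_trace_basis A.2 (W - W') (fixedBasis H)).unique ?_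
  exact hasSum_of_eq ((hasSum_trace_basis A.2 W (fixedBasis H)).sub
    (hasSum_trace_basis A.2 W' (fixedBasis H))) (fun i => by simp [inner_sub_right]) rfl

lemma trace_mul_mono {W W' : H →L[ℂ] H} (hW : W ≤ W') {A : TraceClass H}
    (hA : 0 ≤ (A : H →L[ℂ] H)) :
    (trace (W * (A : H →L[ℂ] H))).re ≤ (trace (W' * (A : H →L[ℂ] H))).re := by
  have h1 := trace_mul_nonneg (sub_nonneg.2 hW) hA
  rw [trace_mul_sub_left] at h1
  have := (Complex.nonneg_iff.1 h1).1
  rw [Complex.sub_re] at this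
  linarith

end TraceDist

/-! ### Energy -/

section EnergyLemmas

variable {ι H : Type*} [NormedAddCommGroup H] [InnerProductSpace ℂ H] [CompleteSpace H]
  (G : EnergyObservable ι H)

/-- The spectral cutoff can be dropped because finitely many eigenvalues always lie below a common
integer. Additivity and homogeneity of the energy then hold term by term. -/
lemma energy_eq_tsum (A : H →L[ℂ] H) :
    G.energy A = ∑' j, ENNReal.ofReal (G.eig j * (⟪G.basis j, A (G.basis j)⟫_ℂ).re) := by
  classical
  unfold EnergyObservable.energy
  apply le_antisymm
  · refine iSup_le fun n => ENNReal.tsum_le_tsum fun j => ?_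
    split_ifs
    · exact le_rfl
    · exact zero_le
  · rw [ENNReal.tsum_eq_iSup_sum]
    refine iSup_le fun s => ?_
    obtain ⟨n, hn⟩ := exists_nat_ge (∑ j ∈ s, G.eig j)
    refine le_trans ?_ (le_iSup _ n)
    refine le_trans (le_of_eq ?_) (ENNReal.sum_le_tsum s)
    refine Finset.sum_congr rfl fun j hj => ?_
    rw [if_pos]
    exact (Finset.single_le_sum (fun i _ => G.eig_nonneg i) hj).trans hn

variable {G}

lemma re_inner_nonneg_of_nonneg {A : H →L[ℂ] H} (hA : 0 ≤ A) (x : H) : 0 ≤ (⟪x, A x⟫_ℂ).re :=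
  (Complex.nonneg_iff.1 (nonneg_iff_inner.1 hA x)).1

lemma energy_add {A B : H →L[ℂ] H} (hA : 0 ≤ A) (hB : 0 ≤ B) :
    G.energy (A + B) = G.energy A + G.energy B := by
  rw [energy_eq_tsum, energy_eq_tsum, energy_eq_tsum, ← ENNReal.tsum_add]
  congr 1; ext j
  rw [← ENNReal.ofReal_add (mul_nonneg (G.eig_nonneg j) (re_inner_nonneg_of_nonneg hA _))
    (mul_nonneg (G.eig_nonneg j) (re_inner_nonneg_of_nonneg hB _))]
  simp [inner_add_right, mul_add]

lemma energy_zero : G.energy (0 : H →L[ℂ] H) = 0 := by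
  rw [energy_eq_tsum]; simp

lemma energy_sum {κ : Type*} (s : Finset κ) {A : κ → H →L[ℂ] H} (hA : ∀ k, 0 ≤ A k) :
    G.energy (∑ k ∈ s, A k) = ∑ k ∈ s, G.energy (A k) := by
  classical
  induction s using Finset.induction_on with
  | empty => simp [energy_zero]
  | insert a s ha ih =>
    rw [Finset.sum_insert ha, Finset.sum_insert ha, energy_add (hA a)
      (Finset.sum_nonneg fun k _ => hA k), ih]

lemma energy_smul {r : ℝ} (hr : 0 ≤ r) (A : H →L[ℂ] H) :
    G.energy ((r : ℂ) • A) = ENNReal.ofReal r * G.energy A := by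
  rw [energy_eq_tsum, energy_eq_tsum, ← ENNReal.tsum_mul_left]
  congr 1; ext j
  rw [← ENNReal.ofReal_mul hr]
  congr 1
  simp [inner_smul_right]
  ring

lemma le_energy {A : TraceClass H} (hA : IsState A) {P : ℝ} (hP : 0 ≤ P)
    (h : ∀ j, P ≤ G.eig j) : ENNReal.ofReal P ≤ G.energy (A : H →L[ℂ] H) := by
  have h1 := Complex.hasSum_re (hasSum_trace_basis A.2 1 G.basis)
  rw [one_mul, hA.2, Complex.one_re] at h1
  simp only [one_apply_eq_self] at h1
  have h2 := ENNReal.ofReal_tsum_of_nonneg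
    (fun j => re_inner_nonneg_of_nonneg hA.1 (G.basis j)) h1.summable
  rw [h1.tsum_eq] at h2
  rw [energy_eq_tsum]
  calc ENNReal.ofReal P = ENNReal.ofReal P * ENNReal.ofReal 1 := by simp
    _ = ∑' j, ENNReal.ofReal P * ENNReal.ofReal
        (⟪G.basis j, (A : H →L[ℂ] H) (G.basis j)⟫_ℂ).re := by
      rw [h2, ENNReal.tsum_mul_left]
    _ ≤ _ := ENNReal.tsum_le_tsum fun j => by
      rw [← ENNReal.ofReal_mul hP]
      exact ENNReal.ofReal_le_ofReal
        (mul_le_mul_of_nonneg_right (h j) (re_inner_nonneg_of_nonneg hA.1 _))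

lemma energy_eigenstate (j : ι) :
    G.energy (rankOne ℂ (G.basis j) (G.basis j)) = ENNReal.ofReal (G.eig j) := by
  classical
  rw [energy_eq_tsum, tsum_eq_single j]
  · simp [G.basis.orthonormal.1 j]
  · intro k hk
    have := orthonormal_iff_ite.1 G.basis.orthonormal j k
    rw [if_neg (Ne.symm hk)] at this
    simp [this]

end EnergyLemmas

/-! ### Expurgation -/

section Expurgation

lemma card_filter_lt_mul_le {κ : Type*} [Fintype κ] [DecidableEq κ] {e : κ → ℝ} (he : ∀ k, 0 ≤ e k)
    {c s : ℝ} [DecidablePred fun k => c < e k] (hs : ∑ k, e k ≤ s) :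
    ((Finset.univ.filter fun k => c < e k).card : ℝ) * c ≤ s := by
  calc ((Finset.univ.filter fun k => c < e k).card : ℝ) * c
      = ∑ k ∈ Finset.univ.filter fun k => c < e k, c := by simp
    _ ≤ ∑ k ∈ Finset.univ.filter fun k => c < e k, e k :=
        Finset.sum_le_sum fun k hk => (Finset.mem_filter.1 hk).2.le
    _ ≤ ∑ k, e k := Finset.sum_le_sum_of_subset_of_nonneg (Finset.filter_subset _ _)
        fun k _ _ => he k
    _ ≤ s := hs

variable {ι H : Type*} [NormedAddCommGroup H] [InnerProductSpace ℂ H] [CompleteSpace H]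

open Classical in
/-- Among states with average energy at most `P`, at most a fraction `θ` has energy above `Pb`. -/
def ExpurgationBound (G : EnergyObservable ι H) (P Pb θ : ℝ) : Prop :=
  ∀ (κ : Type) [Fintype κ] (ρ : κ → TraceClass H), (∀ m, IsState (ρ m)) →
    ∑ m, G.energy (ρ m : H →L[ℂ] H) ≤ Fintype.card κ * ENNReal.ofReal P →
    ((Finset.univ.filter fun m => ENNReal.ofReal Pb < G.energy (ρ m : H →L[ℂ] H)).card : ℝ) ≤
      θ * Fintype.card κ

/-- Mixing with a suitable state reduces the energy bound from `Pb` to `P`. -/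
def MixingBound (G : EnergyObservable ι H) (P Pb r : ℝ) : Prop :=
  ∀ τ₀ : TraceClass H, IsState τ₀ → G.energy (τ₀ : H →L[ℂ] H) ≤ ENNReal.ofReal Pb →
    ∃ τ : TraceClass H, IsState τ ∧ ∀ ρ : TraceClass H, 0 ≤ (ρ : H →L[ℂ] H) →
      G.energy (ρ : H →L[ℂ] H) ≤ ENNReal.ofReal Pb →
      G.energy ((((1 - r : ℝ) : ℂ) • ρ + (r : ℂ) • τ : TraceClass H) : H →L[ℂ] H) ≤
        ENNReal.ofReal P

lemma energy_mix {G : EnergyObservable ι H} {r : ℝ} (h0 : 0 ≤ r) (h1 : r ≤ 1) {ρ τ : TraceClass H}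
    (hρ : 0 ≤ (ρ : H →L[ℂ] H)) (hτ : 0 ≤ (τ : H →L[ℂ] H)) :
    G.energy ((((1 - r : ℝ) : ℂ) • ρ + (r : ℂ) • τ : TraceClass H) : H →L[ℂ] H) =
      ENNReal.ofReal (1 - r) * G.energy (ρ : H →L[ℂ] H) +
      ENNReal.ofReal r * G.energy (τ : H →L[ℂ] H) := by
  have hs : ∀ (s : ℝ) (A : H →L[ℂ] H), 0 ≤ s → 0 ≤ A → 0 ≤ (s : ℂ) • A := fun s A hs hA => by
    rw [ContinuousLinearMap.nonneg_iff_isPositive] at hA ⊢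
    exact hA.smul_of_nonneg (Complex.zero_le_real.2 hs)
  rw [Submodule.coe_add, Submodule.coe_smul, Submodule.coe_smul,
    energy_add (hs _ _ (by linarith) hρ) (hs _ _ h0 hτ), energy_smul (by linarith), energy_smul h0]

/-- The same Pb and θ work for every block length, which keeps the loss in code size independent of
n. The restriction n > 0 matters: with 1/0 = 0 the energy observable for n = 0 vanishes. -/
lemma exists_expurgation_mixing [CompleteSpace H] (G : EnergyObservable ι H) {P : ℝ} (hP : 0 ≤ P)
    {r : ℝ} (h0 : 0 < r) (h1 : r < 1) :
    ∃ Pb θ : ℝ, 0 ≤ θ ∧ θ < 1 ∧ ∀ n : ℕ, 0 < n →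
      ExpurgationBound (G.ext n) P Pb θ ∧ MixingBound (G.ext n) P Pb r := by
  classical
  by_cases hG : ∃ j, G.eig j < P
  · obtain ⟨j, hj⟩ := hG
    have hg := G.eig_nonneg j
    have hP0 : 0 < P := hg.trans_lt hj
    -- With ηP = r(P - g_j), energy at most (1 + η)P becomes at most (1 - r)(1 + η)P + r g_j = P -
    -- rηP after mixing in the product eigenstate of energy g_j. Markov's inequality at the
    -- threshold (1 + η)P gives the fraction 1/(1 + η).
    set η := r * (P - G.eig j) / P with hη
    have hη0 : 0 < η := div_pos (mul_pos h0 (by linarith)) hP0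
    have hηP : η * P = r * (P - G.eig j) := by rw [hη]; field_simp
    refine ⟨(1 + η) * P, 1 / (1 + η), by positivity,
      by rw [div_lt_one (by linarith)]; linarith, fun n hn => ⟨?_, ?_⟩⟩
    · intro κ _ ρ hρ hs
      have hfin : ∀ m, (G.ext n).energy (ρ m : TensorPow H n →L[ℂ] TensorPow H n) ≠ ∞ :=
        fun m => ((Finset.single_le_sum (f := fun m => (G.ext n).energy
          (ρ m : TensorPow H n →L[ℂ] TensorPow H n)) (fun _ _ => zero_le)
          (Finset.mem_univ m)).trans_lt (hs.trans_lt
          (ENNReal.mul_lt_top (ENNReal.natCast_lt_top _) ENNReal.ofReal_lt_top))).ne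
      set e : κ → ℝ := fun m =>
        ((G.ext n).energy (ρ m : TensorPow H n →L[ℂ] TensorPow H n)).toReal with he
      have hs' : ∑ m, e m ≤ Fintype.card κ * P := by
        rw [he, ← ENNReal.toReal_sum fun m _ => hfin m]
        refine ENNReal.toReal_le_of_le_ofReal (by positivity) (hs.trans (le_of_eq ?_))
        rw [ENNReal.ofReal_mul (by positivity), ENNReal.ofReal_natCast]
      have h2 := card_filter_lt_mul_le (c := (1 + η) * P) (fun m => ENNReal.toReal_nonneg) hs'
      have h3 : (Finset.univ.filter fun m => ENNReal.ofReal ((1 + η) * P) <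
          (G.ext n).energy (ρ m : TensorPow H n →L[ℂ] TensorPow H n)) =
          Finset.univ.filter fun k => (1 + η) * P < e k := by
        ext m
        simp only [Finset.mem_filter, Finset.mem_univ, true_and]
        exact ENNReal.ofReal_lt_iff_lt_toReal (by positivity) (hfin m)
      have h4 : ∀ c : ℝ, c * ((1 + η) * P) ≤ Fintype.card κ * P →
          c ≤ 1 / (1 + η) * Fintype.card κ := fun c hc => by
        rw [← mul_assoc] at hc
        have := le_of_mul_le_mul_right hc hP0
        rw [one_div, inv_mul_eq_div, le_div_iff₀ (by linarith)]
        exact this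
      refine h4 _ (le_trans (le_of_eq ?_) h2)
      congr 2
      convert congrArg Finset.card h3
    · intro τ₀ _ _
      have hnorm : ‖(G.ext n).basis fun _ => j‖ = 1 := (G.ext n).basis.orthonormal.1 _
      refine ⟨ketBra ((G.ext n).basis fun _ => j) ((G.ext n).basis fun _ => j),
        isState_ketBra hnorm, fun ρ hρ hE => ?_⟩
      rw [energy_mix h0.le h1.le hρ (isState_ketBra hnorm).1, coe_ketBra, energy_eigenstate]
      have heig : (G.ext n).eig (fun _ => j) = G.eig j := by
        simp only [EnergyObservable.ext, Finset.sum_const, Finset.card_univ, Fintype.card_fin,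
          nsmul_eq_mul]
        field_simp
      rw [heig, ← ENNReal.ofReal_mul h0.le]
      calc _ ≤ ENNReal.ofReal (1 - r) * ENNReal.ofReal ((1 + η) * P) +
            ENNReal.ofReal (r * G.eig j) := by gcongr
        _ = ENNReal.ofReal ((1 - r) * ((1 + η) * P) + r * G.eig j) := by
          rw [← ENNReal.ofReal_mul (by linarith), ENNReal.ofReal_add]
          · exact mul_nonneg (by linarith) (by positivity)
          · positivity
        _ ≤ _ := by
          refine ENNReal.ofReal_le_ofReal ?_
          have : 0 ≤ r * (η * P) := by positivity
          nlinarith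
  -- No eigenvalue lies below P, so every state has energy at least P and an average of at most P
  -- forces equality for each one. No state of lower energy is available; the one mixed in is the
  -- reference state supplied by `MixingBound`.
  · push Not at hG
    refine ⟨P, 0, le_rfl, one_pos, fun n hn => ⟨?_, ?_⟩⟩
    · intro κ _ ρ hρ hs
      have heig : ∀ f, P ≤ (G.ext n).eig f := fun f => by
        simp only [EnergyObservable.ext]
        have h2 : ∑ _i : Fin n, P ≤ ∑ i, G.eig (f i) := Finset.sum_le_sum fun i _ => hG _
        rw [Finset.sum_const, Finset.card_univ, Fintype.card_fin, nsmul_eq_mul] at h2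
        have hn' : (0 : ℝ) < n := by exact_mod_cast hn
        rw [one_div, inv_mul_eq_div, le_div_iff₀ hn']
        linarith
      have hlow : ∀ m, ENNReal.ofReal P ≤
          (G.ext n).energy (ρ m : TensorPow H n →L[ℂ] TensorPow H n) :=
        fun m => le_energy (hρ m) hP heig
      have hall : ∀ m, ¬ ENNReal.ofReal P <
          (G.ext n).energy (ρ m : TensorPow H n →L[ℂ] TensorPow H n) := fun m hm => by
        have h3 := ENNReal.sum_lt_sum_of_nonempty (s := ({m} : Finset κ)) ⟨m, by simp⟩
          (f := fun _ => ENNReal.ofReal P) (g := fun m =>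
          (G.ext n).energy (ρ m : TensorPow H n →L[ℂ] TensorPow H n)) (by simpa using hm)
        rw [Finset.sum_singleton, Finset.sum_singleton] at h3
        have h4 : ∑ k ∈ Finset.univ.erase m, ENNReal.ofReal P ≤ ∑ k ∈ Finset.univ.erase m,
            (G.ext n).energy (ρ k : TensorPow H n →L[ℂ] TensorPow H n) :=
          Finset.sum_le_sum fun k _ => hlow k
        have h5 : (Fintype.card κ : ℝ≥0∞) * ENNReal.ofReal P =
            ENNReal.ofReal P + ∑ k ∈ Finset.univ.erase m, ENNReal.ofReal P := by
          rw [Finset.add_sum_erase _ (fun _ => ENNReal.ofReal P) (Finset.mem_univ m)]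
          simp
        rw [h5, ← Finset.add_sum_erase _ _ (Finset.mem_univ m)] at hs
        refine absurd hs (not_le.2 ?_)
        refine ENNReal.add_lt_add_of_lt_of_le ?_ h3 h4
        exact (ENNReal.sum_lt_top.2 fun _ _ => ENNReal.ofReal_lt_top).ne
      rw [Finset.filter_false_of_mem fun m _ => hall m]
      simp
    · intro τ₀ hτ₀ hE
      refine ⟨τ₀, hτ₀, fun ρ hρ hEρ => ?_⟩
      rw [energy_mix h0.le h1.le hρ hτ₀.1]
      calc _ ≤ ENNReal.ofReal (1 - r) * ENNReal.ofReal P + ENNReal.ofReal r * ENNReal.ofReal P := by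
            gcongr
        _ = ENNReal.ofReal P := by
          rw [← add_mul, ← ENNReal.ofReal_add (by linarith) h0.le]
          simp

end Expurgation

/-! ### Comparison of capacities -/

section Rates

/-- Half of the rate slack δ is reserved: for large n the extra factor 2^(nδ/2) exceeds 1/κ and pays
for the loss of a constant factor in the code size. -/
lemma capacity_mono {code code' : ℕ → ℕ → ℝ → Prop}
    (h : ∀ ε : ℝ, 0 < ε → ε < 1 → ∃ ε₀ : ℝ, 0 < ε₀ ∧ ε₀ < 1 ∧ ∃ κ : ℝ, 0 < κ ∧
      ∀ n : ℕ, 0 < n → ∀ M : ℕ, 0 < M → code n M ε₀ → ∃ M' : ℕ, κ * M ≤ M' ∧ code' n M' ε) :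
    capacity code ≤ capacity code' := by
  refine iSup_le fun R => ?_
  refine le_iSup (fun R : {R : ℝ // Achievable code' R} => (R.1 : EReal)) ⟨R.1, ?_⟩
  intro ε hε0 hε1 δ hδ
  obtain ⟨ε₀, h0, h1, κ, hκ, hcode⟩ := h ε hε0 hε1
  have hgrow : Tendsto (fun n : ℕ => ((2 : ℝ) ^ (δ / 2)) ^ n) atTop atTop :=
    tendsto_pow_atTop_atTop_of_one_lt (Real.one_lt_rpow (by norm_num) (by positivity))
  filter_upwards [R.2 ε₀ h0 h1 (δ / 2) (by positivity), eventually_gt_atTop 0,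
    hgrow.eventually_ge_atTop κ⁻¹] with n ⟨M, hM, hc⟩ hn hg
  have hM0 : 0 < M := by
    have : (0 : ℝ) < M := (Real.rpow_pos_of_pos (by norm_num) _).trans_le hM
    exact_mod_cast this
  obtain ⟨M', hM', hc'⟩ := hcode n hn M hM0 hc
  refine ⟨M', le_trans ?_ hM', hc'⟩
  have hsplit : (2 : ℝ) ^ ((n : ℝ) * (R.1 - δ / 2)) =
      ((2 : ℝ) ^ (δ / 2)) ^ n * (2 : ℝ) ^ ((n : ℝ) * (R.1 - δ)) := by
    rw [← Real.rpow_mul_natCast (by norm_num), ← Real.rpow_add (by norm_num)]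
    congr 1
    ring
  rw [hsplit] at hM
  have hp : (0 : ℝ) < (2 : ℝ) ^ ((n : ℝ) * (R.1 - δ)) := Real.rpow_pos_of_pos (by norm_num) _
  have h2 : 1 ≤ κ * ((2 : ℝ) ^ (δ / 2)) ^ n := by
    rw [inv_le_iff_one_le_mul₀ hκ] at hg
    linarith [mul_comm κ (((2 : ℝ) ^ (δ / 2)) ^ n)]
  calc (2 : ℝ) ^ ((n : ℝ) * (R.1 - δ)) ≤
        (κ * ((2 : ℝ) ^ (δ / 2)) ^ n) * (2 : ℝ) ^ ((n : ℝ) * (R.1 - δ)) :=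
        le_mul_of_one_le_left hp.le h2
    _ = κ * (((2 : ℝ) ^ (δ / 2)) ^ n * (2 : ℝ) ^ ((n : ℝ) * (R.1 - δ))) := by ring
    _ ≤ κ * M := by gcongr

end Rates

/-! ### Private communication and secret key transmission -/

section PrivateKey

variable {ι HA HB HE : Type*}
  [NormedAddCommGroup HA] [InnerProductSpace ℂ HA] [CompleteSpace HA]
  [NormedAddCommGroup HB] [InnerProductSpace ℂ HB] [CompleteSpace HB]
  [NormedAddCommGroup HE] [InnerProductSpace ℂ HE] [CompleteSpace HE]
  {N : Channel HA HB} {Nc : Channel HA HE} {G : EnergyObservable ι HA} {P : ℝ}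

lemma PrivateCode.secretKeyCode {n M : ℕ} {ε : ℝ} (hM : 0 < M) (h : PrivateCode N Nc G P n M ε) :
    SecretKeyCode N Nc G P n M ε := by
  obtain ⟨Nn, Ncn, hN, hNc, ρ, Λ, ω, hρ, hΛ, hω, hall⟩ := h
  have hM' : (0 : ℝ) < M := by exact_mod_cast hM
  refine ⟨Nn, Ncn, hN, hNc, ρ, Λ, ω, hρ, hΛ, hω, ?_, ?_, ?_⟩
  · refine ENNReal.div_le_of_le_mul ?_
    calc _ ≤ ∑ _m : Fin M, ENNReal.ofReal P := Finset.sum_le_sum fun m _ => (hall m).1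
      _ = _ := by simp [mul_comm]
  · rw [one_div, inv_mul_eq_div, le_div_iff₀ hM']
    calc _ = ∑ _m : Fin M, (1 - ε) := by simp; ring
      _ ≤ _ := Finset.sum_le_sum fun m _ => (hall m).2.1
  · rw [one_div (M : ℝ), inv_mul_eq_div, div_le_iff₀ hM']
    calc _ ≤ ∑ _m : Fin M, ε := Finset.sum_le_sum fun m _ => (hall m).2.2
      _ = _ := by simp [mul_comm]

/-- The elements of a POVM with index in a set `s`, the remaining ones being added to one of
them. -/
lemma IsPOVM.exists_restrict {H : Type*} [NormedAddCommGroup H] [InnerProductSpace ℂ H]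
    [CompleteSpace H] {M M' : ℕ} {Λ : Fin M → H →L[ℂ] H} (hΛ : IsPOVM Λ) (hM' : 0 < M')
    (s : Finset (Fin M)) (e : Fin M' ≃ s) :
    ∃ Λ' : Fin M' → H →L[ℂ] H, IsPOVM Λ' ∧ ∀ m, Λ (e m) ≤ Λ' m := by
  classical
  let R : H →L[ℂ] H := ∑ m ∈ sᶜ, Λ m
  have hR : 0 ≤ R := Finset.sum_nonneg fun m _ => hΛ.1 m
  let m₀ : Fin M' := ⟨0, hM'⟩
  have h1 : ∀ m, Λ (e m) ≤ Λ (e m) + (if m = m₀ then R else 0) := fun m => by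
    split_ifs
    · exact le_add_of_nonneg_right hR
    · simp
  refine ⟨fun m => Λ (e m) + (if m = m₀ then R else 0), ⟨fun m => (hΛ.1 _).trans (h1 m), ?_⟩, h1⟩
  rw [Finset.sum_add_distrib, Finset.sum_ite_eq' Finset.univ m₀]
  simp only [Finset.mem_univ, if_true]
  rw [e.sum_comp (fun x : s => Λ x), Finset.sum_coe_sort s Λ, Finset.sum_add_sum_compl, hΛ.2]

lemma Channel.map_mix (N : Channel HA HB) (r : ℝ) (ρ τ : TraceClass HA) :
    N.toLin (((1 - r : ℝ) : ℂ) • ρ + (r : ℂ) • τ) =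
      ((1 - r : ℝ) : ℂ) • N.toLin ρ + (r : ℂ) • N.toLin τ := by
  rw [map_add, map_smul, map_smul]

lemma Channel.le_re_trace_mix (N : Channel HA HB) {r ε : ℝ} (hr0 : 0 ≤ r) (hr1 : r ≤ 1)
    (hε : 0 ≤ ε) {W : HB →L[ℂ] HB} (hW : 0 ≤ W) {ρ τ : TraceClass HA}
    (hρ : 1 - ε ≤ (trace (W * (N.toLin ρ : HB →L[ℂ] HB))).re) (hτ : 0 ≤ (τ : HA →L[ℂ] HA)) :
    1 - (ε + r) ≤ (trace (W * (N.toLin (((1 - r : ℝ) : ℂ) • ρ + (r : ℂ) • τ) :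
      HB →L[ℂ] HB))).re := by
  have h2 := (Complex.nonneg_iff.1 (trace_mul_nonneg hW (N.nonneg hτ))).1
  rw [N.map_mix, trace_mul_add, trace_mul_smul, trace_mul_smul, Complex.add_re,
    Complex.re_ofReal_mul, Complex.re_ofReal_mul]
  have h3 := mul_le_mul_of_nonneg_left hρ (by linarith : 0 ≤ 1 - r)
  nlinarith [mul_nonneg hr0 h2, mul_nonneg hr0 hε]

/-- By convexity of the norm, the part coming from τ adds at most its weight r, since half the trace
norm of a difference of two states is at most 1. -/
lemma Channel.tnorm_mix_le (N : Channel HA HB) {r ε : ℝ} (hr0 : 0 ≤ r) (hr1 : r ≤ 1)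
    {ρ τ : TraceClass HA} {ω : TraceClass HB} (hρ : 1 / 2 * tnorm (N.toLin ρ - ω) ≤ ε)
    (hτ : IsState τ) (hω : IsState ω) :
    1 / 2 * tnorm (N.toLin (((1 - r : ℝ) : ℂ) • ρ + (r : ℂ) • τ) - ω) ≤ ε + r := by
  have h2 : N.toLin (((1 - r : ℝ) : ℂ) • ρ + (r : ℂ) • τ) - ω =
      ((1 - r : ℝ) : ℂ) • (N.toLin ρ - ω) + (r : ℂ) • (N.toLin τ - ω) := by
    rw [N.map_mix]
    push_cast
    module
  have h3 : tnorm (N.toLin τ - ω) ≤ 2 := by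
    refine (tnorm_sub_le _ _).trans ?_
    rw [(N.isState hτ).tnorm_eq, hω.tnorm_eq]
    norm_num
  rw [h2]
  have h4 := tnorm_add_le (((1 - r : ℝ) : ℂ) • (N.toLin ρ - ω)) ((r : ℂ) • (N.toLin τ - ω))
  rw [tnorm_smul, tnorm_smul, Complex.norm_real, Complex.norm_real, Real.norm_eq_abs,
    Real.norm_eq_abs, abs_of_nonneg hr0, abs_of_nonneg (by linarith : 0 ≤ 1 - r)] at h4
  have h5 := tnorm_nonneg (N.toLin ρ - ω)
  nlinarith

/-- Three kinds of codewords are discarded: at most θM with large energy and, by Markov's inequality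
at the threshold ε', at most (1 - θ)M/4 each with large decoding error or large leakage. This leaves
(1 - θ)M/2 of them, which explains the error ε'(1 - θ)/4 of the given code. -/
lemma SecretKeyCode.exists_privateCode {n M : ℕ} {Pb θ r ε' : ℝ} (hM : 0 < M) (hP : 0 ≤ P)
    (hr0 : 0 < r) (hr1 : r < 1) (hθ1 : θ < 1) (hε' : 0 < ε')
    (hexp : ExpurgationBound (G.ext n) P Pb θ) (hmix : MixingBound (G.ext n) P Pb r)
    (h : SecretKeyCode N Nc G P n M (ε' * ((1 - θ) / 4))) :
    ∃ M' : ℕ, (1 - θ) / 2 * M ≤ M' ∧ PrivateCode N Nc G P n M' (ε' + r) := by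
  classical
  obtain ⟨Nn, Ncn, hN, hNc, ρ, Λ, ω, hρ, hΛ, hω, hE, hs, hd⟩ := h
  have hM' : (0 : ℝ) < M := by exact_mod_cast hM
  have hMne : (M : ℝ≥0∞) ≠ 0 := by exact_mod_cast hM.ne'
  set err : Fin M → ℝ := fun m =>
    1 - (trace (Λ m * (Nn.toLin (ρ m) : TensorPow HB n →L[ℂ] TensorPow HB n))).re with herr
  set dst : Fin M → ℝ := fun m => 1 / 2 * tnorm (Ncn.toLin (ρ m) - ω) with hdst
  have herr0 : ∀ m, 0 ≤ err m := fun m => by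
    have hle : Λ m ≤ 1 := by
      rw [← hΛ.2]
      exact Finset.single_le_sum (fun k _ => hΛ.1 k) (Finset.mem_univ m)
    have h1 := trace_mul_mono hle (Nn.isState (hρ m)).1
    rw [one_mul, (Nn.isState (hρ m)).2, Complex.one_re] at h1
    simp only [herr]
    linarith
  have hdst0 : ∀ m, 0 ≤ dst m := fun m => mul_nonneg (by norm_num) (tnorm_nonneg _)
  have hsE : ∑ m, (G.ext n).energy (ρ m : TensorPow HA n →L[ℂ] TensorPow HA n) ≤
      Fintype.card (Fin M) * ENNReal.ofReal P := by
    rw [ENNReal.div_le_iff hMne (ENNReal.natCast_ne_top M)] at hE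
    rwa [Fintype.card_fin, mul_comm]
  have hserr : ∑ m, err m ≤ M * (ε' * ((1 - θ) / 4)) := by
    rw [one_div, inv_mul_eq_div, le_div_iff₀ hM'] at hs
    rw [herr, Finset.sum_sub_distrib]
    simp
    linarith
  have hsdst : ∑ m, dst m ≤ M * (ε' * ((1 - θ) / 4)) := by
    rw [one_div (M : ℝ), inv_mul_eq_div, div_le_iff₀ hM'] at hd
    rw [mul_comm]
    exact hd
  have c1 := hexp (Fin M) ρ hρ hsE
  have c2 := card_filter_lt_mul_le (c := ε') herr0 hserr
  have c3 := card_filter_lt_mul_le (c := ε') hdst0 hsdst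
  set B1 := Finset.univ.filter fun m => ENNReal.ofReal Pb <
    (G.ext n).energy (ρ m : TensorPow HA n →L[ℂ] TensorPow HA n) with hB1
  set B2 := Finset.univ.filter fun m => ε' < err m with hB2
  set B3 := Finset.univ.filter fun m => ε' < dst m with hB3
  have c2' : (B2.card : ℝ) ≤ M * ((1 - θ) / 4) := by
    refine le_of_mul_le_mul_right (c2.trans (le_of_eq ?_)) hε'
    ring
  have c3' : (B3.card : ℝ) ≤ M * ((1 - θ) / 4) := by
    refine le_of_mul_le_mul_right (c3.trans (le_of_eq ?_)) hε'
    ring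
  have c1' : (B1.card : ℝ) ≤ θ * M := by
    rw [Fintype.card_fin] at c1
    convert c1
  set s : Finset (Fin M) := (B1 ∪ B2 ∪ B3)ᶜ with hsdef
  have hcard : (1 - θ) / 2 * M ≤ s.card := by
    have h1 : ((B1 ∪ B2 ∪ B3).card : ℝ) ≤ B1.card + B2.card + B3.card := by
      exact_mod_cast (Finset.card_union_le _ _).trans
        (Nat.add_le_add_right (Finset.card_union_le _ _) _)
    have h2 : ((B1 ∪ B2 ∪ B3).card : ℝ) + s.card = M := by
      have := Finset.card_add_card_compl (B1 ∪ B2 ∪ B3)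
      rw [Fintype.card_fin] at this
      exact_mod_cast this
    nlinarith
  have hs0 : 0 < s.card := by
    have : (0 : ℝ) < s.card := lt_of_lt_of_le (mul_pos (by linarith) hM') hcard
    exact_mod_cast this
  have hgood : ∀ m ∈ s, (G.ext n).energy (ρ m : TensorPow HA n →L[ℂ] TensorPow HA n) ≤
      ENNReal.ofReal Pb ∧ err m ≤ ε' ∧ dst m ≤ ε' := fun m hm => by
    simpa [hsdef, hB1, hB2, hB3, not_or, and_assoc] using hm
  let e : Fin s.card ≃ s := s.equivFin.symm
  obtain ⟨Λ', hΛ', hΛle⟩ := hΛ.exists_restrict hs0 s e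
  let m₀ := e ⟨0, hs0⟩
  -- Any surviving codeword can be the reference state of energy at most Pb.
  obtain ⟨τ, hτ, hτE⟩ := hmix (ρ m₀) (hρ m₀) (hgood m₀ m₀.2).1
  refine ⟨s.card, hcard, Nn, Ncn, hN, hNc,
    fun m => ((1 - r : ℝ) : ℂ) • ρ (e m) + (r : ℂ) • τ, Λ', ω,
    fun m => (hρ _).convex hτ hr0.le hr1.le, hΛ', hω, fun m => ⟨?_, ?_, ?_⟩⟩
  · exact hτE _ (hρ _).1 (hgood _ (e m).2).1
  · have h1 : (1 - ε') ≤ (trace (Λ' m *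
        (Nn.toLin (ρ (e m)) : TensorPow HB n →L[ℂ] TensorPow HB n))).re := by
      have := (hgood _ (e m).2).2.1
      refine le_trans ?_ (trace_mul_mono (hΛle m) (Nn.isState (hρ (e m))).1)
      simp only [herr] at this
      linarith
    exact Nn.le_re_trace_mix hr0.le hr1.le hε'.le (hΛ'.1 m) h1 hτ.1
  · exact Ncn.tnorm_mix_le hr0.le hr1.le (hgood _ (e m).2).2.2 hτ hω

lemma privateCapacity_le_secretKeyCapacity :
    privateCapacity N Nc G P ≤ secretKeyCapacity N Nc G P :=
  capacity_mono fun ε h0 h1 => ⟨ε, h0, h1, 1, one_pos, fun n _ M hM hc =>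
    ⟨M, by simp, hc.secretKeyCode hM⟩⟩

lemma secretKeyCapacity_le_privateCapacity (hP : 0 ≤ P) :
    secretKeyCapacity N Nc G P ≤ privateCapacity N Nc G P :=
  capacity_mono fun ε h0 h1 => by
    obtain ⟨Pb, θ, hθ0, hθ1, hb⟩ := exists_expurgation_mixing G hP
      (half_pos h0) (by linarith : ε / 2 < 1)
    -- The error budget ε is shared equally between the expurgation threshold and the mixing weight.
    refine ⟨ε / 2 * ((1 - θ) / 4), by have : 0 < 1 - θ := by linarith
                                      positivity, by nlinarith, (1 - θ) / 2, by linarith,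
      fun n hn M hM hc => ?_⟩
    obtain ⟨M', hM', hc'⟩ := hc.exists_privateCode hM hP (half_pos h0) (by linarith) hθ1
      (half_pos h0) (hb n hn).1 (hb n hn).2
    exact ⟨M', hM', by simpa using hc'⟩

end PrivateKey

/-! ### Fidelity with a pure state -/

section Fidelity

variable {H : Type*} [NormedAddCommGroup H] [InnerProductSpace ℂ H] [CompleteSpace H]

lemma traceNorm_rankOne {x : H} (hx : ‖x‖ = 1) (y : H) :
    traceNorm (rankOne ℂ x y : H →L[ℂ] H) = ENNReal.ofReal ‖y‖ := by
  have hn : ∀ r : ℝ, 0 ≤ r → 0 ≤ (r : ℂ) • (rankOne ℂ y y : H →L[ℂ] H) := fun r hr => by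
    have := rankOne_self_nonneg y
    rw [ContinuousLinearMap.nonneg_iff_isPositive] at this ⊢
    exact this.smul_of_nonneg (Complex.zero_le_real.2 hr)
  -- For y = 0 the inverse norm is 0 by convention and both sides vanish.
  have habs : CFC.abs (rankOne ℂ x y : H →L[ℂ] H) = ((‖y‖⁻¹ : ℝ) : ℂ) • rankOne ℂ y y := by
    refine CFC.sqrt_unique ?_ (hn _ (by positivity))
    rw [ContinuousLinearMap.star_eq_adjoint, InnerProductSpace.adjoint_rankOne]
    ext z
    simp only [mul_apply_eq_comp, smul_apply, rankOne_apply, map_smul, inner_smul_right, smul_smul,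
      inner_self_eq_norm_sq_to_K, hx]
    by_cases hy : y = 0
    · simp [hy]
    · have : (‖y‖ : ℂ) ≠ 0 := by simpa using hy
      congr 1
      push_cast
      simp only [Complex.coe_algebraMap]
      field_simp
  rw [traceNorm, habs, ← traceNorm_of_nonneg (hn _ (by positivity))]
  have : ((‖y‖⁻¹ : ℝ) : ℂ) • (rankOne ℂ y y : H →L[ℂ] H) =
      ((((‖y‖⁻¹ : ℝ) : ℂ) • ketBra y y : TraceClass H) : H →L[ℂ] H) := rfl
  rw [this, traceNorm_eq_trace (Subtype.prop _) (hn _ (by positivity)), ← traceL_one, map_smul,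
    traceL_one, coe_ketBra, trace_rankOne, inner_self_eq_norm_sq_to_K]
  congr 1
  by_cases hy : ‖y‖ = 0
  · simp [hy]
  · rw [smul_eq_mul, Complex.re_ofReal_mul]
    norm_cast
    simp only [Complex.coe_algebraMap, Complex.ofReal_re]
    field_simp

/-- The projection |φ⟩⟨φ| is its own square root, so its product with √σ is |φ⟩⟨√σ φ|, of trace norm
‖√σ φ‖. Fidelity with a pure state is thus linear in σ. -/
lemma fidelity_rankOne {φ : H} (hφ : ‖φ‖ = 1) {σ : H →L[ℂ] H} (hσ : 0 ≤ σ) :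
    fidelity (rankOne ℂ φ φ) σ = (⟪φ, σ φ⟫_ℂ).re := by
  have hs : (CFC.sqrt σ)† = CFC.sqrt σ := (IsSelfAdjoint.of_nonneg (CFC.sqrt_nonneg _)).star_eq
  have h1 : CFC.sqrt (rankOne ℂ φ φ : H →L[ℂ] H) = rankOne ℂ φ φ :=
    CFC.sqrt_unique (by
      ext z
      simp [hφ, inner_self_eq_norm_sq_to_K]) (rankOne_self_nonneg φ)
  have h2 : (rankOne ℂ φ φ : H →L[ℂ] H) * CFC.sqrt σ = rankOne ℂ φ (CFC.sqrt σ φ) := by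
    ext z
    simp only [mul_apply_eq_comp, rankOne_apply]
    rw [← ContinuousLinearMap.adjoint_inner_left, hs]
  rw [fidelity, h1, h2, traceNorm_rankOne hφ, ENNReal.toReal_ofReal (norm_nonneg _)]
  have h3 : ⟪φ, σ φ⟫_ℂ = ⟪CFC.sqrt σ φ, CFC.sqrt σ φ⟫_ℂ := by
    conv_lhs => rw [← CFC.sqrt_mul_sqrt_self σ hσ]
    rw [mul_apply_eq_comp, ← ContinuousLinearMap.adjoint_inner_left, hs]
  rw [h3]
  exact (inner_self_eq_norm_sq (𝕜 := ℂ) _).symm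

end Fidelity

/-! ### Entanglement fidelities of channels on `ℂ^M` -/

section Qudit

variable {M : ℕ}

/-- The component `⟨r|φ⟩` of a vector `φ` of `R ⊗ S`. -/
def component (φ : BiQudit M) (r : Fin M) : Qudit M := WithLp.toLp 2 fun s => φ (r, s)

lemma quditOp_coe (A : Qudit M →L[ℂ] Qudit M) : (quditOp A : Qudit M →L[ℂ] Qudit M) = A := rfl

lemma inner_opOfMatrix {κ : Type} [Fintype κ] [DecidableEq κ] (A : Matrix κ κ ℂ)
    (x y : EuclideanSpace ℂ κ) :
    ⟪x, opOfMatrix A y⟫_ℂ = ∑ p, ∑ q, (starRingEnd ℂ) (x p) * A p q * y q := by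
  rw [PiLp.inner_apply]
  refine Finset.sum_congr rfl fun p _ => ?_
  rw [RCLike.inner_apply, opOfMatrix]
  have : (Matrix.toEuclideanCLM (n := κ) (𝕜 := ℂ) A y) p = ∑ q, A p q * y q := rfl
  rw [this, Finset.sum_mul]
  exact Finset.sum_congr rfl fun q _ => by ring

lemma opOfMatrix_matrixOfOp {κ : Type} [Fintype κ] [DecidableEq κ]
    (A : EuclideanSpace ℂ κ →L[ℂ] EuclideanSpace ℂ κ) : opOfMatrix (matrixOfOp A) = A :=
  (Matrix.toEuclideanCLM (n := κ) (𝕜 := ℂ)).apply_symm_apply A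

lemma matrixOfOp_opOfMatrix {κ : Type} [Fintype κ] [DecidableEq κ]
    (A : Matrix κ κ ℂ) : matrixOfOp (opOfMatrix A) = A :=
  (Matrix.toEuclideanCLM (n := κ) (𝕜 := ℂ)).symm_apply_apply A

lemma opOfMatrix_rankOne {κ : Type} [Fintype κ] [DecidableEq κ] (x y : EuclideanSpace ℂ κ) :
    opOfMatrix (Matrix.of fun p q => x p * (starRingEnd ℂ) (y q)) = rankOne ℂ x y := by
  refine ext_of_inner fun u v => ?_
  rw [inner_opOfMatrix, rankOne_apply, inner_smul_right, PiLp.inner_apply, PiLp.inner_apply,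
    Finset.sum_mul_sum, Finset.sum_comm]
  refine Finset.sum_congr rfl fun p _ => Finset.sum_congr rfl fun q _ => ?_
  simp only [Matrix.of_apply, RCLike.inner_apply]
  ring

lemma matrixOfOp_rankOne {κ : Type} [Fintype κ] [DecidableEq κ] (x y : EuclideanSpace ℂ κ)
    (p q : κ) : matrixOfOp (rankOne ℂ x y : EuclideanSpace ℂ κ →L[ℂ] EuclideanSpace ℂ κ) p q =
      x p * (starRingEnd ℂ) (y q) := by
  rw [← opOfMatrix_rankOne, matrixOfOp_opOfMatrix, Matrix.of_apply]

lemma quditOp_blockOp_rankOne (φ : BiQudit M) (r r' : Fin M) :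
    quditOp (blockOp (rankOne ℂ φ φ) r r') = ketBra (component φ r) (component φ r') := by
  refine Subtype.ext ?_
  rw [quditOp_coe, coe_ketBra, ← opOfMatrix_rankOne (component φ r), blockOp]
  refine congrArg opOfMatrix (Matrix.ext fun s s' => ?_)
  rw [Matrix.of_apply, Matrix.of_apply, matrixOfOp_rankOne]
  rfl

lemma inner_idTensor (C : TraceClass (Qudit M) →ₗ[ℂ] TraceClass (Qudit M)) (φ ψ : BiQudit M) :
    ⟪ψ, idTensor C (rankOne ℂ φ φ) ψ⟫_ℂ = ∑ r, ∑ r', ⟪component ψ r,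
      (C (ketBra (component φ r) (component φ r')) : Qudit M →L[ℂ] Qudit M) (component ψ r')⟫_ℂ := by
  have key : ∀ r r', ⟪component ψ r, (C (ketBra (component φ r) (component φ r')) :
      Qudit M →L[ℂ] Qudit M) (component ψ r')⟫_ℂ = ∑ s, ∑ s', (starRingEnd ℂ) (ψ (r, s)) *
      matrixOfOp (C (quditOp (blockOp (rankOne ℂ φ φ) r r')) : Qudit M →L[ℂ] Qudit M) s s' *
      ψ (r', s') := fun r r' => by
    rw [quditOp_blockOp_rankOne, ← opOfMatrix_matrixOfOp (C (ketBra (component φ r)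
      (component φ r')) : Qudit M →L[ℂ] Qudit M), inner_opOfMatrix, opOfMatrix_matrixOfOp]
    rfl
  rw [idTensor, inner_opOfMatrix, Fintype.sum_prod_type]
  simp only [Fintype.sum_prod_type, key]
  refine Finset.sum_congr rfl fun r _ => ?_
  rw [Finset.sum_comm]
  rfl

/-- `⟨x| C(|x⟩⟨y|) |y⟩`. -/
def pairFid (C : TraceClass (Qudit M) →ₗ[ℂ] TraceClass (Qudit M)) (x y : Qudit M) : ℂ :=
  ⟪x, (C (ketBra x y) : Qudit M →L[ℂ] Qudit M) y⟫_ℂ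

lemma idTensor_nonneg (C : Channel (Qudit M) (Qudit M)) (φ : BiQudit M) :
    0 ≤ idTensor C.toLin (rankOne ℂ φ φ) := by
  rw [nonneg_iff_inner]
  intro ψ
  rw [inner_idTensor]
  exact C.completelyPositive M _ (Channel.blockPositive_ketBra (component φ)) (component ψ)

lemma fidelity_idTensor (C : Channel (Qudit M) (Qudit M)) {φ : BiQudit M} (hφ : ‖φ‖ = 1) :
    fidelity (rankOne ℂ φ φ) (idTensor C.toLin (rankOne ℂ φ φ)) =
      (∑ r, ∑ r', pairFid C.toLin (component φ r) (component φ r')).re := by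
  rw [fidelity_rankOne hφ (idTensor_nonneg C φ), inner_idTensor]
  rfl

lemma traceL_ketBra {H : Type*} [NormedAddCommGroup H] [InnerProductSpace ℂ H] [CompleteSpace H]
    (W : H →L[ℂ] H) (x y : H) : traceL W (ketBra x y) = ⟪y, W x⟫_ℂ := by
  rw [traceL_apply, coe_ketBra, ← trace_rankOne]
  congr 1
  ext z
  simp

lemma sum_inner_eq_of_sum_ketBra {κ κ' : Type*} [Fintype κ] [Fintype κ'] {x : κ → Qudit M}
    {y : κ' → Qudit M} (h : ∑ r, ketBra (x r) (x r) = ∑ i, ketBra (y i) (y i))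
    (A : Qudit M →ₗ[ℂ] Qudit M) : ∑ r, ⟪x r, A (x r)⟫_ℂ = ∑ i, ⟪y i, A (y i)⟫_ℂ := by
  have h1 := congrArg (traceL (LinearMap.toContinuousLinearMap A)) h
  simpa only [map_sum, traceL_ketBra, LinearMap.coe_toContinuousLinearMap'] using h1

/-- The entanglement fidelity depends only on the reduced state. -/
lemma sum_pairFid_eq {κ κ' : Type*} [Fintype κ] [Fintype κ'] {x : κ → Qudit M}
    {y : κ' → Qudit M} (h : ∑ r, ketBra (x r) (x r) = ∑ i, ketBra (y i) (y i))
    (C : TraceClass (Qudit M) →ₗ[ℂ] TraceClass (Qudit M)) :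
    ∑ r, ∑ r', pairFid C (x r) (x r') = ∑ i, ∑ i', pairFid C (y i) (y i') := by
  -- In each argument separately (after a conjugation in the second) `pairFid` is a quadratic form,
  -- and a sum of values of a quadratic form over the vectors x_r depends only on ∑ |x_r⟩⟨x_r|. The
  -- two arguments are exchanged one after the other.
  let A : Qudit M → (Qudit M →ₗ[ℂ] Qudit M) := fun z =>
    { toFun := fun w => (C (ketBra w z) : Qudit M →L[ℂ] Qudit M) z
      map_add' := fun w w' => by simp [ketBra_add_left]
      map_smul' := fun c w => by simp [ketBra_smul_left] }
  let B : Qudit M → (Qudit M →ₗ[ℂ] Qudit M) := fun w =>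
    { toFun := fun z => ((C (ketBra w z) : Qudit M →L[ℂ] Qudit M)†) w
      map_add' := fun w w' => by simp [ketBra_add_right]
      map_smul' := fun c z => by
        rw [ketBra_smul_right, map_smul, Submodule.coe_smul, map_smulₛₗ, Complex.conj_conj]
        rfl }
  have hA : ∀ w z, pairFid C w z = ⟪w, A z w⟫_ℂ := fun w z => rfl
  have hB : ∀ w z, pairFid C w z = (starRingEnd ℂ) ⟪z, B w z⟫_ℂ := fun w z => by
    rw [inner_conj_symm]
    exact (ContinuousLinearMap.adjoint_inner_left _ _ _).symm
  calc ∑ r, ∑ r', pairFid C (x r) (x r') = ∑ r', ∑ r, ⟪x r, A (x r') (x r)⟫_ℂ := Finset.sum_comm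
    _ = ∑ r', ∑ i, ⟪y i, A (x r') (y i)⟫_ℂ :=
        Finset.sum_congr rfl fun r' _ => sum_inner_eq_of_sum_ketBra h _
    _ = ∑ i, ∑ r', pairFid C (y i) (x r') := Finset.sum_comm
    _ = ∑ i, ∑ i', pairFid C (y i) (y i') := by
        refine Finset.sum_congr rfl fun i _ => ?_
        simp only [hB, ← map_sum]
        rw [sum_inner_eq_of_sum_ketBra h]

lemma pairFid_smul (C : TraceClass (Qudit M) →ₗ[ℂ] TraceClass (Qudit M)) (s t : ℝ)
    (x y : Qudit M) : pairFid C ((s : ℂ) • x) ((t : ℂ) • y) = (s ^ 2 * t ^ 2 : ℝ) * pairFid C x y := by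
  simp only [pairFid, ketBra_smul_left, ketBra_smul_right, map_smul, Submodule.coe_smul, smul_apply,
    inner_smul_left, inner_smul_right, Complex.conj_ofReal]
  push_cast
  ring

lemma exists_gram_pairFid (C : Channel (Qudit M) (Qudit M)) {k : ℕ} (x : Fin k → Qudit M) :
    ∃ g : Fin k → PiLp 2 fun _ : Fin k => Qudit M, ∀ i j,
      pairFid C.toLin (x i) (x j) = ⟪g i, g j⟫_ℂ := by
  obtain ⟨S, hS⟩ := C.exists_gram_ketBra x
  exact ⟨fun i => S i (x i), fun i j => hS i j _ _⟩

lemma re_pairFid_symm (C : Channel (Qudit M) (Qudit M)) (x y : Qudit M) :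
    (pairFid C.toLin y x).re = (pairFid C.toLin x y).re := by
  obtain ⟨g, hg⟩ := exists_gram_pairFid C ![x, y]
  have h01 := hg 0 1
  have h10 := hg 1 0
  simp only [Matrix.cons_val_zero, Matrix.cons_val_one] at h01 h10
  rw [h01, h10, ← inner_conj_symm, Complex.conj_re]

/-- By complete positivity the numbers `pairFid` form a Gram matrix, whose off-diagonal entries are
controlled by Cauchy–Schwarz and the inequality of means. -/
lemma re_pairFid_le (C : Channel (Qudit M) (Qudit M)) (x y : Qudit M) :
    (pairFid C.toLin x y).re ≤ ((pairFid C.toLin x x).re + (pairFid C.toLin y y).re) / 2 := by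
  obtain ⟨g, hg⟩ := exists_gram_pairFid C ![x, y]
  have h01 := hg 0 1
  have h00 := hg 0 0
  have h11 := hg 1 1
  simp only [Matrix.cons_val_zero, Matrix.cons_val_one] at h01 h00 h11
  have e2 : ∀ y : PiLp 2 fun _ : Fin 2 => Qudit M, (⟪y, y⟫_ℂ).re = ‖y‖ ^ 2 :=
    inner_self_eq_norm_sq (𝕜 := ℂ)
  rw [h01, h00, h11, e2, e2]
  have := (Complex.re_le_norm _).trans (norm_inner_le_norm (𝕜 := ℂ) (g 0) (g 1))
  nlinarith [sq_nonneg (‖g 0‖ - ‖g 1‖)]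

lemma IsState.sum_inner_le {H κ : Type*} [NormedAddCommGroup H] [InnerProductSpace ℂ H]
    [CompleteSpace H] {ρ : TraceClass H} (hρ : IsState ρ) {v : κ → H} (hv : Orthonormal ℂ v)
    (s : Finset κ) : ∑ k ∈ s, (⟪v k, (ρ : H →L[ℂ] H) (v k)⟫_ℂ).re ≤ 1 := by
  obtain ⟨a, ha⟩ := exists_isSumRankOne_of_nonneg ρ.2 hρ.1
  have h1 := isSumRankOne_self_norm ha
  rw [hρ.2, Complex.one_re] at h1
  refine hasSum_le (fun t => ?_) (hasSum_sum fun k _ => Complex.hasSum_re (ha.hasSum (v k) (v k))) h1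
  refine le_trans (le_of_eq (Finset.sum_congr rfl fun k _ => ?_)) (hv.sum_inner_products_le (a t)
    (s := s))
  rw [← inner_conj_symm (a t), Complex.mul_conj, Complex.ofReal_re, Complex.normSq_eq_norm_sq]

/-- A lower bound on the fidelity of all pure states bounds the coherences. -/
lemma le_re_pairFid_of_pure (C : Channel (Qudit M) (Qudit M)) {ε : ℝ}
    (h : ∀ x : Qudit M, ‖x‖ = 1 → 1 - ε ≤ (pairFid C.toLin x x).re) {a c : Qudit M}
    (ha : ‖a‖ = 1) (hc : ‖c‖ = 1) (hac : ⟪a, c⟫_ℂ = 0) :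
    1 - 2 * ε ≤ (pairFid C.toLin a c).re := by
  have hca : ⟪c, a⟫_ℂ = 0 := by rw [← inner_conj_symm, hac, map_zero]
  have hv : Orthonormal ℂ ![a, c] := by
    rw [orthonormal_iff_ite]
    intro i j
    fin_cases i <;> fin_cases j <;>
      simp [hac, hca, inner_self_eq_norm_sq_to_K, ha, hc]
  have hrt : ((Real.sqrt 2)⁻¹ : ℝ) ^ 2 = 1 / 2 := by
    rw [inv_pow, Real.sq_sqrt (by norm_num)]; norm_num
  -- The vector a + u c has norm √2 and `pairFid` has degree four in it, whence the factor 4.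
  have hu : ∀ u : ℂ, ‖u‖ = 1 → 4 - 4 * ε ≤ (pairFid C.toLin (a + u • c) (a + u • c)).re := by
    intro u hu
    have hn2 : ‖a + u • c‖ ^ 2 = 2 := by
      have e2 : ∀ y : Qudit M, (⟪y, y⟫_ℂ).re = ‖y‖ ^ 2 := inner_self_eq_norm_sq (𝕜 := ℂ)
      rw [← e2, inner_add_left, inner_add_right, inner_add_right]
      rw [inner_smul_left, inner_smul_left, inner_smul_right, inner_smul_right, hac, hca,
        inner_self_eq_norm_sq_to_K, inner_self_eq_norm_sq_to_K, ha, hc]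
      have : (starRingEnd ℂ) u * u = 1 := by
        rw [mul_comm, Complex.mul_conj, Complex.normSq_eq_norm_sq, hu]; simp
      rw [← mul_assoc, this]
      norm_num
    have hn : ‖a + u • c‖ = Real.sqrt 2 := by
      rw [← hn2, Real.sqrt_sq (norm_nonneg _)]
    have h1 := h ((((Real.sqrt 2)⁻¹ : ℝ) : ℂ) • (a + u • c)) (by
      rw [norm_smul, hn, Complex.norm_real, Real.norm_eq_abs, abs_of_pos (by positivity)]
      exact inv_mul_cancel₀ (by positivity))
    rw [pairFid_smul, Complex.re_ofReal_mul, hrt] at h1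
    linarith
  -- Summing over the phases 1, -1, i, -i removes every term in which the factors u and their
  -- conjugates do not cancel. There remain the two fidelities, the two coherences and the two
  -- transition terms between a and c.
  have hsum : pairFid C.toLin (a + (1 : ℂ) • c) (a + (1 : ℂ) • c) +
      pairFid C.toLin (a + (-1 : ℂ) • c) (a + (-1 : ℂ) • c) +
      pairFid C.toLin (a + Complex.I • c) (a + Complex.I • c) +
      pairFid C.toLin (a + (-Complex.I) • c) (a + (-Complex.I) • c) =
      4 * (pairFid C.toLin a a + pairFid C.toLin c c + pairFid C.toLin a c + pairFid C.toLin c a +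
        ⟪c, (C.toLin (ketBra a a) : Qudit M →L[ℂ] Qudit M) c⟫_ℂ +
        ⟪a, (C.toLin (ketBra c c) : Qudit M →L[ℂ] Qudit M) a⟫_ℂ) := by
    simp only [pairFid, ketBra_add_left, ketBra_add_right, ketBra_smul_left, ketBra_smul_right,
      map_add, map_smul, Submodule.coe_add, Submodule.coe_smul, add_apply, smul_apply,
      inner_add_left, inner_add_right, inner_smul_left, inner_smul_right, map_one, map_neg,
      Complex.conj_I]
    ring_nf
    have h4 : Complex.I ^ 4 = 1 := Complex.I_pow_four
    simp only [Complex.I_sq, h4]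
    ring
  have h1 := hu 1 (by simp)
  have h2 := hu (-1) (by simp)
  have h3 := hu Complex.I (by simp)
  have h4 := hu (-Complex.I) (by simp)
  have hre := congrArg Complex.re hsum
  have e4 : ∀ z : ℂ, (4 * z).re = 4 * z.re := fun z => by simp
  rw [e4] at hre
  simp only [Complex.add_re] at hre
  -- The image of each of a and c is a state, so its fidelity and its transition term add up to at
  -- most 1. Removing both contributions from the lower bound 4 - 4ε leaves at least 2 - 4ε for the
  -- two coherences, which have equal real parts.
  have t1 := (C.isState (isState_ketBra ha)).sum_inner_le hv Finset.univ
  have t2 := (C.isState (isState_ketBra hc)).sum_inner_le hv Finset.univ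
  simp only [Fin.sum_univ_two, Matrix.cons_val_zero, Matrix.cons_val_one] at t1 t2
  have hsym := re_pairFid_symm C a c
  have ea : (pairFid C.toLin a a).re =
    (⟪a, (C.toLin (ketBra a a) : Qudit M →L[ℂ] Qudit M) a⟫_ℂ).re := rfl
  have ec : (pairFid C.toLin c c).re =
    (⟪c, (C.toLin (ketBra c c) : Qudit M →L[ℂ] Qudit M) c⟫_ℂ).re := rfl
  linarith

lemma sum_ketBra_orthonormalBasis {κ : Type*} [Fintype κ] (b : OrthonormalBasis κ ℂ (Qudit M)) :
    ∑ i, ketBra (b i) (b i) = quditOp 1 := by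
  refine Subtype.ext ?_
  rw [quditOp_coe, AddSubmonoidClass.coe_finset_sum]
  exact b.sum_rankOne_eq_id

/-- A bound on the fidelity of the pure states of `S` gives one for those of `R ⊗ S`. -/
lemma le_fidelity_of_pure (C : Channel (Qudit M) (Qudit M)) {ε : ℝ} (hε : 0 ≤ ε)
    (h : ∀ x : Qudit M, ‖x‖ = 1 → 1 - ε ≤ (pairFid C.toLin x x).re) {φ : BiQudit M}
    (hφ : ‖φ‖ = 1) :
    1 - 2 * ε ≤ (∑ r, ∑ r', pairFid C.toLin (component φ r) (component φ r')).re := by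
  -- T is the reduced state on S. Since only T matters, the components of φ may be replaced by √pᵢ
  -- bᵢ with an eigenbasis bᵢ, as in a Schmidt decomposition; the fidelity becomes a mean of the
  -- `pairFid` of basis vectors with weights pᵢ pⱼ.
  let T : Qudit M →L[ℂ] Qudit M := ∑ r, rankOne ℂ (component φ r) (component φ r)
  have hT : 0 ≤ T := Finset.sum_nonneg fun r _ => rankOne_self_nonneg _
  have hTp := (ContinuousLinearMap.nonneg_iff_isPositive T).1 hT
  have hsymm := hTp.isSymmetric
  have hn : Module.finrank ℂ (Qudit M) = M := by simp
  let b := hsymm.eigenvectorBasis hn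
  let p := hsymm.eigenvalues hn
  have hp : ∀ i, T (b i) = (p i : ℂ) • b i := fun i => hsymm.apply_eigenvectorBasis hn i
  have hp0 : ∀ i, 0 ≤ p i := fun i => by
    have h1 := nonneg_iff_inner.1 hT (b i)
    rw [hp, inner_smul_right, inner_self_eq_norm_sq_to_K, b.orthonormal.1 i] at h1
    simpa using h1
  have hdec : ∑ r, ketBra (component φ r) (component φ r) =
      ∑ i, ketBra (((Real.sqrt (p i) : ℝ) : ℂ) • b i) (((Real.sqrt (p i) : ℝ) : ℂ) • b i) := by
    refine Subtype.ext ?_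
    rw [AddSubmonoidClass.coe_finset_sum, AddSubmonoidClass.coe_finset_sum]
    change T = _
    have h1 : ∀ i, (ketBra (((Real.sqrt (p i) : ℝ) : ℂ) • b i) (((Real.sqrt (p i) : ℝ) : ℂ) • b i) :
        Qudit M →L[ℂ] Qudit M) = T ∘L rankOne ℂ (b i) (b i) := fun i => by
      ext1 z
      have : ((Real.sqrt (p i) : ℝ) : ℂ) * ((Real.sqrt (p i) : ℝ) : ℂ) = p i := by
        rw [← Complex.ofReal_mul, Real.mul_self_sqrt (hp0 i)]
      rw [coe_ketBra, rankOne_apply, ContinuousLinearMap.comp_apply, rankOne_apply, map_smul, hp,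
        inner_smul_left, smul_smul, smul_smul, Complex.conj_ofReal, ← this]
      congr 1
      ring
    simp only [h1]
    rw [← ContinuousLinearMap.comp_finset_sum, b.sum_rankOne_eq_id]
    rfl
  rw [sum_pairFid_eq hdec]
  have hsum : ∑ i, p i = 1 := by
    have h1 := congrArg (traceL 1) hdec
    simp only [map_sum, traceL_ketBra, one_apply_eq_self, inner_self_eq_norm_sq_to_K, norm_smul,
      b.orthonormal.1, Complex.norm_real, Real.norm_eq_abs, abs_of_nonneg (Real.sqrt_nonneg _),
      mul_one] at h1
    have h2 : ∑ r, ‖component φ r‖ ^ 2 = 1 := by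
      have : ‖φ‖ ^ 2 = ∑ r, ‖component φ r‖ ^ 2 := by
        rw [EuclideanSpace.norm_sq_eq, Fintype.sum_prod_type]
        refine Finset.sum_congr rfl fun r _ => ?_
        rw [EuclideanSpace.norm_sq_eq]
        rfl
      rw [← this, hφ, one_pow]
    have h3 : ∀ i, Real.sqrt (p i) ^ 2 = p i := fun i => Real.sq_sqrt (hp0 i)
    have h4 : ∑ r, ‖component φ r‖ ^ 2 = ∑ i, Real.sqrt (p i) ^ 2 := by exact_mod_cast h1
    rw [← h2, h4]
    exact Finset.sum_congr rfl fun i _ => (h3 i).symm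
  have hterm : ∀ i j, p i * p j * (1 - 2 * ε) ≤ (pairFid C.toLin (((Real.sqrt (p i) : ℝ) : ℂ) • b i)
      (((Real.sqrt (p j) : ℝ) : ℂ) • b j)).re := fun i j => by
    rw [pairFid_smul, Complex.re_ofReal_mul, Real.sq_sqrt (hp0 i), Real.sq_sqrt (hp0 j)]
    refine mul_le_mul_of_nonneg_left ?_ (mul_nonneg (hp0 i) (hp0 j))
    by_cases hij : i = j
    · subst hij
      have := h (b i) (b.orthonormal.1 i)
      linarith
    · exact le_re_pairFid_of_pure C h (b.orthonormal.1 i) (b.orthonormal.1 j)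
        (b.orthonormal.2 hij)
  have hS : ∑ i, ∑ j, p i * p j * (1 - 2 * ε) = 1 - 2 * ε := by
    simp only [← Finset.sum_mul, ← Finset.mul_sum, hsum, mul_one, one_mul]
  rw [Complex.re_sum]
  simp only [Complex.re_sum]
  rw [← hS]
  exact Finset.sum_le_sum fun i _ => Finset.sum_le_sum fun j _ => hterm i j

/-- The maximally entangled vector. -/
def maxVec (M : ℕ) : BiQudit M :=
  WithLp.toLp 2 fun p => if p.1 = p.2 then (((Real.sqrt M)⁻¹ : ℝ) : ℂ) else 0

lemma component_maxVec (r : Fin M) : component (maxVec M) r =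
    (((Real.sqrt M)⁻¹ : ℝ) : ℂ) • EuclideanSpace.basisFun (Fin M) ℂ r := by
  ext s
  by_cases h : r = s
  · subst h; simp [component, maxVec]
  · simp [component, maxVec, h, Ne.symm h]

lemma maxEntangled_eq (hM : 0 < M) : maxEntangled M = rankOne ℂ (maxVec M) (maxVec M) := by
  rw [← opOfMatrix_rankOne, maxEntangled]
  congr 1
  ext p q
  have hM' : (0 : ℝ) ≤ M := by positivity
  have : (((Real.sqrt M)⁻¹ : ℝ) : ℂ) * (((Real.sqrt M)⁻¹ : ℝ) : ℂ) = 1 / (M : ℂ) := by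
    rw [← Complex.ofReal_mul, ← mul_inv, Real.mul_self_sqrt hM']
    simp
  by_cases h1 : p.1 = p.2 <;> by_cases h2 : q.1 = q.2 <;>
    simp only [Matrix.of_apply, maxVec, h1, h2, if_true, if_false, and_self, and_true, and_false,
      map_zero, mul_zero, zero_mul, Complex.conj_ofReal, this]

lemma norm_maxVec (hM : 0 < M) : ‖maxVec M‖ = 1 := by
  have hM' : (0 : ℝ) < M := by exact_mod_cast hM
  have : ‖maxVec M‖ ^ 2 = 1 := by
    have h1 : ‖maxVec M‖ ^ 2 = ∑ r, ‖component (maxVec M) r‖ ^ 2 := by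
      rw [EuclideanSpace.norm_sq_eq, Fintype.sum_prod_type]
      refine Finset.sum_congr rfl fun r _ => ?_
      rw [EuclideanSpace.norm_sq_eq]
      rfl
    rw [h1]
    simp only [component_maxVec, norm_smul, (EuclideanSpace.basisFun (Fin M) ℂ).orthonormal.1,
      Complex.norm_real, norm_inv, Real.norm_eq_abs, abs_of_nonneg (Real.sqrt_nonneg _), mul_one,
      inv_pow, Real.sq_sqrt hM'.le]
    simp
    field_simp
  exact (pow_eq_one_iff_of_nonneg (norm_nonneg _) two_ne_zero).1 this

/-- The entanglement fidelity for the maximally entangled state, in an arbitrary orthonormal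
basis. -/
lemma fidelity_maxEntangled (C : Channel (Qudit M) (Qudit M)) (hM : 0 < M) {κ : Type*} [Fintype κ]
    (b : OrthonormalBasis κ ℂ (Qudit M)) :
    fidelity (maxEntangled M) (idTensor C.toLin (maxEntangled M)) =
      (1 / M : ℝ) ^ 2 * (∑ i, ∑ j, pairFid C.toLin (b i) (b j)).re := by
  have hM' : (0 : ℝ) ≤ M := by positivity
  rw [maxEntangled_eq hM, fidelity_idTensor C (norm_maxVec hM)]
  simp only [component_maxVec, pairFid_smul, ← Finset.mul_sum]
  rw [Complex.re_ofReal_mul, inv_pow, Real.sq_sqrt hM', sum_pairFid_eq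
    ((sum_ketBra_orthonormalBasis (EuclideanSpace.basisFun (Fin M) ℂ)).trans
      (sum_ketBra_orthonormalBasis b).symm)]
  congr 1
  ring

/-- The left side is the mean of all entries of a Gram matrix, hence at most the mean of the
diagonal ones. That the basis is arbitrary is essential for finding a whole subspace of good
vectors. -/
lemma fidelity_maxEntangled_le (C : Channel (Qudit M) (Qudit M)) (hM : 0 < M) {κ : Type*}
    [Fintype κ] (b : OrthonormalBasis κ ℂ (Qudit M)) :
    fidelity (maxEntangled M) (idTensor C.toLin (maxEntangled M)) ≤
      (1 / M : ℝ) * ∑ i, (pairFid C.toLin (b i) (b i)).re := by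
  have hM' : (0 : ℝ) < M := by exact_mod_cast hM
  have hcard : Fintype.card κ = M := by
    rw [← Module.finrank_eq_card_basis b.toBasis]; simp
  rw [fidelity_maxEntangled C hM b, sq, mul_assoc]
  refine mul_le_mul_of_nonneg_left ?_ (by positivity)
  rw [one_div, inv_mul_le_iff₀ hM']
  simp only [Complex.re_sum]
  calc ∑ i, ∑ j, (pairFid C.toLin (b i) (b j)).re
      ≤ ∑ i, ∑ j, ((pairFid C.toLin (b i) (b i)).re + (pairFid C.toLin (b j) (b j)).re) / 2 :=
        Finset.sum_le_sum fun i _ => Finset.sum_le_sum fun j _ => re_pairFid_le C _ _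
    _ = M * ∑ i, (pairFid C.toLin (b i) (b i)).re := by
        simp only [← Finset.sum_div, Finset.sum_add_distrib, Finset.sum_const, Finset.card_univ,
          hcard, nsmul_eq_mul, ← Finset.mul_sum]
        ring

end Qudit

/-! ### Some Kraus channels -/

section KrausExamples

variable {H K : Type*} [NormedAddCommGroup H] [InnerProductSpace ℂ H] [CompleteSpace H]
  [NormedAddCommGroup K] [InnerProductSpace ℂ K] [CompleteSpace K]

/-- The conjugation `A ↦ J A J†` with an isometry. -/
lemma exists_isometryChannel (J : H →ₗᵢ[ℂ] K) :
    ∃ Φ : Channel H K, ∀ x y, Φ.toLin (ketBra x y) = ketBra (J x) (J y) := by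
  have hS : IsKrausFamily fun _ : Unit => J.toContinuousLinearMap := fun x =>
    hasSum_of_eq (hasSum_fintype fun _ : Unit => ‖x‖ ^ 2) (fun _ => by simp) (by simp)
  refine ⟨krausChannel hS, fun x y => Subtype.ext (ext_of_inner fun u v => ?_)⟩
  refine (krausChannel_hasKraus hS (ketBra x y) u v).unique
    (hasSum_of_eq (hasSum_fintype fun _ : Unit => ⟪u, (rankOne ℂ (J x) (J y) : K →L[ℂ] K) v⟫_ℂ)
      (fun _ => ?_) (by simp))
  simp [inner_smul_right, ContinuousLinearMap.adjoint_inner_left,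
    ContinuousLinearMap.adjoint_inner_right]

lemma isKrausFamily_rankOne {ι κ : Type*} (b : HilbertBasis ι ℂ H) {a : κ → K}
    (ha : HasSum (fun t => ‖a t‖ ^ 2) 1) :
    IsKrausFamily fun p : κ × ι => (rankOne ℂ (a p.1) (b p.2) : H →L[ℂ] K) := fun x => by
  have hb := hasSum_norm_inner_sq b x
  have := ha.mul hb (ha.summable.mul_of_nonneg hb.summable (fun _ => by positivity)
    (fun _ => by positivity))
  refine hasSum_of_eq this (fun p => ?_) (one_mul _).symm
  rw [rankOne_apply, norm_smul, mul_pow, mul_comm]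

lemma hasSum_mul_complex {ι κ : Type*} {f : κ → ℂ} {g : ι → ℂ} {a b : ℂ} (hf : HasSum f a)
    (hg : HasSum g b) : HasSum (fun p : κ × ι => f p.1 * g p.2) (a * b) :=
  hf.mul hg (summable_mul_of_summable_norm hf.summable.norm hg.summable.norm)

lemma hasSum_rankOne_conj {ι κ : Type*} (b : HilbertBasis ι ℂ H) {a : κ → K} {τ : K →L[ℂ] K}
    (ha : IsSumRankOne τ a a) {A : H →L[ℂ] H} {c : ℂ} (hA : HasSum (fun i => ⟪b i, A (b i)⟫_ℂ) c)
    (u v : K) :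
    HasSum (fun p : κ × ι => ⟪((rankOne ℂ (a p.1) (b p.2) : H →L[ℂ] K)†) u,
      A (((rankOne ℂ (a p.1) (b p.2) : H →L[ℂ] K)†) v)⟫_ℂ) (c * ⟪u, τ v⟫_ℂ) := by
  have h1 := ha.hasSum u v
  refine hasSum_of_eq (hasSum_mul_complex h1 hA) (fun p => ?_) (mul_comm _ _)
  have e : ∀ w : K, ((rankOne ℂ (a p.1) (b p.2) : H →L[ℂ] K)†) w = ⟪a p.1, w⟫_ℂ • b p.2 :=
    fun w => by rw [adjoint_rankOne, rankOne_apply]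
  rw [e, e, map_smul, inner_smul_left, inner_smul_right, inner_conj_symm, ← mul_assoc]

/-- The channel `A ↦ Tr(A) τ`. -/
lemma exists_constChannel {τ : TraceClass K} (hτ : IsState τ) :
    ∃ Φ : Channel H K, ∀ A, Φ.toLin A = trace (A : H →L[ℂ] H) • τ := by
  obtain ⟨a, ha⟩ := exists_isSumRankOne_of_nonneg τ.2 hτ.1
  have ha1 := isSumRankOne_self_norm ha
  rw [hτ.2, Complex.one_re] at ha1
  refine ⟨krausChannel (isKrausFamily_rankOne (fixedBasis H) ha1), fun A =>
    Subtype.ext (ext_of_inner fun u v => ?_)⟩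
  refine (krausChannel_hasKraus (isKrausFamily_rankOne (fixedBasis H) ha1) A u v).unique ?_
  have h2 : HasSum (fun i => ⟪fixedBasis H i, (A : H →L[ℂ] H) (fixedBasis H i)⟫_ℂ)
      (trace (A : H →L[ℂ] H)) := by
    simpa using hasSum_trace_basis A.2 1 (fixedBasis H)
  refine hasSum_of_eq (hasSum_rankOne_conj (fixedBasis H) ha h2 u v) (fun p => rfl) ?_
  rw [Submodule.coe_smul, ContinuousLinearMap.smul_apply, inner_smul_right]

/-- The compression to the range of an isometry, completed to a channel. -/
lemma exists_compressionChannel {M M' : ℕ} (hM' : 0 < M') (J : Qudit M' →ₗᵢ[ℂ] Qudit M) :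
    ∃ Φ : Channel (Qudit M) (Qudit M'), ∀ (A : TraceClass (Qudit M)) (x : Qudit M'),
      0 ≤ (A : Qudit M →L[ℂ] Qudit M) → (⟪J x, (A : Qudit M →L[ℂ] Qudit M) (J x)⟫_ℂ).re ≤
        (⟪x, (Φ.toLin A : Qudit M' →L[ℂ] Qudit M') x⟫_ℂ).re := by
  let J' := J.toContinuousLinearMap
  have hJ : ∀ x, (J'†) (J' x) = x := fun x => by
    refine ext_inner_left ℂ fun z => ?_
    rw [ContinuousLinearMap.adjoint_inner_right]
    exact J.inner_map_map z x
  let b := EuclideanSpace.basisFun (Fin M) ℂ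
  let e := EuclideanSpace.basisFun (Fin M') ℂ ⟨0, hM'⟩
  have he : ‖e‖ = 1 := (EuclideanSpace.basisFun (Fin M') ℂ).orthonormal.1 _
  let Q : Qudit M →L[ℂ] Qudit M := 1 - J' ∘L J'†
  -- The Kraus operator J† performs the compression; the others send everything orthogonal to the
  -- range of J to the fixed vector e, which restores trace preservation and only adds positive
  -- terms to the output.
  let S : Option (Fin M) → Qudit M →L[ℂ] Qudit M' := fun o =>
    o.elim (J'†) fun i => rankOne ℂ e (b i) ∘L Q
  have hS : IsKrausFamily S := fun x => by
    refine hasSum_of_eq (hasSum_fintype fun o => ‖S o x‖ ^ 2) (fun _ => rfl) ?_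
    rw [Fintype.sum_option]
    have h1 : ∀ i, ‖S (some i) x‖ ^ 2 = ‖⟪b i, Q x⟫_ℂ‖ ^ 2 := fun i => by
      simp [S, norm_smul, he]
    have h2 : ‖S none x‖ ^ 2 = ‖J' ((J'†) x)‖ ^ 2 := by
      simp [S, J']
    simp only [h1]
    rw [h2, b.sum_sq_norm_inner_right, ← sq_eq_sq₀ (by positivity) (by positivity)]
    have h3 : x = J' ((J'†) x) + Q x := by simp [Q]
    have h4 : ⟪J' ((J'†) x), Q x⟫_ℂ = 0 := by
      rw [← ContinuousLinearMap.adjoint_inner_right]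
      simp [Q, hJ]
    have h5 := norm_add_sq_eq_norm_sq_add_norm_sq_of_inner_eq_zero (𝕜 := ℂ) _ _ h4
    rw [← h3] at h5
    rw [sq ‖x‖, h5]
    ring
  refine ⟨krausChannel hS, fun A x hA => ?_⟩
  have h1 := Complex.hasSum_re (krausChannel_hasKraus hS A x x)
  have h2 := le_hasSum h1 none fun o _ => re_inner_nonneg_of_nonneg hA _
  simpa [S, J'] using h2

end KrausExamples

/-! ### Quantum communication and entanglement transmission -/

section QuantumCodes

variable {M : ℕ}

lemma maxMixed_eq : maxMixed M = ((1 / M : ℝ) : ℂ) • quditOp 1 := by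
  refine Subtype.ext ?_
  simp [maxMixed, quditOp_coe]

lemma quditOp_one_eq_sum : (quditOp 1 : TraceClass (Qudit M)) =
    ∑ i, ketBra (EuclideanSpace.basisFun (Fin M) ℂ i) (EuclideanSpace.basisFun (Fin M) ℂ i) :=
  (sum_ketBra_orthonormalBasis _).symm

lemma isState_maxMixed (hM : 0 < M) : IsState (maxMixed M) := by
  have hM' : (M : ℂ) ≠ 0 := by exact_mod_cast hM.ne'
  refine ⟨?_, ?_⟩
  · rw [maxMixed_eq, Submodule.coe_smul, quditOp_coe, ContinuousLinearMap.nonneg_iff_isPositive]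
    exact ContinuousLinearMap.isPositive_one.smul_of_nonneg (Complex.zero_le_real.2 (by positivity))
  · rw [← traceL_one, maxMixed_eq, map_smul, quditOp_one_eq_sum, map_sum]
    simp [traceL_ketBra, inner_self_eq_norm_sq_to_K, hM']

/-- An orthonormal set of bad vectors of largest cardinality exists because cardinalities are
bounded by the dimension; a bad unit vector orthogonal to it could be adjoined. -/
lemma exists_maximal_bad {V : Type*} [NormedAddCommGroup V] [InnerProductSpace ℂ V]
    [FiniteDimensional ℂ V] (bad : V → Prop) :
    ∃ v : Finset V, Orthonormal ℂ (Subtype.val : v → V) ∧ (∀ x ∈ v, bad x) ∧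
      ∀ x : V, ‖x‖ = 1 → (∀ y ∈ v, ⟪y, x⟫_ℂ = 0) → ¬ bad x := by
  classical
  let p : ℕ → Prop := fun k => ∃ v : Finset V, v.card = k ∧
    Orthonormal ℂ (Subtype.val : v → V) ∧ ∀ x ∈ v, bad x
  have hp0 : p 0 := ⟨∅, rfl, by
    refine ⟨fun i => absurd i.2 (Finset.notMem_empty _), fun i => absurd i.2
      (Finset.notMem_empty _)⟩, by simp⟩
  have hple : ∀ k, p k → k ≤ Module.finrank ℂ V := by
    rintro k ⟨v, rfl, hv, -⟩
    simpa using hv.linearIndependent.fintype_card_le_finrank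
  obtain ⟨v, hvc, hv, hbad⟩ : p (Nat.findGreatest p (Module.finrank ℂ V)) :=
    Nat.findGreatest_spec (Nat.zero_le _) hp0
  refine ⟨v, hv, hbad, fun x hx hperp hxbad => ?_⟩
  have hxv : x ∉ v := fun hmem => by
    have := hperp x hmem
    rw [inner_self_eq_zero] at this
    simp [this] at hx
  have hp1 : p (v.card + 1) := by
    refine ⟨insert x v, Finset.card_insert_of_notMem hxv, ?_, ?_⟩
    · have hn : ∀ y ∈ v, ‖y‖ = 1 := fun y hy => hv.1 ⟨y, hy⟩
      have ho : ∀ y ∈ v, ∀ z ∈ v, y ≠ z → ⟪y, z⟫_ℂ = 0 := fun y hy z hz hyz =>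
        hv.2 (i := ⟨y, hy⟩) (j := ⟨z, hz⟩) (by simpa using hyz)
      refine ⟨?_, ?_⟩
      · rintro ⟨y, hy⟩
        rcases Finset.mem_insert.1 hy with rfl | hy
        · exact hx
        · exact hn y hy
      · rintro ⟨y, hy⟩ ⟨z, hz⟩ hyz
        have hyz' : y ≠ z := by simpa using hyz
        change ⟪y, z⟫_ℂ = 0
        rcases Finset.mem_insert.1 hy with hyx | hyv
        · rcases Finset.mem_insert.1 hz with hzx | hzv
          · exact absurd (hyx.trans hzx.symm) hyz'
          · rw [hyx, ← inner_conj_symm, hperp z hzv, map_zero]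
        · rcases Finset.mem_insert.1 hz with hzx | hzv
          · rw [hzx, hperp y hyv]
          · exact ho y hyv z hzv hyz'
    · intro y hy
      rcases Finset.mem_insert.1 hy with rfl | hy
      · exact hxbad
      · exact hbad y hy
  have := Nat.le_findGreatest (hple _ hp1) hp1
  omega

/-- If, in every orthonormal basis, at most `c` vectors are bad, then there is a subspace of
codimension at most `c` without bad unit vectors. -/
lemma exists_isometry_not_bad (bad : Qudit M → Prop) [DecidablePred bad] {c : ℝ}
    (h : ∀ (κ : Type) [Fintype κ] (b : OrthonormalBasis κ ℂ (Qudit M)),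
      ((Finset.univ.filter fun k => bad (b k)).card : ℝ) ≤ c) :
    ∃ (M' : ℕ) (J : Qudit M' →ₗᵢ[ℂ] Qudit M), (M : ℝ) - c ≤ M' ∧ ∀ x, ‖x‖ = 1 → ¬ bad (J x) := by
  classical
  -- Completing v to an orthonormal basis and counting the bad basis vectors bounds the size of v by
  -- c. By maximality the orthogonal complement of its span has no bad unit vector.
  obtain ⟨v, hv, hbad, hmax⟩ := exists_maximal_bad bad
  obtain ⟨u, b, hvu, hb⟩ := Orthonormal.exists_orthonormalBasis_extension (v := (v : Set (Qudit M)))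
    hv
  have hcard : (v.card : ℝ) ≤ c := by
    refine le_trans ?_ (h u b)
    have : v.card ≤ (Finset.univ.filter fun k => bad (b k)).card := by
      refine le_trans (Finset.card_le_card fun x hx => ?_) (Finset.card_image_le (f := Subtype.val))
      refine Finset.mem_image.2 ⟨⟨x, hvu hx⟩, Finset.mem_filter.2 ⟨Finset.mem_univ _, ?_⟩, rfl⟩
      rw [hb]
      exact hbad x hx
    exact_mod_cast this
  let W : Submodule ℂ (Qudit M) := Submodule.span ℂ (v : Set (Qudit M))
  have hW : Module.finrank ℂ W = v.card := finrank_span_finset_eq_card hv.linearIndependent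
  have hWo : Module.finrank ℂ W + Module.finrank ℂ Wᗮ = M := by
    simpa using W.finrank_add_finrank_orthogonal
  refine ⟨Module.finrank ℂ Wᗮ,
    Wᗮ.subtypeₗᵢ.comp (stdOrthonormalBasis ℂ Wᗮ).repr.symm.toLinearIsometry, ?_, fun x hx => ?_⟩
  · have : (v.card : ℝ) + Module.finrank ℂ Wᗮ = M := by rw [← hW]; exact_mod_cast hWo
    linarith
  · refine hmax _ (by rw [LinearIsometry.norm_map, hx]) fun y hy => ?_
    exact (Submodule.mem_orthogonal W _).1 (Subtype.prop
      ((stdOrthonormalBasis ℂ Wᗮ).repr.symm x)) y (Submodule.subset_span hy)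

end QuantumCodes

/-! ### Conversions between entanglement transmission and quantum communication codes. -/

section QuantumEntanglement

variable {ι HA HB : Type*}
  [NormedAddCommGroup HA] [InnerProductSpace ℂ HA] [CompleteSpace HA]
  [NormedAddCommGroup HB] [InnerProductSpace ℂ HB] [CompleteSpace HB]
  {N : Channel HA HB} {G : EnergyObservable ι HA} {P : ℝ}

lemma QuantumCode.entanglementCode {n M : ℕ} {ε : ℝ} (hM : 0 < M) (h : QuantumCode N G P n M ε) :
    EntanglementCode N G P n M ε := by
  obtain ⟨Nn, hN, E, D, hE, hF⟩ := h
  refine ⟨Nn, hN, E, D, hE _ (isState_maxMixed hM), ?_⟩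
  rw [maxEntangled_eq hM]
  exact hF _ (norm_maxVec hM)

lemma quantumCapacity_le_entanglementCapacity :
    quantumCapacity N G P ≤ entanglementCapacity N G P :=
  capacity_mono fun ε h0 h1 => ⟨ε, h0, h1, 1, one_pos, fun _ _ M hM hc =>
    ⟨M, by simp, hc.entanglementCode hM⟩⟩

lemma ketBra_self_nonneg {H : Type*} [NormedAddCommGroup H] [InnerProductSpace ℂ H]
    [CompleteSpace H] (x : H) : 0 ≤ (ketBra x x : H →L[ℂ] H) :=
  rankOne_self_nonneg x

lemma coe_toLin_sum {H K κ : Type*} [NormedAddCommGroup H] [InnerProductSpace ℂ H]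
    [CompleteSpace H] [NormedAddCommGroup K] [InnerProductSpace ℂ K] [CompleteSpace K] [Fintype κ]
    (E : Channel H K) (A : κ → TraceClass H) :
    (E.toLin (∑ k, A k) : K →L[ℂ] K) = ∑ k, (E.toLin (A k) : K →L[ℂ] K) := by
  rw [map_sum, AddSubmonoidClass.coe_finset_sum]

lemma quditOp_one_eq_smul {M : ℕ} (hM : 0 < M) :
    (quditOp 1 : TraceClass (Qudit M)) = ((M : ℝ) : ℂ) • maxMixed M := by
  have hM' : (M : ℂ) ≠ 0 := by exact_mod_cast hM.ne'
  rw [maxMixed_eq, smul_smul]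
  push_cast
  rw [mul_one_div_cancel hM', one_smul]

/-- The energies of the images of an orthonormal basis add up to `M` times the energy of the image
of the maximally mixed state. -/
lemma sum_energy_ketBra {H : Type*} [NormedAddCommGroup H] [InnerProductSpace ℂ H] [CompleteSpace H]
    {ι' κ : Type*} [Fintype κ] (G : EnergyObservable ι' H) {M : ℕ} (hM : 0 < M)
    (E : Channel (Qudit M) H) (b : OrthonormalBasis κ ℂ (Qudit M)) :
    ∑ k, G.energy (E.toLin (ketBra (b k) (b k)) : H →L[ℂ] H) =
      M * G.energy (E.toLin (maxMixed M) : H →L[ℂ] H) := by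
  have h1 : (E.toLin (quditOp 1) : H →L[ℂ] H) =
      ((M : ℝ) : ℂ) • (E.toLin (maxMixed M) : H →L[ℂ] H) := by
    rw [quditOp_one_eq_smul hM, map_smul, Submodule.coe_smul]
  have h2 : (E.toLin (quditOp 1) : H →L[ℂ] H) =
      ∑ k, (E.toLin (ketBra (b k) (b k)) : H →L[ℂ] H) := by
    rw [← sum_ketBra_orthonormalBasis b, coe_toLin_sum]
  rw [← energy_sum _ fun k => E.nonneg (ketBra_self_nonneg _), ← h2, h1,
    energy_smul (by positivity), ENNReal.ofReal_natCast]

/-- An energy bound on pure states, without normalization. -/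
lemma energy_ketBra_le {H : Type*} [NormedAddCommGroup H] [InnerProductSpace ℂ H] [CompleteSpace H]
    {ι' : Type*} (G : EnergyObservable ι' H) {M : ℕ} (E : Channel (Qudit M) H) {c : ℝ≥0∞}
    (h : ∀ x : Qudit M, ‖x‖ = 1 → G.energy (E.toLin (ketBra x x) : H →L[ℂ] H) ≤ c) (x : Qudit M) :
    G.energy (E.toLin (ketBra x x) : H →L[ℂ] H) ≤ ENNReal.ofReal (‖x‖ ^ 2) * c := by
  by_cases hx : x = 0
  · have : ketBra (0 : Qudit M) 0 = 0 := by simpa using ketBra_smul_left (0 : ℂ) (0 : Qudit M) 0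
    rw [hx, this, map_zero, Submodule.coe_zero, energy_zero]
    exact zero_le
  · have hx' : ‖x‖ ≠ 0 := norm_ne_zero_iff.2 hx
    set y : Qudit M := ((‖x‖⁻¹ : ℝ) : ℂ) • x with hy
    have hy1 : ‖y‖ = 1 := by
      rw [hy, norm_smul, Complex.norm_real, norm_inv, norm_norm, inv_mul_cancel₀ hx']
    have hxy : x = ((‖x‖ : ℝ) : ℂ) • y := by
      rw [hy, smul_smul, ← Complex.ofReal_mul, mul_inv_cancel₀ hx', Complex.ofReal_one, one_smul]
    have he : ketBra x x = ((‖x‖ ^ 2 : ℝ) : ℂ) • ketBra y y := by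
      conv_lhs => rw [hxy, ketBra_smul_left, ketBra_smul_right, smul_smul]
      congr 1
      simp [sq]
    rw [he, map_smul, Submodule.coe_smul, energy_smul (by positivity)]
    exact mul_le_mul_right (h y hy1) _

/-- An energy bound on pure states extends to all states of a finite-dimensional system. -/
lemma energy_le_of_pure {H : Type*} [NormedAddCommGroup H] [InnerProductSpace ℂ H] [CompleteSpace H]
    {ι' : Type*} (G : EnergyObservable ι' H) {M : ℕ} (E : Channel (Qudit M) H) {c : ℝ≥0∞}
    (h : ∀ x : Qudit M, ‖x‖ = 1 → G.energy (E.toLin (ketBra x x) : H →L[ℂ] H) ≤ c)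
    {ρ : TraceClass (Qudit M)} (hρ : IsState ρ) : G.energy (E.toLin ρ : H →L[ℂ] H) ≤ c := by
  obtain ⟨m, u, hu⟩ := ContinuousLinearMap.isPositive_iff_eq_sum_rankOne.1
    ((ContinuousLinearMap.nonneg_iff_isPositive _).1 hρ.1)
  have hu' : ρ = ∑ i, ketBra (u i) (u i) := Subtype.ext (by
    rw [AddSubmonoidClass.coe_finset_sum, hu]
    rfl)
  have htr : ∑ i, ‖u i‖ ^ 2 = 1 := by
    have h1 := hρ.2
    rw [← traceL_one, hu', map_sum] at h1
    refine Complex.ofReal_injective ?_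
    rw [Complex.ofReal_one, ← h1, Complex.ofReal_sum]
    refine Finset.sum_congr rfl fun i _ => ?_
    rw [traceL_ketBra, ContinuousLinearMap.one_apply, inner_self_eq_norm_sq_to_K]
    push_cast
    rfl
  have h3 : (E.toLin ρ : H →L[ℂ] H) = ∑ i, (E.toLin (ketBra (u i) (u i)) : H →L[ℂ] H) := by
    rw [hu', coe_toLin_sum]
  rw [h3, energy_sum _ fun i => E.nonneg (ketBra_self_nonneg _)]
  calc _ ≤ ∑ i, ENNReal.ofReal (‖u i‖ ^ 2) * c := Finset.sum_le_sum fun i _ => energy_ketBra_le G E h _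
    _ = c := by
      rw [← Finset.sum_mul, ← ENNReal.ofReal_sum_of_nonneg fun i _ => by positivity, htr,
        ENNReal.ofReal_one, one_mul]

lemma re_pairFid_le_one {M : ℕ} (C : Channel (Qudit M) (Qudit M)) {x : Qudit M} (hx : ‖x‖ = 1) :
    (pairFid C.toLin x x).re ≤ 1 := by
  have hv : Orthonormal ℂ fun _ : Unit => x := ⟨fun _ => hx, fun i j hij => (hij rfl).elim⟩
  simpa [pairFid] using (C.isState (isState_ketBra hx)).sum_inner_le hv Finset.univ

/-- The fidelity with a pure state is linear in the channel, and the contribution of Ψ is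
nonnegative and can be dropped. -/
lemma idTensor_mix {M : ℕ} {K : Type*} [NormedAddCommGroup K] [InnerProductSpace ℂ K]
    [CompleteSpace K] (C : Channel K (Qudit M)) {r : ℝ} (h0 : 0 ≤ r)
    (h1 : r ≤ 1) (Φ Ψ : Channel (Qudit M) K) {ε : ℝ} (hε : 0 ≤ ε) {φ : BiQudit M} (hφ : ‖φ‖ = 1)
    (h : 1 - ε ≤ fidelity (rankOne ℂ φ φ) (idTensor (C.comp Φ).toLin (rankOne ℂ φ φ))) :
    1 - (ε + r) ≤ fidelity (rankOne ℂ φ φ)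
      (idTensor (C.comp (Channel.mix r h0 h1 Φ Ψ)).toLin (rankOne ℂ φ φ)) := by
  have hnn : 0 ≤ fidelity (rankOne ℂ φ φ) (idTensor (C.comp Ψ).toLin (rankOne ℂ φ φ)) :=
    sq_nonneg _
  rw [fidelity_idTensor _ hφ] at h hnn ⊢
  have e : ∀ x y, pairFid (C.comp (Channel.mix r h0 h1 Φ Ψ)).toLin x y =
      ((1 - r : ℝ) : ℂ) * pairFid (C.comp Φ).toLin x y +
        (r : ℂ) * pairFid (C.comp Ψ).toLin x y := fun x y => by
    simp only [pairFid, Channel.comp_toLin, LinearMap.comp_apply, Channel.mix_toLin]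
    rw [C.map_mix, Submodule.coe_add, Submodule.coe_smul, Submodule.coe_smul,
      ContinuousLinearMap.add_apply, ContinuousLinearMap.smul_apply,
      ContinuousLinearMap.smul_apply, inner_add_right, inner_smul_right, inner_smul_right]
  simp only [e, Finset.sum_add_distrib, ← Finset.mul_sum]
  rw [Complex.add_re, Complex.re_ofReal_mul, Complex.re_ofReal_mul]
  have h3 := mul_le_mul_of_nonneg_left h (by linarith : 0 ≤ 1 - r)
  nlinarith [mul_nonneg h0 hnn, mul_nonneg h0 hε]

/-- In every orthonormal basis at most θM vectors have large energy and, by Markov's inequality at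
the threshold ε', at most (1 - θ)M/2 have low fidelity, so a subspace of dimension at least (1 -
θ)M/2 is good throughout. The factor 2 in the error is the price of passing from pure states of S to
those of R ⊗ S; r is the price of mixing. -/
lemma EntanglementCode.exists_quantumCode {n M : ℕ} {Pb θ r ε' : ℝ} (hM : 0 < M)
    (hr0 : 0 < r) (hr1 : r < 1) (hθ1 : θ < 1) (hε' : 0 < ε')
    (hexp : ExpurgationBound (G.ext n) P Pb θ) (hmix : MixingBound (G.ext n) P Pb r)
    (h : EntanglementCode N G P n M (ε' * ((1 - θ) / 2))) :
    ∃ M' : ℕ, (1 - θ) / 2 * M ≤ M' ∧ QuantumCode N G P n M' (2 * ε' + r) := by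
  classical
  obtain ⟨Nn, hN, E, D, hE, hF⟩ := h
  have hMpos : (0 : ℝ) < M := by exact_mod_cast hM
  let C : Channel (Qudit M) (Qudit M) := D.comp (Nn.comp E)
  let en : Qudit M → ℝ≥0∞ := fun x =>
    (G.ext n).energy (E.toLin (ketBra x x) : TensorPow HA n →L[ℂ] TensorPow HA n)
  obtain ⟨M', J, hM', hJ⟩ := exists_isometry_not_bad
    (fun x => ENNReal.ofReal Pb < en x ∨ ε' < 1 - (pairFid C.toLin x x).re)
    (c := θ * M + (1 - θ) / 2 * M) fun κ _ b => by
      have hcard : Fintype.card κ = M := by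
        rw [← Module.finrank_eq_card_basis b.toBasis]; simp
      have c1 := hexp κ (fun k => E.toLin (ketBra (b k) (b k)))
        (fun k => E.isState (isState_ketBra (b.orthonormal.1 k))) (by
          rw [sum_energy_ketBra _ hM, hcard]
          exact mul_le_mul_right hE _)
      have c2 := card_filter_lt_mul_le (c := ε') (e := fun k => 1 - (pairFid C.toLin (b k) (b k)).re)
        (s := M * (ε' * ((1 - θ) / 2)))
        (fun k => sub_nonneg.2 (re_pairFid_le_one C (b.orthonormal.1 k))) (by
          have h1 := hF.trans (fidelity_maxEntangled_le C hM b)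
          rw [one_div, inv_mul_eq_div, le_div_iff₀ hMpos] at h1
          rw [Finset.sum_sub_distrib, Finset.sum_const, Finset.card_univ, hcard, nsmul_eq_mul]
          linarith)
      have c2' : ((Finset.univ.filter fun k => ε' < 1 - (pairFid C.toLin (b k) (b k)).re).card : ℝ)
          ≤ (1 - θ) / 2 * M := by
        refine le_of_mul_le_mul_right (c2.trans (le_of_eq ?_)) hε'
        ring
      have c1' : ((Finset.univ.filter fun k => ENNReal.ofReal Pb < en (b k)).card : ℝ) ≤ θ * M := by
        rw [hcard] at c1
        convert c1
      rw [Finset.filter_or]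
      refine le_trans ?_ (add_le_add c1' c2')
      exact_mod_cast Finset.card_union_le _ _
  have hM'' : (1 - θ) / 2 * M ≤ M' := by linarith
  have hM'0 : 0 < M' := by
    have : (0 : ℝ) < M' := lt_of_lt_of_le (mul_pos (by linarith) hMpos) hM''
    exact_mod_cast this
  have hgood : ∀ x : Qudit M', ‖x‖ = 1 → en (J x) ≤ ENNReal.ofReal Pb ∧
      1 - ε' ≤ (pairFid C.toLin (J x) (J x)).re := fun x hx => by
    have := hJ x hx
    rw [not_or, not_lt, not_lt] at this
    exact ⟨this.1, by linarith [this.2]⟩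
  obtain ⟨Φ, hΦ⟩ := exists_isometryChannel J
  obtain ⟨Ψ, hΨ⟩ := exists_compressionChannel hM'0 J
  let e : Qudit M' := EuclideanSpace.basisFun (Fin M') ℂ ⟨0, hM'0⟩
  have he : ‖e‖ = 1 := (EuclideanSpace.basisFun (Fin M') ℂ).orthonormal.1 _
  obtain ⟨τ, hτ, hτE⟩ := hmix (E.toLin (ketBra (J e) (J e)))
    (E.isState (isState_ketBra (by rw [J.norm_map, he]))) (hgood e he).1
  obtain ⟨Θ, hΘ⟩ := exists_constChannel (H := Qudit M') hτ
  -- The encoder embeds the good subspace, applies the old encoder and mixes in τ as a constant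
  -- channel; the decoder is the old one followed by the compression.
  refine ⟨M', hM'', Nn, hN, Channel.mix r hr0.le hr1.le (E.comp Φ) Θ, Ψ.comp D,
    fun ρ hρ => ?_, fun φ hφ => ?_⟩
  · rw [Channel.mix_toLin, hΘ, hρ.2, one_smul]
    refine hτE _ ((E.comp Φ).isState hρ).1 (energy_le_of_pure _ (E.comp Φ) (fun x hx => ?_) hρ)
    rw [Channel.comp_toLin, LinearMap.comp_apply, hΦ]
    exact (hgood x hx).1
  · refine idTensor_mix ((Ψ.comp D).comp Nn) hr0.le hr1.le (E.comp Φ) Θ (by positivity) hφ ?_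
    rw [fidelity_idTensor _ hφ]
    refine le_fidelity_of_pure _ hε'.le (fun x hx => ?_) hφ
    refine (hgood x hx).2.trans ?_
    -- The compression does not lower the fidelity of a vector of the good subspace.
    have h1 := hΨ (C.toLin (ketBra (J x) (J x))) x (C.nonneg (ketBra_self_nonneg _))
    rw [← hΦ] at h1
    rw [pairFid, ← hΦ]
    exact h1

lemma entanglementCapacity_le_quantumCapacity (hP : 0 ≤ P) :
    entanglementCapacity N G P ≤ quantumCapacity N G P :=
  capacity_mono fun ε h0 h1 => by
    obtain ⟨Pb, θ, hθ0, hθ1, hb⟩ := exists_expurgation_mixing G hP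
      (half_pos h0) (by linarith : ε / 2 < 1)
    -- The threshold ε/4 enters the final error twice, and the mixing weight ε/2 completes it to ε.
    refine ⟨ε / 4 * ((1 - θ) / 2), by have : 0 < 1 - θ := by linarith
                                      positivity, by nlinarith, (1 - θ) / 2, by linarith,
      fun n hn M hM hc => ?_⟩
    obtain ⟨M', hM', hc'⟩ := hc.exists_quantumCode hM (half_pos h0) (by linarith) hθ1
      (by positivity) (hb n hn).1 (hb n hn).2
    refine ⟨M', hM', ?_⟩
    have : 2 * (ε / 4) + ε / 2 = ε := by ring
    rwa [this] at hc'

end QuantumEntanglement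

/-! ### Iterated sums -/

section Sums

variable {I J : Type*}

lemma hasSum_prod_of_nonneg {F : I × J → ℝ} (h0 : ∀ p, 0 ≤ F p) {g : I → ℝ} {a : ℝ}
    (hF : ∀ i, HasSum (fun j => F (i, j)) (g i)) (hg : HasSum g a) : HasSum F a := by
  have hs : Summable F := (summable_prod_of_nonneg h0).2 ⟨fun i => (hF i).summable, by
    simpa only [(hF _).tsum_eq] using hg.summable⟩
  have := (hs.hasSum.prod_fiberwise hF).unique hg
  rw [← this]
  exact hs.hasSum

lemma hasSum_prod_fintype {E : Type*} [AddCommMonoid E] [TopologicalSpace E] [ContinuousAdd E]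
    [Fintype I] {F : I × J → E} {g : I → E} (hF : ∀ i, HasSum (fun j => F (i, j)) (g i)) :
    HasSum F (∑ i, g i) := by
  classical
  have h1 : ∀ i, HasSum (fun p : I × J => if p.1 = i then F p else 0) (g i) := fun i => by
    refine ((Prod.mk_right_injective i).hasSum_iff (fun p hp => ?_)).1 
      (hasSum_of_eq (hF i) (fun j => if_pos rfl) rfl)
    refine if_neg fun hpi => hp ⟨p.2, ?_⟩
    rw [← hpi]
  refine hasSum_of_eq (hasSum_sum (s := Finset.univ) fun i _ => h1 i) (fun p => ?_) rfl
  simp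

lemma HasSum.swap_fiberwise {E : Type*} [AddCommGroup E] [UniformSpace E] [IsUniformAddGroup E]
    [T2Space E] [RegularSpace E] {F : I × J → E} (hF : Summable F) {g : I → E} {g' : J → E} {a : E}
    (hg : ∀ i, HasSum (fun j => F (i, j)) (g i)) (hg' : ∀ j, HasSum (fun i => F (i, j)) (g' j))
    (ha : HasSum g a) : HasSum g' a := by
  have h1 := (hF.hasSum.prod_fiberwise hg).unique ha
  rw [← h1]
  exact HasSum.prod_fiberwise ((Equiv.prodComm J I).hasSum_iff.2 hF.hasSum) hg'

lemma tsum_mul_le_of_hasSum_sq {x y : I → ℝ} {a b : ℝ} (ha : 0 ≤ a) (hb : 0 ≤ b)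
    (hx : HasSum (fun t => x t ^ 2) (a ^ 2)) (hy : HasSum (fun t => y t ^ 2) (b ^ 2)) :
    ∑' t, x t * y t ≤ a * b := by
  refine (summable_mul_of_sq hx.summable hy.summable).tsum_le_of_sum_le fun s => ?_
  refine (Real.sum_mul_le_sqrt_mul_sqrt s x y).trans ?_
  refine mul_le_mul ?_ ?_ (Real.sqrt_nonneg _) ha
  · exact Real.sqrt_le_iff.2 ⟨ha, sum_le_hasSum s (fun _ _ => by positivity) hx⟩
  · exact Real.sqrt_le_iff.2 ⟨hb, sum_le_hasSum s (fun _ _ => by positivity) hy⟩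

end Sums

/-! ### Operators with a purification -/

section Purification

variable {T E : Type*} [NormedAddCommGroup E] [InnerProductSpace ℂ E] [CompleteSpace E]

lemma exists_lpState (v : lp (fun _ : T => E) 2) :
    ∃ A : TraceClass E, IsSumRankOne (A : E →L[ℂ] E) v v := by
  obtain ⟨A, hA⟩ := exists_isSumRankOne (lp_hasSum_norm_sq v).summable (lp_hasSum_norm_sq v).summable
  exact ⟨⟨A, hA.mem_traceClass⟩, hA⟩

/-- The operator `∑ₜ |vₜ⟩⟨vₜ|`. -/
def lpState (v : lp (fun _ : T => E) 2) : TraceClass E := (exists_lpState v).choose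

lemma isSumRankOne_lpState (v : lp (fun _ : T => E) 2) :
    IsSumRankOne (lpState v : E →L[ℂ] E) v v := (exists_lpState v).choose_spec

lemma trace_lpState (v : lp (fun _ : T => E) 2) : (trace (lpState v : E →L[ℂ] E)).re = ‖v‖ ^ 2 :=
  (isSumRankOne_self_norm (isSumRankOne_lpState v)).unique (lp_hasSum_norm_sq v)

/-- Termwise |v⟩⟨v| - |w⟩⟨w| = |v - w⟩⟨v| + |w⟩⟨v - w|, followed by Cauchy–Schwarz. -/
lemma tnorm_lpState_sub_le (v w : lp (fun _ : T => E) 2) :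
    tnorm (lpState v - lpState w) ≤ ‖v - w‖ * (‖v‖ + ‖w‖) := by
  have hs : ∀ z : lp (fun _ : T => E) 2, Summable fun t => ‖z t‖ ^ 2 := fun z =>
    (lp_hasSum_norm_sq z).summable
  obtain ⟨A, hA⟩ := exists_isSumRankOne (hs (v - w)) (hs v)
  obtain ⟨B, hB⟩ := exists_isSumRankOne (hs w) (hs (v - w))
  let A' : TraceClass E := ⟨A, hA.mem_traceClass⟩
  let B' : TraceClass E := ⟨B, hB.mem_traceClass⟩
  have hAB : lpState v - lpState w = A' + B' := by
    refine Subtype.ext (ext_of_inner fun x y => ?_)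
    have h1 := ((isSumRankOne_lpState v).hasSum x y).sub ((isSumRankOne_lpState w).hasSum x y)
    have h2 := (hA.hasSum x y).add (hB.hasSum x y)
    have h3 : ⟪x, (lpState v : E →L[ℂ] E) y⟫_ℂ - ⟪x, (lpState w : E →L[ℂ] E) y⟫_ℂ =
        ⟪x, A y⟫_ℂ + ⟪x, B y⟫_ℂ := by
      refine h1.unique (hasSum_of_eq h2 (fun t => ?_) rfl)
      rw [lp.coeFn_sub, Pi.sub_apply, inner_sub_right, inner_sub_left]
      ring
    rw [Submodule.coe_sub, ContinuousLinearMap.sub_apply, inner_sub_right, h3, ← inner_add_right]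
    rfl
  rw [hAB]
  refine (tnorm_add_le _ _).trans ?_
  have hA1 : tnorm A' ≤ ‖v - w‖ * ‖v‖ := (IsSumRankOne.tnorm_le (A := A') hA).trans
    (tsum_mul_le_of_hasSum_sq (norm_nonneg _) (norm_nonneg _) (lp_hasSum_norm_sq _)
      (lp_hasSum_norm_sq _))
  have hB1 : tnorm B' ≤ ‖w‖ * ‖v - w‖ := (IsSumRankOne.tnorm_le (A := B') hB).trans
    (tsum_mul_le_of_hasSum_sq (norm_nonneg _) (norm_nonneg _) (lp_hasSum_norm_sq _)
      (lp_hasSum_norm_sq _))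
  linarith

/-- The distance of a state to the part of it which comes from some of its rank-one summands. -/
lemma IsState.tnorm_sub_lpState {W : Type*} {ρ : TraceClass E} (hρ : IsState ρ) {a : W → E}
    (ha : IsSumRankOne (ρ : E →L[ℂ] E) a a) (v : lp (fun _ : T => E) 2) {j : T → W}
    (hj : Function.Injective j) (hv : ∀ t, v t = a (j t)) :
    ‖v‖ ≤ 1 ∧ tnorm (ρ - lpState v) = 1 - ‖v‖ ^ 2 := by
  have hsq : ∀ (z u : E), ⟪z, u⟫_ℂ * ⟪u, z⟫_ℂ = ((‖⟪z, u⟫_ℂ‖ ^ 2 : ℝ) : ℂ) := fun z u => by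
    rw [← inner_conj_symm u z, Complex.mul_conj, Complex.normSq_eq_norm_sq]
  -- Since v collects a subfamily of the rank-one terms of ρ, the difference is the sum of the
  -- remaining ones; it is positive, and its trace norm is its trace.
  have hnn : 0 ≤ ((ρ - lpState v : TraceClass E) : E →L[ℂ] E) := by
    rw [nonneg_iff_inner]
    intro z
    have h1 := (isSumRankOne_lpState v).hasSum z z
    have h2 := ha.hasSum z z
    have h0 : ∀ u : E, 0 ≤ ⟪z, u⟫_ℂ * ⟪u, z⟫_ℂ := fun u => by
      rw [hsq]
      exact Complex.zero_le_real.2 (by positivity)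
    have h3 := hasSum_le_inj j hj (fun w _ => h0 (a w)) (fun t => by rw [hv]) h1 h2
    rw [Submodule.coe_sub, ContinuousLinearMap.sub_apply, inner_sub_right]
    exact sub_nonneg.2 h3
  have ht : tnorm (ρ - lpState v) = 1 - ‖v‖ ^ 2 := by
    rw [tnorm_of_nonneg hnn, ← traceL_one, map_sub, traceL_one, traceL_one, hρ.2, Complex.sub_re,
      trace_lpState, Complex.one_re]
  refine ⟨?_, ht⟩
  have := tnorm_nonneg (ρ - lpState v)
  rw [ht] at this
  nlinarith [norm_nonneg v]

/-- If the mean of `M` vectors of the unit ball has norm almost one, then most of the vectors are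
close to the mean. -/
lemma mean_dist_le {V : Type*} [NormedAddCommGroup V] [InnerProductSpace ℂ V] {M : ℕ} (hM : 0 < M)
    (v : Fin M → V) (hv : ∀ m, ‖v m‖ ≤ 1) {r : V} (hr : ∑ m, v m = (M : ℂ) • r) {ε : ℝ}
    (h : 1 - ε ≤ ‖r‖ ^ 2) :
    (1 / M : ℝ) * ∑ m, (2 * ‖v m - r‖ + (1 - ‖v m‖ ^ 2)) ≤ 2 * √ε + ε := by
  have hM' : (0 : ℝ) < M := by exact_mod_cast hM
  -- The variance identity. It bounds the mean squared distance by 1 - ‖r‖² ≤ ε, and Cauchy–Schwarz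
  -- then gives the term 2√ε. Nonnegativity of the variance bounds the mean of 1 - ‖v_m‖² by ε as
  -- well.
  have h1 : ∑ m, ‖v m - r‖ ^ 2 = ∑ m, ‖v m‖ ^ 2 - M * ‖r‖ ^ 2 := by
    have e : ∀ m, ‖v m - r‖ ^ 2 = ‖v m‖ ^ 2 - 2 * (⟪v m, r⟫_ℂ).re + ‖r‖ ^ 2 := fun m =>
      norm_sub_sq (𝕜 := ℂ) (v m) r
    have e2 : ∑ m, (⟪v m, r⟫_ℂ).re = M * ‖r‖ ^ 2 := by
      rw [← Complex.re_sum, ← sum_inner, hr, inner_smul_left, inner_self_eq_norm_sq_to_K]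
      simp [← Complex.ofReal_pow]
    simp only [e]
    rw [Finset.sum_add_distrib, Finset.sum_sub_distrib, ← Finset.mul_sum, e2, Finset.sum_const,
      Finset.card_univ, Fintype.card_fin, nsmul_eq_mul]
    ring
  have h2 : ∑ m, ‖v m‖ ^ 2 ≤ M := by
    calc _ ≤ ∑ _m : Fin M, (1 : ℝ) := Finset.sum_le_sum fun m _ => by
          have := hv m
          nlinarith [norm_nonneg (v m)]
      _ = M := by simp
  have h3 : 0 ≤ ∑ m, ‖v m - r‖ ^ 2 := Finset.sum_nonneg fun m _ => by positivity
  have hε : 0 ≤ ε := by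
    have : M * ‖r‖ ^ 2 ≤ M * 1 := by linarith
    have := le_of_mul_le_mul_left this hM'
    linarith
  have h4 : (∑ m, ‖v m - r‖) ^ 2 ≤ M * ∑ m, ‖v m - r‖ ^ 2 := by
    simpa using sq_sum_le_card_mul_sum_sq (s := Finset.univ) (f := fun m => ‖v m - r‖)
  have h5 : ∑ m, ‖v m - r‖ ≤ M * √ε := by
    refine le_of_sq_le_sq (h4.trans ?_) (by positivity)
    rw [mul_pow, Real.sq_sqrt hε]
    nlinarith [mul_le_mul_of_nonneg_left h hM'.le, mul_le_mul_of_nonneg_left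
      (mul_le_mul_of_nonneg_left h hM'.le) hM'.le]
  rw [one_div, inv_mul_eq_div, div_le_iff₀ hM', Finset.sum_add_distrib, ← Finset.mul_sum,
    Finset.sum_sub_distrib]
  simp only [Finset.sum_const, Finset.card_univ, Fintype.card_fin, nsmul_eq_mul, mul_one]
  nlinarith [mul_le_mul_of_nonneg_left h hM'.le]

end Purification

/-! ### Gram families of encoders and decoders -/

section Gram

variable {H K Z : Type*} [NormedAddCommGroup H] [InnerProductSpace ℂ H] [CompleteSpace H]
  [NormedAddCommGroup K] [InnerProductSpace ℂ K] [CompleteSpace K]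
  [NormedAddCommGroup Z] [InnerProductSpace ℂ Z] [CompleteSpace Z]

/-- An operator and its adjoint have the same Hilbert–Schmidt norm, here between different spaces
and in arbitrary bases. -/
lemma summable_adjoint_sq {ι κ : Type*} (b : HilbertBasis ι ℂ H) (c : HilbertBasis κ ℂ Z)
    (S : H →L[ℂ] Z) (h : Summable fun i => ‖S (b i)‖ ^ 2) : Summable fun t => ‖(S†) (c t)‖ ^ 2 := by
  have h1 : HasSum (fun p : ι × κ => ‖⟪c p.2, S (b p.1)⟫_ℂ‖ ^ 2) _ :=
    hasSum_prod_of_nonneg (fun p => by positivity) (fun i => hasSum_norm_inner_sq c (S (b i)))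
      h.hasSum
  refine (HasSum.swap_fiberwise h1.summable (fun i => hasSum_norm_inner_sq c (S (b i)))
    (fun t => hasSum_of_eq (hasSum_norm_inner_sq b ((S†) (c t))) (fun i => ?_) rfl)
    h.hasSum).summable
  rw [ContinuousLinearMap.adjoint_inner_right, ← inner_conj_symm, RCLike.norm_conj]

/-- The rank-one terms come from inserting the basis c into ⟨S u, S' v⟩. The diagonal operators A₁
and A₂, being trace class, make S and S' Hilbert–Schmidt. -/
lemma isSumRankOne_of_gram {κ : Type*} (c : HilbertBasis κ ℂ Z) {A A₁ A₂ : TraceClass H}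
    {S S' : H →L[ℂ] Z} (h : ∀ u v, ⟪u, (A : H →L[ℂ] H) v⟫_ℂ = ⟪S u, S' v⟫_ℂ)
    (h₁ : ∀ u v, ⟪u, (A₁ : H →L[ℂ] H) v⟫_ℂ = ⟪S u, S v⟫_ℂ)
    (h₂ : ∀ u v, ⟪u, (A₂ : H →L[ℂ] H) v⟫_ℂ = ⟪S' u, S' v⟫_ℂ) :
    IsSumRankOne (A : H →L[ℂ] H) (fun t => (S†) (c t)) fun t => (S'†) (c t) := by
  have key : ∀ (B : TraceClass H) (R : H →L[ℂ] Z),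
      (∀ u v, ⟪u, (B : H →L[ℂ] H) v⟫_ℂ = ⟪R u, R v⟫_ℂ) →
      Summable fun t => ‖(R†) (c t)‖ ^ 2 := fun B R hR => by
    refine summable_adjoint_sq (fixedBasis H) c R ?_
    refine (Complex.hasSum_re (hasSum_trace_basis B.2 1 (fixedBasis H))).summable.congr fun i => ?_
    rw [ContinuousLinearMap.one_apply, hR]
    exact inner_self_eq_norm_sq (𝕜 := ℂ) (R (fixedBasis H i))
  refine ⟨key A₁ S h₁, key A₂ S' h₂, fun u v => ?_⟩
  refine hasSum_of_eq (c.hasSum_inner_mul_inner (S u) (S' v)) (fun t => ?_) (h u v)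
  rw [ContinuousLinearMap.adjoint_inner_left, ContinuousLinearMap.adjoint_inner_right]

/-- The images of matrix units are simultaneously sums of rank-one operators. -/
lemma Channel.exists_isSumRankOne_ketBra (Φ : Channel H K) {k : ℕ} (x : Fin k → H) :
    ∃ y : Fin k → basisIndex (PiLp 2 fun _ : Fin k => K) → K, ∀ i j,
      IsSumRankOne (Φ.toLin (ketBra (x i) (x j)) : K →L[ℂ] K) (y i) (y j) := by
  obtain ⟨S, hS⟩ := Φ.exists_gram_ketBra x
  exact ⟨fun i t => ((S i)†) (fixedBasis _ t), fun i j =>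
    isSumRankOne_of_gram (fixedBasis _) (hS i j) (hS i i) (hS j j)⟩

/-- The Heisenberg picture: the right side is a bounded sesquilinear form in z' and z, hence
represented by an operator. -/
lemma Channel.exists_dual (D : Channel H K) (x x' : K) :
    ∃ Λ : H →L[ℂ] H, ∀ z z', ⟪z', Λ z⟫_ℂ = ⟪x, (D.toLin (ketBra z z') : K →L[ℂ] K) x'⟫_ℂ := by
  let f : H →ₗ⋆[ℂ] H →ₗ[ℂ] ℂ := LinearMap.mk₂'ₛₗ (starRingEnd ℂ) (RingHom.id ℂ)
    (fun z' z => ⟪x, (D.toLin (ketBra z z') : K →L[ℂ] K) x'⟫_ℂ)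
    (fun z z' w => by simp [ketBra_add_right, inner_add_right])
    (fun a z w => by simp [ketBra_smul_right, inner_smul_right])
    (fun w z z' => by simp [ketBra_add_left, inner_add_right])
    (fun a w z => by simp [ketBra_smul_left, inner_smul_right])
  let F : H →L⋆[ℂ] H →L[ℂ] ℂ := f.mkContinuous₂ (‖x‖ * ‖x'‖) fun z' z => by
    refine (D.norm_inner_ketBra_le z z' x x').trans (le_of_eq ?_)
    ring
  refine ⟨ContinuousLinearMap.adjoint (InnerProductSpace.continuousLinearMapOfBilin F),
    fun z z' => ?_⟩
  rw [ContinuousLinearMap.adjoint_inner_right, InnerProductSpace.continuousLinearMapOfBilin_apply]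
  rfl

/-- The matrix elements of a decoder are given by the operators `κₘ`. -/
lemma Channel.exists_decoder_gram {M : ℕ} (D : Channel H (Qudit M)) :
    ∃ κ : Fin M → (H →L[ℂ] PiLp 2 fun _ : Fin M => H), IsKrausFamily κ ∧ ∀ m m' z z',
      ⟪EuclideanSpace.basisFun (Fin M) ℂ m, (D.toLin (ketBra z z') : Qudit M →L[ℂ] Qudit M)
        (EuclideanSpace.basisFun (Fin M) ℂ m')⟫_ℂ = ⟪κ m' z', κ m z⟫_ℂ := by
  let e := EuclideanSpace.basisFun (Fin M) ℂ
  -- The index order is reversed, because ⟨z', Λ z⟩ involves |z⟩⟨z'|; in this order complete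
  -- positivity of D makes the family Λ block positive.
  choose Λ hΛ using fun m' m => D.exists_dual (e m) (e m')
  obtain ⟨κ, hκ⟩ := exists_gram Λ fun z => by
    rw [Finset.sum_comm]
    simp only [hΛ]
    exact D.completelyPositive M _ (Channel.blockPositive_ketBra z) e
  have hD : ∀ m m' z z', ⟪e m, (D.toLin (ketBra z z') : Qudit M →L[ℂ] Qudit M) (e m')⟫_ℂ =
      ⟪κ m' z', κ m z⟫_ℂ := fun m m' z z' => by rw [← hκ, hΛ]
  refine ⟨κ, fun z => ?_, hD⟩
  -- Trace preservation of D, evaluated on |z⟩⟨z|, is the completeness relation for κ.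
  have h1 := hasSum_trace_basis (D.toLin (ketBra z z)).2 1 e.toHilbertBasis
  rw [one_mul, D.tracePreserving, coe_ketBra, trace_rankOne] at h1
  refine hasSum_of_eq (Complex.hasSum_re h1) (fun m => ?_)
    (inner_self_eq_norm_sq (𝕜 := ℂ) z).symm
  rw [OrthonormalBasis.coe_toHilbertBasis, ContinuousLinearMap.one_apply, hD]
  exact (inner_self_eq_norm_sq (𝕜 := ℂ) _).symm

end Gram

/-! ### From entanglement transmission to secret keys -/

section Decoupling

variable {H K E Z : Type*} [NormedAddCommGroup H] [InnerProductSpace ℂ H] [CompleteSpace H]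
  [NormedAddCommGroup K] [InnerProductSpace ℂ K] [CompleteSpace K]
  [NormedAddCommGroup E] [InnerProductSpace ℂ E] [CompleteSpace E]
  [NormedAddCommGroup Z] [InnerProductSpace ℂ Z] [CompleteSpace Z]

/-- A Kraus family and an orthonormal basis of its target space yield a Parseval frame. -/
lemma IsKrausFamily.isParseval {L J : Type*} [Fintype L] {κ : L → K →L[ℂ] Z}
    (hκ : IsKrausFamily κ) (ζ : HilbertBasis J ℂ Z) :
    IsParseval fun p : L × J => ((κ p.1)†) (ζ p.2) := fun x y => by
  have h1 : ∑ l, ⟪κ l x, κ l y⟫_ℂ = ⟪x, y⟫_ℂ := by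
    have := (hκ.hasSum_inner x y).tsum_eq
    rwa [tsum_fintype] at this
  rw [← h1]
  refine hasSum_prod_fintype fun l => hasSum_of_eq (ζ.hasSum_inner_mul_inner (κ l x) (κ l y))
    (fun s => ?_) rfl
  rw [ContinuousLinearMap.adjoint_inner_left, ContinuousLinearMap.adjoint_inner_right]

lemma IsParseval.hasSum_norm_sq {W : Type*} {w : W → K} (hw : IsParseval w) (x : K) :
    HasSum (fun s => ‖⟪w s, x⟫_ℂ‖ ^ 2) (‖x‖ ^ 2) := by
  refine hasSum_of_eq (Complex.hasSum_re (hw x x)) (fun s => ?_)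
    (inner_self_eq_norm_sq (𝕜 := ℂ) x).symm
  rw [← inner_conj_symm x (w s), ← Complex.normSq_eq_conj_mul_self, Complex.ofReal_re,
    Complex.normSq_eq_norm_sq]

variable {I W : Type*} {c : HilbertBasis I ℂ E} {S : I → H →L[ℂ] K}

/-- Both ∑_s ‖R_s y‖² and ∑_f ‖S_f y‖² are iterated sums of |⟨w_s, S_f y⟩|², taken in opposite
orders. -/
lemma IsParseval.isKrausFamily_slice {w : W → K} (hw : IsParseval w) (hS : IsKrausFamily S)
    {R : W → H →L[ℂ] E} (hR : ∀ s f y, ⟪c f, R s y⟫_ℂ = ⟪w s, S f y⟫_ℂ) : IsKrausFamily R :=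
  fun y => by
    have h1 : HasSum (fun p : I × W => ‖⟪w p.2, S p.1 y⟫_ℂ‖ ^ 2) (‖y‖ ^ 2) :=
      hasSum_prod_of_nonneg (fun p => by positivity) (fun f => hw.hasSum_norm_sq (S f y)) (hS y)
    refine HasSum.swap_fiberwise h1.summable (fun f => hw.hasSum_norm_sq (S f y)) (fun s => ?_) (hS y)
    exact hasSum_of_eq (hasSum_norm_inner_sq c (R s y)) (fun f => by rw [hR]) rfl

/-- Inner products of slices, summed over a basis of the sliced space. -/
lemma hasSum_inner_slice {J : Type*} (hS : IsKrausFamily S) (ζ : HilbertBasis J ℂ Z)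
    {κ κ' : K →L[ℂ] Z} {R R' : J → H →L[ℂ] E}
    (hR : ∀ s f y, ⟪c f, R s y⟫_ℂ = ⟪(κ†) (ζ s), S f y⟫_ℂ)
    (hR' : ∀ s f y, ⟪c f, R' s y⟫_ℂ = ⟪(κ'†) (ζ s), S f y⟫_ℂ) (y y' : H) {a : ℂ}
    (ha : HasSum (fun f => ⟪κ' (S f y'), κ (S f y)⟫_ℂ) a) :
    HasSum (fun s => ⟪R' s y', R s y⟫_ℂ) a := by
  have hsum : ∀ (T : K →L[ℂ] Z) (z : H),
      Summable fun p : I × J => ‖⟪ζ p.2, T (S p.1 z)⟫_ℂ‖ ^ 2 := fun T z =>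
    (hasSum_prod_of_nonneg (fun p => by positivity)
      (fun f => hasSum_norm_inner_sq ζ (T (S f z)))
      (Summable.norm_sq_map (hS z).summable T).hasSum).summable
  have hF : Summable fun p : I × J => ⟪κ' (S p.1 y'), ζ p.2⟫_ℂ * ⟪ζ p.2, κ (S p.1 y)⟫_ℂ := by
    refine Summable.of_norm ((summable_mul_of_sq (hsum κ' y') (hsum κ y)).congr fun p => ?_)
    rw [norm_mul, ← inner_conj_symm (κ' (S p.1 y')), RCLike.norm_conj]
  refine HasSum.swap_fiberwise hF (fun f => ζ.hasSum_inner_mul_inner (κ' (S f y')) (κ (S f y)))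
    (fun s => ?_) ha
  refine hasSum_of_eq (c.hasSum_inner_mul_inner (R' s y') (R s y)) (fun f => ?_) rfl
  rw [hR, ← inner_conj_symm (R' s y'), hR', ContinuousLinearMap.adjoint_inner_left,
    ContinuousLinearMap.adjoint_inner_left, inner_conj_symm]

/-- The matrix elements of the decoded operator, in terms of the slices. -/
lemma inner_decoder_eq {T J : Type*} {N : Channel H K} (hS : IsKrausFamily S) (hN : N.HasKraus S)
    {Q : Type*} [NormedAddCommGroup Q] [InnerProductSpace ℂ Q] [CompleteSpace Q]
    (D : Channel K Q) {q q' : Q} {κ κ' : K →L[ℂ] Z}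
    (hD : ∀ z z', ⟪q, (D.toLin (ketBra z z') : Q →L[ℂ] Q) q'⟫_ℂ = ⟪κ' z', κ z⟫_ℂ)
    (ζ : HilbertBasis J ℂ Z) {R R' : J → H →L[ℂ] E}
    (hR : ∀ s f y, ⟪c f, R s y⟫_ℂ = ⟪(κ†) (ζ s), S f y⟫_ℂ)
    (hR' : ∀ s f y, ⟪c f, R' s y⟫_ℂ = ⟪(κ'†) (ζ s), S f y⟫_ℂ)
    {X : TraceClass H} {y y' : T → H} (hX : IsSumRankOne (X : H →L[ℂ] H) y y')
    {v v' : lp (fun _ : T × J => E) 2} (hv : ∀ p, v p = R p.2 (y p.1))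
    (hv' : ∀ p, v' p = R' p.2 (y' p.1)) :
    ⟪q, (D.toLin (N.toLin X) : Q →L[ℂ] Q) q'⟫_ℂ = ⟪v', v⟫_ℂ := by
  have h1 : HasSum (fun p : T × I => ⟪κ' (S p.2 (y' p.1)), κ (S p.2 (y p.1))⟫_ℂ)
      ⟪q, (D.toLin (N.toLin X) : Q →L[ℂ] Q) q'⟫_ℂ :=
    hasSum_of_eq (D.hasSum_inner (hN.isSumRankOne hS hX) q q') (fun p => (hD _ _).symm) rfl
  have hs : ∀ t, Summable fun f => ⟪κ' (S f (y' t)), κ (S f (y t))⟫_ℂ := fun t =>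
    h1.summable.prod_factor t
  have h2 := h1.prod_fiberwise fun t => (hs t).hasSum
  have h3 : HasSum (fun p : T × J => ⟪R' p.2 (y' p.1), R p.2 (y p.1)⟫_ℂ) ⟪v', v⟫_ℂ :=
    hasSum_of_eq (lp.hasSum_inner (𝕜 := ℂ) v' v) (fun p => by rw [hv, hv']) rfl
  exact h2.unique (h3.prod_fiberwise fun t =>
    hasSum_inner_slice hS ζ hR hR' (y t) (y' t) (hs t).hasSum)

/-- The vector of `ℓ²` with components `R s (y t)`. -/
lemma exists_lp_slice {T J : Type*} {R : J → H →L[ℂ] E} {y : T → H}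
    (h : Summable fun p : T × J => ‖R p.2 (y p.1)‖ ^ 2) :
    ∃ v : lp (fun _ : T × J => E) 2, ∀ p, v p = R p.2 (y p.1) :=
  ⟨⟨fun p => R p.2 (y p.1), memℓp_gen (by simpa using h)⟩, fun _ => rfl⟩

/-- The slices of a Kraus family along a Parseval frame. -/
lemma exists_slice_kraus {Nc : Channel H E} (hS : IsKrausFamily S)
    (hNc : IsKrausComplement c S Nc) {w : W → K} (hw : IsParseval w) :
    ∃ R : W → H →L[ℂ] E, IsKrausFamily R ∧ Nc.HasKraus R ∧
      ∀ s f y, ⟪c f, R s y⟫_ℂ = ⟪w s, S f y⟫_ℂ := by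
  choose R hR using fun s => hS.exists_slice c (w s)
  have hRK : IsKrausFamily R := hw.isKrausFamily_slice hS hR
  refine ⟨R, hRK, ?_, hR⟩
  have := hNc.toLin_eq ((krausChannel_hasKraus hRK).isKrausComplement hw hR)
  intro A u v
  rw [this]
  exact krausChannel_hasKraus hRK A u v

lemma injective_mk_mid {T L J : Type*} (l : L) :
    Function.Injective fun p : T × J => (p.1, (l, p.2)) := fun p q hpq => by
  simp only [Prod.mk.injEq, true_and] at hpq
  exact Prod.ext hpq.1 hpq.2

lemma Summable.comp_mk_mid {T L J : Type*} {F : T × (L × J) → ℝ} (hF : Summable F) (l : L) :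
    Summable fun p : T × J => F (p.1, (l, p.2)) :=
  hF.comp_injective (injective_mk_mid l)

/-- If a channel can be decoded, the images of the basis states under the complementary channel
come from vectors whose inner products give the entanglement fidelity. -/
lemma exists_environment_vectors {T J : Type*} {N : Channel H K} {Nc : Channel H E}
    (hS : IsKrausFamily S) (hN : N.HasKraus S) (hNc : IsKrausComplement c S Nc) {M : ℕ}
    (Ec : Channel (Qudit M) H) (D : Channel K (Qudit M)) {e : Fin M → Qudit M}
    (he : ∀ m, ‖e m‖ = 1) {y : Fin M → T → H}
    (hy : ∀ m m', IsSumRankOne (Ec.toLin (ketBra (e m) (e m')) : H →L[ℂ] H) (y m) (y m'))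
    {κ : Fin M → K →L[ℂ] Z} (hκ : IsKrausFamily κ)
    (hD : ∀ m m' z z', ⟪e m, (D.toLin (ketBra z z') : Qudit M →L[ℂ] Qudit M) (e m')⟫_ℂ =
      ⟪κ m' z', κ m z⟫_ℂ) (ζ : HilbertBasis J ℂ Z) :
    ∃ v : Fin M → lp (fun _ : T × J => E) 2,
      (∀ m, ‖v m‖ ≤ 1 ∧ tnorm (Nc.toLin (Ec.toLin (ketBra (e m) (e m))) - lpState (v m)) =
        1 - ‖v m‖ ^ 2) ∧
      ∀ m m', pairFid (D.comp (N.comp Ec)).toLin (e m) (e m') = ⟪v m', v m⟫_ℂ := by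
  -- The frame consists of the vectors κ_l† ζ_s, so the environment Kraus operators carry the label
  -- l of the decoder output.
  obtain ⟨R, hRK, hNR, hR⟩ := exists_slice_kraus hS hNc (hκ.isParseval ζ)
  have hsum : ∀ m, Summable fun p : T × J => ‖R (m, p.2) (y m p.1)‖ ^ 2 := fun m =>
    Summable.comp_mk_mid (F := fun q : T × (Fin M × J) => ‖R q.2 (y m q.1)‖ ^ 2)
      (hRK.summable_prod (hy m m).left) m
  -- For input m only the slices labelled m are kept: v_m describes the event that the decoder
  -- returns m, and ‖v_m‖² is the probability of this event. The remaining slices make up the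
  -- positive difference between the true environment state and the reduction of v_m.
  choose v hv using fun m => exists_lp_slice (R := fun s => R (m, s)) (hsum m)
  refine ⟨v, fun m => ?_, fun m m' => ?_⟩
  · exact (Nc.isState (Ec.isState (isState_ketBra (he m)))).tnorm_sub_lpState
      (hNR.isSumRankOne hRK (hy m m)) (v m) (injective_mk_mid m) (hv m)
  · exact inner_decoder_eq hS hN D (hD m m') ζ
      (fun s => hR (m, s)) (fun s => hR (m', s)) (hy m m') (hv m) (hv _)

/-- If a channel can be decoded, its complementary channel is almost constant. -/
lemma exists_decoupling {N : Channel H K} {Nc : Channel H E} (hS : IsKrausFamily S)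
    (hN : N.HasKraus S) (hNc : IsKrausComplement c S Nc) {M : ℕ} (hM : 0 < M)
    (Ec : Channel (Qudit M) H) (D : Channel K (Qudit M)) {ε : ℝ}
    (hF : 1 - ε ≤ fidelity (maxEntangled M)
      (idTensor (D.comp (N.comp Ec)).toLin (maxEntangled M))) :
    ∃ σ : TraceClass E, (1 / M : ℝ) * ∑ m, tnorm (Nc.toLin (Ec.toLin
      (ketBra (EuclideanSpace.basisFun (Fin M) ℂ m) (EuclideanSpace.basisFun (Fin M) ℂ m))) - σ) ≤
        2 * √ε + ε := by
  have hM' : (0 : ℝ) < M := by exact_mod_cast hM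
  have hMC : (M : ℂ) ≠ 0 := by exact_mod_cast hM.ne'
  let e := EuclideanSpace.basisFun (Fin M) ℂ
  obtain ⟨κ, hκ, hD⟩ := D.exists_decoder_gram
  obtain ⟨y, hy⟩ := Ec.exists_isSumRankOne_ketBra e
  obtain ⟨v, hb, hpair⟩ := exists_environment_vectors hS hN hNc Ec D (e := e) e.orthonormal.1 hy
    hκ hD (fixedBasis _)
  -- The squared norm of the mean is M⁻² times the sum of all ⟨v_m', v_m⟩, which is the entanglement
  -- fidelity.
  obtain ⟨r, hr⟩ : ∃ r, r = (M : ℂ)⁻¹ • ∑ m, v m := ⟨_, rfl⟩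
  have hr' : ∑ m, v m = (M : ℂ) • r := by rw [hr, smul_smul, mul_inv_cancel₀ hMC, one_smul]
  have hrn : 1 - ε ≤ ‖r‖ ^ 2 := by
    refine hF.trans (le_of_eq ?_)
    rw [fidelity_maxEntangled _ hM e]
    simp only [hpair]
    have h1 : ∑ m, ∑ m', ⟪v m', v m⟫_ℂ = ⟪∑ m, v m, ∑ m, v m⟫_ℂ := by
      rw [inner_sum]
      exact Finset.sum_congr rfl fun m _ => (sum_inner _ _ _).symm
    have h2 : (⟪∑ m, v m, ∑ m, v m⟫_ℂ).re = ‖∑ m, v m‖ ^ 2 :=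
      inner_self_eq_norm_sq (𝕜 := ℂ) (∑ m, v m)
    rw [h1, h2, hr, norm_smul, mul_pow]
    simp
  -- The reduction of r is only a positive operator, in general of trace below 1; a genuine state is
  -- substituted in `exists_mean_state`.
  refine ⟨lpState r, le_trans ?_ (mean_dist_le hM v (fun m => (hb m).1) hr' hrn)⟩
  refine mul_le_mul_of_nonneg_left (Finset.sum_le_sum fun m _ => ?_) (by positivity)
  have hr1 : ‖r‖ ≤ 1 := by
    rw [hr, norm_smul, norm_inv, Complex.norm_natCast, inv_mul_le_iff₀ hM', mul_one]
    refine (norm_sum_le _ _).trans ?_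
    calc ∑ m, ‖v m‖ ≤ ∑ _m : Fin M, (1 : ℝ) := Finset.sum_le_sum fun m _ => (hb m).1
      _ = M := by simp
  have h3 := tnorm_lpState_sub_le (v m) r
  have h4 := tnorm_add_le (Nc.toLin (Ec.toLin (ketBra (e m) (e m))) - lpState (v m))
    (lpState (v m) - lpState r)
  rw [sub_add_sub_cancel, (hb m).2] at h4
  have h5 := (hb m).1
  have h6 : ‖v m - r‖ * (‖v m‖ + ‖r‖) ≤ ‖v m - r‖ * 2 :=
    mul_le_mul_of_nonneg_left (by linarith) (norm_nonneg _)
  calc _ ≤ _ := h4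
    _ ≤ _ := by linarith

/-- The measurement of the decoded system in the computational basis. -/
lemma Channel.exists_povm {M : ℕ} (D : Channel K (Qudit M)) :
    ∃ Λ : Fin M → K →L[ℂ] K, IsPOVM Λ ∧ ∀ (X : TraceClass K) m, trace (Λ m * (X : K →L[ℂ] K)) =
      ⟪EuclideanSpace.basisFun (Fin M) ℂ m, (D.toLin X : Qudit M →L[ℂ] Qudit M)
        (EuclideanSpace.basisFun (Fin M) ℂ m)⟫_ℂ := by
  obtain ⟨κ, hκ, hD⟩ := D.exists_decoder_gram
  have hi : ∀ m u v, ⟪u, ((κ m)† ∘L κ m) v⟫_ℂ = ⟪κ m u, κ m v⟫_ℂ := fun m u v => by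
    rw [ContinuousLinearMap.comp_apply, ContinuousLinearMap.adjoint_inner_right]
  refine ⟨fun m => (κ m)† ∘L κ m, ⟨fun m => ?_, ?_⟩, fun X m => ?_⟩
  · rw [nonneg_iff_inner]
    intro x
    rw [hi]
    exact inner_self_nonneg_complex _
  · refine ext_of_inner fun u v => ?_
    rw [ContinuousLinearMap.sum_apply, inner_sum, ContinuousLinearMap.one_apply]
    simp only [hi]
    have := (hκ.hasSum_inner u v).tsum_eq
    rwa [tsum_fintype] at this
  · obtain ⟨a, a', ha⟩ := exists_isSumRankOne_of_mem X.2
    refine (ha.hasSum_trace_mul _).unique (hasSum_of_eq (D.hasSum_inner ha _ _) (fun t => ?_) rfl)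
    rw [hi, hD]

/-- The mean of states is a state which is, on average, at most twice as far from them as any
other operator. -/
lemma exists_mean_state {M : ℕ} (hM : 0 < M) {ρ : Fin M → TraceClass E} (hρ : ∀ m, IsState (ρ m))
    (σ : TraceClass E) {δ : ℝ} (h : (1 / M : ℝ) * ∑ m, tnorm (ρ m - σ) ≤ δ) :
    ∃ ω : TraceClass E, IsState ω ∧ (1 / M : ℝ) * ∑ m, 1 / 2 * tnorm (ρ m - ω) ≤ δ := by
  have hM' : (0 : ℝ) < M := by exact_mod_cast hM
  have hMC : (M : ℂ) ≠ 0 := by exact_mod_cast hM.ne'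
  have hinv : (0 : ℂ) ≤ (M : ℂ)⁻¹ := by
    rw [← Complex.ofReal_natCast, ← Complex.ofReal_inv]
    exact Complex.zero_le_real.2 (by positivity)
  set ω : TraceClass E := (M : ℂ)⁻¹ • ∑ m, ρ m with hω
  have hst : IsState ω := by
    refine ⟨?_, ?_⟩
    · rw [nonneg_iff_inner]
      intro x
      rw [hω, Submodule.coe_smul, AddSubmonoidClass.coe_finset_sum, ContinuousLinearMap.smul_apply,
        inner_smul_right, ContinuousLinearMap.sum_apply, inner_sum]
      exact mul_nonneg hinv (Finset.sum_nonneg fun m _ => nonneg_iff_inner.1 (hρ m).1 x)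
    · rw [← traceL_one, hω, map_smul, map_sum]
      simp only [traceL_one, (hρ _).2]
      simp [hMC]
  refine ⟨ω, hst, ?_⟩
  have h1 : σ - ω = (M : ℂ)⁻¹ • ∑ m, (σ - ρ m) := by
    rw [Finset.sum_sub_distrib, smul_sub, ← hω, Finset.sum_const, Finset.card_univ,
      Fintype.card_fin, ← Nat.cast_smul_eq_nsmul ℂ, smul_smul, inv_mul_cancel₀ hMC, one_smul]
  have hsymm : ∀ m, tnorm (σ - ρ m) = tnorm (ρ m - σ) := fun m => by
    rw [← tnorm_neg, neg_sub]
  have h2 : tnorm (σ - ω) ≤ δ := by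
    rw [h1, tnorm_smul, norm_inv, Complex.norm_natCast, ← one_div]
    refine le_trans (mul_le_mul_of_nonneg_left (tnorm_sum_le _ _) (by positivity)) ?_
    simpa only [hsymm] using h
  -- The detour through σ doubles the mean distance, and the factor 1/2 of the trace distance
  -- compensates for it.
  have h3 : ∀ m, 1 / 2 * tnorm (ρ m - ω) ≤ 1 / 2 * tnorm (ρ m - σ) + 1 / 2 * δ := fun m => by
    have := tnorm_add_le (ρ m - σ) (σ - ω)
    rw [sub_add_sub_cancel] at this
    linarith
  rw [one_div (M : ℝ), inv_mul_eq_div, div_le_iff₀ hM'] at h ⊢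
  refine (Finset.sum_le_sum fun m _ => h3 m).trans ?_
  rw [Finset.sum_add_distrib, ← Finset.mul_sum, Finset.sum_const, Finset.card_univ,
    Fintype.card_fin, nsmul_eq_mul]
  linarith

end Decoupling

/-! ### Secret key codes from entanglement transmission codes. -/

section EntanglementKey

variable {ι HA HB HE : Type*}
  [NormedAddCommGroup HA] [InnerProductSpace ℂ HA] [CompleteSpace HA]
  [NormedAddCommGroup HB] [InnerProductSpace ℂ HB] [CompleteSpace HB]
  [NormedAddCommGroup HE] [InnerProductSpace ℂ HE] [CompleteSpace HE]
  {N : Channel HA HB} {Nc : Channel HA HE} {G : EnergyObservable ι HA} {P : ℝ}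

/-- Key values are sent as computational basis states and read off by measuring the decoded system.
Averaging over the basis reproduces the energy of the maximally mixed input, the mean success
probability is at least the entanglement fidelity, and secrecy is decoupling. -/
lemma EntanglementCode.secretKeyCode (hNc : IsComplementary N Nc) {n M : ℕ} {ε : ℝ} (hM : 0 < M)
    (h : EntanglementCode N G P n M ε) : SecretKeyCode N Nc G P n M (2 * √ε + ε) := by
  obtain ⟨Nn, hN, E, D, hE, hF⟩ := h
  have hMne : (M : ℝ≥0∞) ≠ 0 := by exact_mod_cast hM.ne'
  obtain ⟨Ncn, S, hNcn, hS, hNS, hcS⟩ := hNc.exists_tensorPower n hN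
  obtain ⟨σ, hσ⟩ := exists_decoupling hS hNS hcS hM E D hF
  obtain ⟨Λ, hΛ, hΛt⟩ := D.exists_povm
  let e := EuclideanSpace.basisFun (Fin M) ℂ
  have hst : ∀ m, IsState (E.toLin (ketBra (e m) (e m))) := fun m =>
    E.isState (isState_ketBra (e.orthonormal.1 m))
  obtain ⟨ω, hω, hωd⟩ := exists_mean_state hM (fun m => Ncn.isState (hst m)) σ hσ
  refine ⟨Nn, Ncn, hN, hNcn, fun m => E.toLin (ketBra (e m) (e m)), Λ, ω, hst, hΛ, hω, ?_, ?_, hωd⟩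
  · rw [sum_energy_ketBra _ hM E e, mul_comm]
    exact (ENNReal.mul_div_cancel_right hMne (ENNReal.natCast_ne_top M)).le.trans hE
  · have h1 := hF.trans (fidelity_maxEntangled_le (D.comp (Nn.comp E)) hM e)
    simp only [hΛt]
    have h2 := Real.sqrt_nonneg ε
    refine le_trans (by linarith) h1

lemma entanglementCapacity_le_secretKeyCapacity (hNc : IsComplementary N Nc) :
    entanglementCapacity N G P ≤ secretKeyCapacity N Nc G P :=
  capacity_mono fun ε h0 h1 => by
    -- Starting from the error (ε/4)², the bound 2√ε₀ + ε₀ becomes ε/2 + (ε/4)², which is below ε.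
    refine ⟨(ε / 4) ^ 2, by positivity, by nlinarith, 1, one_pos, fun n _ M hM hc =>
      ⟨M, by simp, ?_⟩⟩
    obtain ⟨Nn, Ncn, hN, hNcn, ρ, Λ, ω, hρ, hΛ, hω, hE, hs, hd⟩ := hc.secretKeyCode hNc hM
    rw [Real.sqrt_sq (by positivity)] at hs hd
    have hle : 2 * (ε / 4) + (ε / 4) ^ 2 ≤ ε := by nlinarith
    exact ⟨Nn, Ncn, hN, hNcn, ρ, Λ, ω, hρ, hΛ, hω, hE, by linarith, hd.trans hle⟩

end EntanglementKey

end

end QCap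

theorem mainTheorem3 {ι HA HB : Type*}
    [NormedAddCommGroup HA] [InnerProductSpace ℂ HA] [CompleteSpace HA]
    [TopologicalSpace.SeparableSpace HA]
    [NormedAddCommGroup HB] [InnerProductSpace ℂ HB] [CompleteSpace HB]
    [TopologicalSpace.SeparableSpace HB]
    (N : QCap.Channel HA HB) (G : QCap.EnergyObservable ι HA) (P : ℝ) (hP : 0 ≤ P) :
    QCap.quantumCapacity N G P = QCap.entanglementCapacity N G P ∧
    ∀ (HE : Type*) [NormedAddCommGroup HE] [InnerProductSpace ℂ HE] [CompleteSpace HE]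
      [TopologicalSpace.SeparableSpace HE] (Nc : QCap.Channel HA HE),
      QCap.IsComplementary N Nc →
        QCap.entanglementCapacity N G P ≤ QCap.privateCapacity N Nc G P ∧
        QCap.privateCapacity N Nc G P = QCap.secretKeyCapacity N Nc G P := by
  refine ⟨le_antisymm QCap.quantumCapacity_le_entanglementCapacity
    (QCap.entanglementCapacity_le_quantumCapacity hP), fun HE _ _ _ _ Nc hNc => ⟨?_, ?_⟩⟩
  -- Decoupling only gives averaged secrecy, so the route to the private capacity passes through the
  -- secret key capacity, expurgation restoring uniformity.
  · exact (QCap.entanglementCapacity_le_secretKeyCapacity hNc).trans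
      (QCap.secretKeyCapacity_le_privateCapacity hP)
  · exact le_antisymm QCap.privateCapacity_le_secretKeyCapacity
      (QCap.secretKeyCapacity_le_privateCapacity hP)
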